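/- Let $\mathcal H$ and $\mathcal X$ be (real or complex) Hilbert spaces and let $Y(t,s)\in\mathcal L(\mathcal H)$, $0\le s\le t<\infty$, be the evolution operator generated by $A_c(t)$: $Y(t,t)=I$, $Y(t,r)Y(r,s)=Y(t,s)$ for $0\le s\le r\le t$, $Y(\cdot,s)$ is strongly continuous on $[s,\infty)$ and $Y(t,\cdot)$ is strongly continuous on $[0,t]$. For $D:[0,\infty)\to\mathcal L(\mathcal H)$, the evolution operator generated by $A_c(t)+D(t)$ is an evolution operator $Y_D$ with $$Y_D(t,s)w=Y(t,s)w+\int_s^tY(t,r)D(r)Y_D(r,s)w\,dr,\qquad w\in\mathcal H,\ 0\le s\le t,$$ where the integrand is required to be integrable. An evolution operator $U$ is exponentially stable if there are $M\ge0$, $\alpha>0$ with $\|U(t,s)\|\le Me^{-\alpha(t-s)}$ for all $0\le s\le t$. Let $B_c:[0,\infty)\to\mathcal L(\mathcal X,\mathcal H)$, $W_c:[0,\infty)\to\mathcal L(\mathcal H)$ and $R_c:[0,\infty)\to\mathcal L(\mathcal X)$ be norm continuous and uniformly bounded, with $W_c(t)$ self-adjoint and nonnegative, $R_c(t)$ self-adjoint,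 and $(v,R_c(t)v)\ge\delta\|v\|^2$ for all $t\ge0$, $v\in\mathcal X$ and some $\delta>0$. Assume that * $(A_c(t),B_c(t))$ is uniformly stabilizable: for some norm continuous, uniformly bounded $K:[0,\infty)\to\mathcal L(\mathcal H,\mathcal X)$ there is an exponentially stable evolution operator generated by $A_c(t)+B_c(t)K(t)$; * $(A_c(t),W_c^{1/2}(t))$ is uniformly detectable: for some norm continuous, uniformly bounded $L:[0,\infty)\to\mathcal L(\mathcal H)$ there is an exponentially stable evolution operator generated by $A_c(t)+L(t)W_c^{1/2}(t)$. For $s\ge0$, $z_0\in\mathcal H$ and strongly measurable $u:[s,\infty)\to\mathcal X$ let $$J_\infty(u;z_0,s)=\int_s^\infty\big((z(r),W_c(r)z(r))+(u(r),R_c(r)u(r))\big)\,dr\in[0,\infty],\qquad z(t)=Y(t,s)z_0+\int_s^tY(t,r)B_c(r)u(r)\,dr$$ (the cost is $+\infty$ if $u$ is not square integrable). Then there are nonnegative self-adjoint operators $P_\infty(s)\in\mathcal L(\mathcal H)$, $s\ge0$, with $$\min_uJ_\infty(u;z_0,s)=(P_\infty(s)z_0,z_0)\qquad\text{for all }z_0\in\mathcal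 H,\ s\ge0.$$ For every such family $P_\infty$ and the optimal feedback $K_\infty(t)=R_c^{-1}(t)B_c^*(t)P_\infty(t)$, there is an evolution operator $Y_{-B_cK_\infty}(t,s)$ generated by $A_c(t)-B_c(t)K_\infty(t)$, and every such evolution operator is exponentially stable. -/

import Mathlib

open MeasureTheory Filter Topology

noncomputable section

namespace InfiniteHorizonLQ

/-! ### The nonnegative square root of a bounded nonnegative self-adjoint operator -/

/-- The coefficients of the power series `(1 - √(1 - x)) / 2 = ∑ c n * x ^ (n + 1)`. -/
def sqrtCoeff (n : ℕ) : ℝ := (catalan n : ℝ) / 4 ^ (n + 1)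

lemma sqrtCoeff_nonneg (n : ℕ) : 0 ≤ sqrtCoeff n := by
  unfold sqrtCoeff; positivity

lemma sqrtCoeff_succ (n : ℕ) :
    sqrtCoeff (n + 1) = ∑ p ∈ Finset.HasAntidiagonal.antidiagonal n, sqrtCoeff p.1 * sqrtCoeff p.2 := by
  unfold sqrtCoeff
  rw [catalan_succ', Nat.cast_sum, Finset.sum_div]
  refine Finset.sum_congr rfl fun p hp => ?_
  have h : p.1 + p.2 = n := Finset.HasAntidiagonal.mem_antidiagonal.1 hp
  rw [← h, Nat.cast_mul, div_mul_div_comm, ← pow_add]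
  congr 2
  ring

lemma sqrtCoeff_sum_le (N : ℕ) : ∑ n ∈ Finset.range N, sqrtCoeff n ≤ 1 / 2 := by
  induction N with
  | zero => simp
  | succ N ih =>
    have h0 : 0 ≤ ∑ n ∈ Finset.range N, sqrtCoeff n :=
      Finset.sum_nonneg fun n _ => sqrtCoeff_nonneg n
    have h1 : ∑ n ∈ Finset.range N, sqrtCoeff (n + 1)
        ≤ (∑ n ∈ Finset.range N, sqrtCoeff n) * ∑ n ∈ Finset.range N, sqrtCoeff n := by
      simp_rw [sqrtCoeff_succ]
      rw [Finset.sum_mul_sum, ← Finset.sum_product', ← Finset.sum_biUnion]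
      · refine Finset.sum_le_sum_of_subset_of_nonneg ?_ fun p _ _ =>
          mul_nonneg (sqrtCoeff_nonneg _) (sqrtCoeff_nonneg _)
        intro p hp
        simp only [Finset.mem_biUnion, Finset.mem_range, Finset.HasAntidiagonal.mem_antidiagonal,
          Finset.mem_product] at hp ⊢
        obtain ⟨a, ha, hp⟩ := hp
        omega
      · intro a _ b _ hab
        refine Finset.disjoint_left.2 fun p hp hq => hab ?_
        rw [Finset.HasAntidiagonal.mem_antidiagonal] at hp hq
        omega
    rw [Finset.sum_range_succ']
    have h2 : sqrtCoeff 0 = 1 / 4 := by norm_num [sqrtCoeff]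
    nlinarith

section Sqrt

variable {𝕜 H : Type*} [RCLike 𝕜] [NormedAddCommGroup H] [InnerProductSpace 𝕜 H] [CompleteSpace H]

lemma exists_sqrt_one_sub (A : H →L[𝕜] H) (hA : IsSelfAdjoint A) (hn : ‖A‖ ≤ 1) :
    ∃ S : H →L[𝕜] H, S.IsPositive ∧ S * S = 1 - A := by
  set f : ℕ → H →L[𝕜] H := fun n => (sqrtCoeff n : 𝕜) • A ^ (n + 1) with hf
  have hfn : ∀ n, ‖f n‖ ≤ sqrtCoeff n := fun n => by
    have h1 : ‖A ^ (n + 1)‖ ≤ 1 :=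
      (norm_pow_le' A n.succ_pos).trans (pow_le_one₀ (norm_nonneg _) hn)
    have h2 : ‖(sqrtCoeff n : 𝕜)‖ = sqrtCoeff n := by
      rw [RCLike.norm_ofReal, abs_of_nonneg (sqrtCoeff_nonneg n)]
    rw [hf]
    simp only [norm_smul, h2]
    nlinarith [sqrtCoeff_nonneg n]
  have hc : Summable sqrtCoeff := summable_of_sum_range_le sqrtCoeff_nonneg sqrtCoeff_sum_le
  have hfs : Summable fun n => ‖f n‖ := hc.of_nonneg_of_le (fun _ => norm_nonneg _) hfn
  set t : H →L[𝕜] H := ∑' n, f n with ht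
  have htn : ‖t‖ ≤ 1 / 2 :=
    (tsum_of_norm_bounded hc.hasSum hfn).trans
      (hc.tsum_le_of_sum_range_le sqrtCoeff_sum_le)
  have htt : t * t = ∑' n, f (n + 1) := by
    rw [ht, tsum_mul_tsum_eq_tsum_sum_antidiagonal_of_summable_norm hfs hfs]
    congr 1
    ext1 n
    simp only [hf]
    rw [sqrtCoeff_succ, RCLike.ofReal_sum, Finset.sum_smul]
    refine Finset.sum_congr rfl fun p hp => ?_
    have h : p.1 + p.2 = n := Finset.HasAntidiagonal.mem_antidiagonal.1 hp
    rw [smul_mul_smul_comm, ← pow_add, RCLike.ofReal_mul, ← h]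
    congr 2
    ring
  have ht1 : t = ((1 / 4 : ℝ) : 𝕜) • A + t * t := by
    rw [htt, ht, hfs.of_norm.tsum_eq_zero_add]
    have h2 : sqrtCoeff 0 = 1 / 4 := by norm_num [sqrtCoeff]
    simp only [hf, h2, zero_add, pow_one]
  have hts : IsSelfAdjoint t := by
    rw [IsSelfAdjoint, ht, tsum_star]
    congr 1
    ext1 n
    have : IsSelfAdjoint (f n) :=
      IsSelfAdjoint.smul (by simp [isSelfAdjoint_iff]) (hA.pow _)
    exact this
  refine ⟨1 - (t + t), ?_, ?_⟩
  · rw [ContinuousLinearMap.isPositive_def']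
    refine ⟨(IsSelfAdjoint.one _).sub (hts.add hts), fun x => ?_⟩
    rw [ContinuousLinearMap.reApplyInnerSelf_apply]
    have h1 : ‖inner 𝕜 (t x) x‖ ≤ 1 / 2 * ‖x‖ * ‖x‖ :=
      (norm_inner_le_norm _ _).trans
        (mul_le_mul_of_nonneg_right ((t.le_opNorm x).trans
          (mul_le_mul_of_nonneg_right htn (norm_nonneg _))) (norm_nonneg _))
    have h2 := (RCLike.re_le_norm (inner 𝕜 (t x) x)).trans h1
    simp only [sub_apply, add_apply, one_apply_eq_self, inner_sub_left,
      inner_add_left, map_sub, map_add, inner_self_eq_norm_sq]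
    nlinarith
  · have h4 : A = (4 : 𝕜) • (t - t * t) := by
      have : t - t * t = ((1 / 4 : ℝ) : 𝕜) • A := by
        nth_rewrite 1 [ht1]
        abel
      have h : (4 : 𝕜) * ((1 / 4 : ℝ) : 𝕜) = 1 := by
        rw [← RCLike.ofReal_ofNat 4, ← RCLike.ofReal_mul]
        norm_num
      rw [this, smul_smul, h, one_smul]
    rw [h4, show (4 : 𝕜) = ((4 : ℕ) : 𝕜) by norm_num, Nat.cast_smul_eq_nsmul]
    noncomm_ring

/-- Every bounded nonnegative self-adjoint operator has a nonnegative self-adjoint square root. -/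
theorem exists_isPositive_sqrt (T : H →L[𝕜] H) (hT : T.IsPositive) :
    ∃ S : H →L[𝕜] H, S.IsPositive ∧ S * S = T := by
  set c : ℝ := ‖T‖ + 1 with hc
  have hc0 : 0 < c := by positivity
  have hA : IsSelfAdjoint (1 - ((c⁻¹ : ℝ) : 𝕜) • T) :=
    (IsSelfAdjoint.one _).sub (IsSelfAdjoint.smul (by simp [isSelfAdjoint_iff]) hT.isSelfAdjoint)
  have hn : ‖1 - ((c⁻¹ : ℝ) : 𝕜) • T‖ ≤ 1 := by
    rw [ContinuousLinearMap.norm_eq_iSup_rayleighQuotient _ hA.isSymmetric]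
    refine ciSup_le fun x => ?_
    rcases eq_or_ne x 0 with rfl | hx
    · simp
    have hx0 : 0 < ‖x‖ ^ 2 := by positivity
    have h1 : 0 ≤ RCLike.re (inner 𝕜 (T x) x) := hT.re_inner_nonneg_left x
    have h2 : RCLike.re (inner 𝕜 (T x) x) ≤ c * ‖x‖ ^ 2 := by
      have := (RCLike.re_le_norm (inner 𝕜 (T x) x)).trans
        ((norm_inner_le_norm _ _).trans
          (mul_le_mul_of_nonneg_right (T.le_opNorm x) (norm_nonneg _)))
      nlinarith
    have h3 : c⁻¹ * RCLike.re (inner 𝕜 (T x) x) ≤ ‖x‖ ^ 2 := by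
      rw [inv_mul_le_iff₀ hc0]; exact h2
    have h4 : 0 ≤ c⁻¹ * RCLike.re (inner 𝕜 (T x) x) := by positivity
    have h5 : (1 - ((c⁻¹ : ℝ) : 𝕜) • T).reApplyInnerSelf x
        = ‖x‖ ^ 2 - c⁻¹ * RCLike.re (inner 𝕜 (T x) x) := by
      rw [ContinuousLinearMap.reApplyInnerSelf_apply]
      simp only [sub_apply, smul_apply, one_apply_eq_self, inner_sub_left,
        inner_smul_left, map_sub, inner_self_eq_norm_sq, RCLike.conj_ofReal, RCLike.re_ofReal_mul]
    rw [ContinuousLinearMap.rayleighQuotient, h5, abs_of_nonneg (div_nonneg (by linarith) hx0.le),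
      div_le_one hx0]
    linarith
  obtain ⟨S, hS, hSS⟩ := exists_sqrt_one_sub _ hA hn
  refine ⟨((√c : ℝ) : 𝕜) • S, hS.smul_of_nonneg (by simp), ?_⟩
  rw [smul_mul_smul_comm, hSS, sub_sub_cancel, smul_smul, ← RCLike.ofReal_mul, ← RCLike.ofReal_mul,
    Real.mul_self_sqrt hc0.le, mul_inv_cancel₀ hc0.ne', RCLike.ofReal_one, one_smul]

/-- The nonnegative self-adjoint square root `T ^ (1/2)` of a nonnegative self-adjoint bounded
operator `T` (which is unique), and `0` if `T` is not nonnegative. -/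
def posSqrt (T : H →L[𝕜] H) : H →L[𝕜] H :=
  open scoped Classical in
  if hT : T.IsPositive then (exists_isPositive_sqrt T hT).choose else 0

lemma posSqrt_isPositive {T : H →L[𝕜] H} (hT : T.IsPositive) : (posSqrt T).IsPositive := by
  rw [posSqrt, dif_pos hT]
  exact (exists_isPositive_sqrt T hT).choose_spec.1

lemma posSqrt_mul_self {T : H →L[𝕜] H} (hT : T.IsPositive) : posSqrt T * posSqrt T = T := by
  rw [posSqrt, dif_pos hT]
  exact (exists_isPositive_sqrt T hT).choose_spec.2

end Sqrt

/-! ### Evolution operators on `0 ≤ s ≤ t < ∞` -/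

section Evolution

variable {𝕜 H : Type*} [RCLike 𝕜] [NormedAddCommGroup H] [InnerProductSpace 𝕜 H]

/-- `U t s`, `0 ≤ s ≤ t`, is an evolution operator (values at other `(t, s)` are irrelevant). -/
structure IsEvolutionOperator (U : ℝ → ℝ → H →L[𝕜] H) : Prop where
  refl : ∀ t, 0 ≤ t → U t t = ContinuousLinearMap.id 𝕜 H
  comp : ∀ s r t, 0 ≤ s → s ≤ r → r ≤ t → U t r ∘L U r s = U t s
  continuousOn_left : ∀ s, 0 ≤ s → ∀ x, ContinuousOn (fun t => U t s x) (Set.Ici s)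
  continuousOn_right : ∀ t, 0 ≤ t → ∀ x, ContinuousOn (fun s => U t s x) (Set.Icc 0 t)

/-- Exponential stability: `‖U t s‖ ≤ M * exp (-α (t - s))` for all `0 ≤ s ≤ t`. -/
def IsExponentiallyStable (U : ℝ → ℝ → H →L[𝕜] H) : Prop :=
  ∃ M α : ℝ, 0 ≤ M ∧ 0 < α ∧
    ∀ s t, 0 ≤ s → s ≤ t → ‖U t s‖ ≤ M * Real.exp (-α * (t - s))

variable [NormedSpace ℝ H]

/-- `V` is the evolution operator obtained from the evolution operator `Y` by the bounded
perturbation `D` of its generator: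
`V t s w = Y t s w + ∫ r in s..t, Y t r (D r (V r s w))` for `0 ≤ s ≤ t`. -/
structure IsPerturbedEvolution (Y : ℝ → ℝ → H →L[𝕜] H) (D : ℝ → H →L[𝕜] H)
    (V : ℝ → ℝ → H →L[𝕜] H) : Prop where
  isEvolutionOperator : IsEvolutionOperator V
  intervalIntegrable : ∀ s t, 0 ≤ s → s ≤ t → ∀ w,
    IntervalIntegrable (fun r => Y t r (D r (V r s w))) volume s t
  eq_add_integral : ∀ s t, 0 ≤ s → s ≤ t → ∀ w,
    V t s w = Y t s w + ∫ r in s..t, Y t r (D r (V r s w))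

end Evolution

/-- The operator-valued function `F` is norm continuous and uniformly bounded on `[0, ∞)`. -/
def IsBoundedContinuous {E : Type*} [NormedAddCommGroup E] (F : ℝ → E) : Prop :=
  ContinuousOn F (Set.Ici 0) ∧ ∃ c : ℝ, ∀ t, 0 ≤ t → ‖F t‖ ≤ c

section Control

variable {𝕜 H X : Type*} [RCLike 𝕜]
  [NormedAddCommGroup H] [InnerProductSpace 𝕜 H] [NormedSpace ℝ H]
  [NormedAddCommGroup X] [InnerProductSpace 𝕜 X]

/-- `(A, C)` is uniformly detectable, where `A` generates the evolution operator `Y`. -/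
def IsUniformlyDetectable (Y : ℝ → ℝ → H →L[𝕜] H) (C : ℝ → H →L[𝕜] X) : Prop :=
  ∃ L : ℝ → X →L[𝕜] H, IsBoundedContinuous L ∧
    ∃ YL, IsPerturbedEvolution Y (fun t => L t ∘L C t) YL ∧ IsExponentiallyStable YL

/-- `(A, B)` is uniformly stabilizable, where `A` generates the evolution operator `Y`. -/
def IsUniformlyStabilizable (Y : ℝ → ℝ → H →L[𝕜] H) (B : ℝ → X →L[𝕜] H) : Prop :=
  ∃ K : ℝ → H →L[𝕜] X, IsBoundedContinuous K ∧
    ∃ YK, IsPerturbedEvolution Y (fun t => B t ∘L K t) YK ∧ IsExponentiallyStable YK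

/-- The state `z(t) = Y(t,s) z₀ + ∫ₛᵗ Y(t,r) B(r) u(r) dr` with initial value `z₀` at time `s`. -/
def trajectory (Y : ℝ → ℝ → H →L[𝕜] H) (B : ℝ → X →L[𝕜] H) (s : ℝ) (z₀ : H) (u : ℝ → X)
    (t : ℝ) : H :=
  Y t s z₀ + ∫ r in s..t, Y t r (B r (u r))

/-- The cost `∫ₛ^∞ ((z, W z) + (u, R u)) dr ∈ [0, ∞]` of the control `u` with initial value `z₀` at
time `s`. For nonnegative `W` and coercive `R` it is `∞` unless `u` is square integrable on
`[s, ∞)`. -/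
def infiniteCost (Y : ℝ → ℝ → H →L[𝕜] H) (B : ℝ → X →L[𝕜] H) (W : ℝ → H →L[𝕜] H)
    (R : ℝ → X →L[𝕜] X) (s : ℝ) (z₀ : H) (u : ℝ → X) : ENNReal :=
  ∫⁻ r in Set.Ici s, ENNReal.ofReal
    (RCLike.re (inner 𝕜 (trajectory Y B s z₀ u r) (W r (trajectory Y B s z₀ u r)))
      + RCLike.re (inner 𝕜 (u r) (R r (u r))))

/-- `P s` is, for each `s ≥ 0`, the optimal cost operator `P_∞(s)` of the infinite-horizon problem
started at time `s`: it is self-adjoint and nonnegative, and `(P s z₀, z₀)` is the minimum of the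
cost over all strongly measurable controls, for every initial value `z₀`. -/
def IsOptimalCostOperator (Y : ℝ → ℝ → H →L[𝕜] H) (B : ℝ → X →L[𝕜] H) (W : ℝ → H →L[𝕜] H)
    (R : ℝ → X →L[𝕜] X) (P : ℝ → H →L[𝕜] H) : Prop :=
  ∀ s, 0 ≤ s → (P s).IsPositive ∧
    ∀ z₀, IsLeast (infiniteCost Y B W R s z₀ ''
        {u | AEStronglyMeasurable u (volume.restrict (Set.Ici s))})
      (ENNReal.ofReal (RCLike.re (inner 𝕜 (P s z₀) z₀)))

/-- The feedback `K(t) = R(t)⁻¹ B(t)* P(t)`. -/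
def feedback [CompleteSpace H] [CompleteSpace X] (B : ℝ → X →L[𝕜] H) (R : ℝ → X →L[𝕜] X)
    (P : ℝ → H →L[𝕜] H) (t : ℝ) : H →L[𝕜] X :=
  (R t).inverse ∘L ContinuousLinearMap.adjoint (B t) ∘L P t

end Control

end InfiniteHorizonLQ

end

namespace InfiniteHorizonLQ

/-! The control weight is normalised away. With v = R^{1/2}u, B' = B R^{-1/2} and C = W^{1/2}, the
cost of u is the squared norm in L²(ℝ; H × X) of the signal φ = (Cz, v), extended by zero before s.
For fixed s the pairs (x, φ) of an initial value and a square integrable signal form a closed linear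
relation (`outputGraph`, `isClosed_outputGraph`), and the stabilizing feedback puts over each x a
signal of norm at most c‖x‖, with c independent of s. Minimising the cost means removing the
component along the fibre over zero, so the optimal signal is T(s)x with T(s) linear and bounded
(`exists_minimal_section`), and P(s) = T(s)*T(s).

Neither a Riccati equation nor any regularity of P in s is needed. The tail of an optimal signal is
optimal (`IsOptimalSignal.restrict`), so the optimal trajectories form an evolution operator V.
Testing the orthogonality of T(s)x against the response of the stable closed loop Z to a control h
of bounded support gives ∫⟨P V x, B'h⟩ + ∫⟨v, h⟩ = 0 (`IsOptimalSignal.integral_inner_add_eq_zero`).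
Hence v = -B'* P V x (`IsOptimalSignal.control_eq`), and V is generated by A - B'B'*P = A - B K_∞.

For stability, LCz is added and subtracted: an optimal trajectory is a mild solution for the stable
evolution operator of A + LC with forcing B'v - LCz. Both terms are controlled by the two components
of the signal, so the forcing has L² norm at most a constant times ‖x‖. Thus V(·,s)x is bounded and
square integrable uniformly in s, and Datko's criterion applies
(`isExponentiallyStable_of_integral_le`). Uniqueness of perturbed evolution operators, and of P by
its quadratic form, extends this to every admissible P and every closed loop.

Since Y is only separately strongly continuous, its bounds on the triangles 0 ≤ s ≤ t ≤ T have to be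
recovered from Z (`IsPerturbedEvolution.isLocallyBounded_base`). -/

/-! ### Measurability of operator-valued products and a Gronwall inequality -/

/-- Measurability of T in the strong operator sense suffices: the claim is clear for simple g, and
each T a is continuous, so it passes to pointwise limits of simple functions. -/
lemma aestronglyMeasurable_clm_apply {α 𝕜 E F : Type*} [MeasurableSpace α] [RCLike 𝕜]
    [NormedAddCommGroup E] [NormedSpace 𝕜 E] [NormedAddCommGroup F] [NormedSpace 𝕜 F]
    {ν : Measure α} {T : α → E →L[𝕜] F} {g : α → E}
    (hT : ∀ v, AEStronglyMeasurable (fun a => T a v) ν) (hg : AEStronglyMeasurable g ν) :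
    AEStronglyMeasurable (fun a => T a (g a)) ν := by
  have hs : ∀ f : SimpleFunc α E, AEStronglyMeasurable (fun a => T a (f a)) ν := by
    intro f
    induction f using SimpleFunc.induction with
    | const c hs =>
      refine ((hT c).indicator hs).congr (Eventually.of_forall fun a => ?_)
      by_cases h : a ∈ ‹Set α› <;> simp [h]
    | add _ hf hg =>
      refine (hf.add hg).congr (Eventually.of_forall fun a => ?_)
      simp
  have h1 : AEStronglyMeasurable (fun a => T a (hg.mk g a)) ν := by
    refine aestronglyMeasurable_of_tendsto_ae atTop
      (fun n => hs (hg.stronglyMeasurable_mk.approx n)) (Eventually.of_forall fun a => ?_)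
    exact ((T a).continuous.tendsto _).comp (hg.stronglyMeasurable_mk.tendsto_approx a)
  refine h1.congr ?_
  filter_upwards [hg.ae_eq_mk] with a ha
  rw [ha]

lemma integral_exp_mul_sub_left {l : ℝ} (hl : l ≠ 0) (a t : ℝ) :
    ∫ r in a..t, Real.exp (l * (r - a)) = (Real.exp (l * (t - a)) - 1) / l := by
  have h : ∀ r ∈ Set.uIcc a t, HasDerivAt (fun r => Real.exp (l * (r - a)) / l)
      (Real.exp (l * (r - a))) r := fun r _ =>
    ((((hasDerivAt_id r).sub_const a).const_mul l).exp.div_const l).congr_deriv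
      (by simp only [id]; field_simp)
  rw [intervalIntegral.integral_eq_sub_of_hasDerivAt h
    (Continuous.intervalIntegrable (by fun_prop) _ _)]
  simp only [sub_self, mul_zero, Real.exp_zero]
  ring

lemma integral_exp_mul_sub_right {l : ℝ} (hl : l ≠ 0) (s t : ℝ) :
    ∫ r in s..t, Real.exp (l * (t - r)) = (Real.exp (l * (t - s)) - 1) / l := by
  have h : ∀ r ∈ Set.uIcc s t, HasDerivAt (fun r => Real.exp (l * (t - r)) / (-l))
      (Real.exp (l * (t - r))) r := fun r _ =>
    ((((hasDerivAt_id r).const_sub t).const_mul l).exp.div_const (-l)).congr_deriv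
      (by simp only [id]; field_simp)
  rw [intervalIntegral.integral_eq_sub_of_hasDerivAt h
    (Continuous.intervalIntegrable (by fun_prop) _ _)]
  simp only [sub_self, mul_zero, Real.exp_zero]
  field_simp
  ring

/-- Gronwall by iteration: in the weight exp (l (t - a)), each use of the integral inequality halves
the constant of an exponential bound on φ. -/
lemma eq_zero_of_le_integral {φ : ℝ → ℝ} {a b c : ℝ} (hc : 0 ≤ c)
    (hφ : ContinuousOn φ (Set.Icc a b)) (h0 : ∀ t ∈ Set.Icc a b, 0 ≤ φ t)
    (h : ∀ t ∈ Set.Icc a b, φ t ≤ c * ∫ r in a..t, φ r) :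
    ∀ t ∈ Set.Icc a b, φ t = 0 := by
  obtain ⟨N, hN⟩ := isCompact_Icc.bddAbove_image hφ
  have hN' : ∀ t ∈ Set.Icc a b, φ t ≤ max N 0 := fun t ht =>
    (hN (Set.mem_image_of_mem _ ht)).trans (le_max_left _ _)
  -- Chosen so that c / l ≤ 1 / 2; the extra 1 keeps l positive when c = 0.
  set l : ℝ := 2 * c + 1 with hl
  have hl0 : 0 < l := by positivity
  have key : ∀ n : ℕ, ∀ t ∈ Set.Icc a b, φ t ≤ max N 0 / 2 ^ n * Real.exp (l * (t - a)) := by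
    intro n
    induction n with
    | zero =>
      intro t ht
      have : 1 ≤ Real.exp (l * (t - a)) :=
        Real.one_le_exp (mul_nonneg hl0.le (sub_nonneg.2 ht.1))
      have h3 := hN' t ht
      have h4 : (0 : ℝ) ≤ max N 0 := le_max_right _ _
      simp only [pow_zero, div_one]
      nlinarith
    | succ n ih =>
      intro t ht
      set Q := max N 0 / 2 ^ n with hQ
      have hQ0 : 0 ≤ Q := div_nonneg (le_max_right _ _) (by positivity)
      have h1 : ∫ r in a..t, φ r ≤ ∫ r in a..t, Q * Real.exp (l * (r - a)) := by
        refine intervalIntegral.integral_mono_on ht.1 ?_ ?_ fun r hr => ih r ⟨hr.1, hr.2.trans ht.2⟩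
        · refine (hφ.mono ?_).intervalIntegrable
          rw [Set.uIcc_of_le ht.1]
          exact Set.Icc_subset_Icc_right ht.2
        · exact Continuous.intervalIntegrable (by fun_prop) _ _
      have h2 : ∫ r in a..t, Q * Real.exp (l * (r - a)) = Q * ((Real.exp (l * (t - a)) - 1) / l) := by
        rw [intervalIntegral.integral_const_mul, integral_exp_mul_sub_left hl0.ne']
      calc φ t ≤ c * ∫ r in a..t, φ r := h t ht
        _ ≤ c * (Q * ((Real.exp (l * (t - a)) - 1) / l)) :=
          mul_le_mul_of_nonneg_left (h1.trans h2.le) hc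
        _ ≤ Q / 2 * Real.exp (l * (t - a)) := by
          have h5 : 0 < Real.exp (l * (t - a)) := Real.exp_pos _
          have h6 : c / l ≤ 1 / 2 := by rw [div_le_div_iff₀ hl0 two_pos]; linarith
          have h7 : 0 ≤ c / l := by positivity
          calc c * (Q * ((Real.exp (l * (t - a)) - 1) / l))
              = Q * ((c / l) * (Real.exp (l * (t - a)) - 1)) := by ring
            _ ≤ Q * (1 / 2 * Real.exp (l * (t - a))) := by
              refine mul_le_mul_of_nonneg_left ?_ hQ0
              nlinarith
            _ = _ := by ring
        _ = _ := by rw [hQ, pow_succ]; ring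
  intro t ht
  refine le_antisymm ?_ (h0 t ht)
  have h1 : Tendsto (fun n : ℕ => max N 0 / 2 ^ n * Real.exp (l * (t - a))) atTop (𝓝 0) := by
    have := ((tendsto_pow_atTop_nhds_zero_of_lt_one (r := (1 / 2 : ℝ)) (by norm_num)
      (by norm_num)).const_mul (max N 0)).mul_const (Real.exp (l * (t - a)))
    simp only [mul_zero, zero_mul] at this
    refine this.congr fun n => ?_
    rw [one_div, inv_pow, div_eq_mul_inv]
  exact ge_of_tendsto' h1 fun n => key n t ht

/-! ### Extension of evolution operators to all times, and local boundedness -/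

section

variable {𝕜 H : Type*} [RCLike 𝕜] [NormedAddCommGroup H] [InnerProductSpace 𝕜 H]

/-- The extension of an evolution operator to all pairs of real numbers by the identity
for `t ≤ s`, and by `U t 0` for `s ≤ 0`. -/
def extend (U : ℝ → ℝ → H →L[𝕜] H) (t s : ℝ) : H →L[𝕜] H := U (max t (max s 0)) (max s 0)

lemma extend_of_le (U : ℝ → ℝ → H →L[𝕜] H) {t s : ℝ} (hs : 0 ≤ s) (h : s ≤ t) :
    extend U t s = U t s := by
  rw [extend, max_eq_left hs, max_eq_left h]

lemma IsEvolutionOperator.extend_eq_id {U : ℝ → ℝ → H →L[𝕜] H} (hU : IsEvolutionOperator U)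
    {t s : ℝ} (h : t ≤ s) : extend U t s = ContinuousLinearMap.id 𝕜 H := by
  rw [extend, max_eq_right (h.trans (le_max_left s 0)), hU.refl _ (le_max_right s 0)]

lemma IsEvolutionOperator.continuous_extend_left {U : ℝ → ℝ → H →L[𝕜] H}
    (hU : IsEvolutionOperator U) (s : ℝ) (x : H) : Continuous fun t => extend U t s x := by
  refine (hU.continuousOn_left (max s 0) (le_max_right _ _) x).comp_continuous
    (f := fun t => max t (max s 0)) (by fun_prop) fun t => ?_
  exact Set.mem_Ici.2 (le_max_right _ _)

/-- The clamped values fit together at s = t because U t t is the identity. -/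
lemma IsEvolutionOperator.continuous_extend_right {U : ℝ → ℝ → H →L[𝕜] H}
    (hU : IsEvolutionOperator U) (t : ℝ) (x : H) : Continuous fun s => extend U t s x := by
  rcases le_total 0 t with ht | ht
  · have h : ∀ s, extend U t s x = U t (min (max s 0) t) x := by
      intro s
      rcases le_total (max s 0) t with h | h
      · rw [extend, max_eq_left h, min_eq_left h]
      · rw [extend, max_eq_right h, min_eq_right h, hU.refl _ (le_max_right _ _), hU.refl _ ht]
    simp_rw [h]
    refine (hU.continuousOn_right t ht x).comp_continuous
      (f := fun s => min (max s 0) t) (by fun_prop) fun s => ?_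
    exact ⟨le_min (le_max_right _ _) ht, min_le_right _ _⟩
  · have h : ∀ s, extend U t s x = x := by
      intro s
      rw [extend, max_eq_right (ht.trans (le_max_right s 0)), hU.refl _ (le_max_right _ _)]
      rfl
    simp_rw [h]
    exact continuous_const

/-- Separate continuity gives joint measurability (Carathéodory functions). The extension to the
whole plane serves to make this and the later Fubini arguments available. -/
lemma IsEvolutionOperator.stronglyMeasurable_extend {U : ℝ → ℝ → H →L[𝕜] H}
    (hU : IsEvolutionOperator U) (x : H) :
    StronglyMeasurable fun p : ℝ × ℝ => extend U p.1 p.2 x :=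
  stronglyMeasurable_uncurry_of_continuous_of_stronglyMeasurable
    (u := fun t s => extend U t s x) (fun s => hU.continuous_extend_left s x)
    (fun t => (hU.continuous_extend_right t x).stronglyMeasurable)

/-- Uniform boundedness on the triangles `0 ≤ s ≤ t ≤ T`. -/
def IsLocallyBounded (U : ℝ → ℝ → H →L[𝕜] H) : Prop :=
  ∀ T, ∃ N : ℝ, ∀ s t, 0 ≤ s → s ≤ t → t ≤ T → ‖U t s‖ ≤ N

lemma IsExponentiallyStable.isLocallyBounded {U : ℝ → ℝ → H →L[𝕜] H}
    (hU : IsExponentiallyStable U) : IsLocallyBounded U := by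
  obtain ⟨M, α, hM, hα, h⟩ := hU
  refine fun T => ⟨M, fun s t hs hst _ => (h s t hs hst).trans ?_⟩
  refine mul_le_of_le_one_right hM (Real.exp_le_one_iff.2 ?_)
  nlinarith

lemma IsLocallyBounded.extend {U : ℝ → ℝ → H →L[𝕜] H} (hU : IsLocallyBounded U) (T : ℝ) :
    ∃ N : ℝ, 0 ≤ N ∧ ∀ s t, t ≤ T → s ≤ T → ‖extend U t s‖ ≤ N := by
  obtain ⟨N, hN⟩ := hU (max T 0)
  have h := hN 0 0 le_rfl le_rfl (le_max_right _ _)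
  refine ⟨N, (norm_nonneg _).trans h, fun s t ht hs => hN _ _ (le_max_right _ _) (le_max_right _ _) ?_⟩
  exact max_le (ht.trans (le_max_left _ _)) (max_le_max hs le_rfl)

/-- The defining equation is read backwards, as Y = V - ∫ Y D V. For fixed t, uniform boundedness
gives some bound on s ↦ Y t s; iterating the equation in the weight exp (l (t - s)) then removes
that bound, leaving one that depends only on V, D and T. -/
lemma IsPerturbedEvolution.isLocallyBounded_base [CompleteSpace H] [NormedSpace ℝ H]
    {Y V : ℝ → ℝ → H →L[𝕜] H} {D : ℝ → H →L[𝕜] H} (hY : IsEvolutionOperator Y)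
    (hV : IsPerturbedEvolution Y D V) (hVb : IsLocallyBounded V)
    (hD : ∃ d : ℝ, ∀ t, 0 ≤ t → ‖D t‖ ≤ d) : IsLocallyBounded Y := by
  obtain ⟨d, hd⟩ := hD
  have hd0 : 0 ≤ d := (norm_nonneg _).trans (hd 0 le_rfl)
  intro T
  obtain ⟨N, hN⟩ := hVb T
  set l : ℝ := 2 * (d * N) + 1 with hl
  refine ⟨2 * N * Real.exp (l * T), fun s t hs hst htT => ?_⟩
  have ht : 0 ≤ t := hs.trans hst
  have hN0 : 0 ≤ N := (norm_nonneg _).trans (hN s t hs hst htT)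
  have hl0 : 0 < l := by positivity
  -- This C may depend on t. It only starts the induction, and C / 2 ^ n disappears in the limit.
  obtain ⟨C, hC⟩ : ∃ C, ∀ i : Set.Icc 0 t, ‖Y t i‖ ≤ C := by
    refine banach_steinhaus fun x => ?_
    obtain ⟨c, hc⟩ := isCompact_Icc.bddAbove_image (hY.continuousOn_right t ht x).norm
    exact ⟨c, fun i => hc ⟨i, i.2, rfl⟩⟩
  have hC0 : 0 ≤ C := (norm_nonneg _).trans (hC ⟨t, ht, le_rfl⟩)
  have key : ∀ n : ℕ, ∀ s ∈ Set.Icc 0 t,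
      ‖Y t s‖ ≤ (2 * N + C / 2 ^ n) * Real.exp (l * (t - s)) := by
    intro n
    induction n with
    | zero =>
      intro s hs
      have h1 : 1 ≤ Real.exp (l * (t - s)) :=
        Real.one_le_exp (mul_nonneg hl0.le (sub_nonneg.2 hs.2))
      have h2 := hC ⟨s, hs⟩
      simp only at h2
      simp only [pow_zero, div_one]
      nlinarith
    | succ n ih =>
      intro s hs
      set Q := 2 * N + C / 2 ^ n with hQ
      have hQ0 : 0 ≤ Q := by positivity
      have hE : 1 ≤ Real.exp (l * (t - s)) :=
        Real.one_le_exp (mul_nonneg hl0.le (sub_nonneg.2 hs.2))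
      refine ContinuousLinearMap.opNorm_le_bound _ (by positivity) fun w => ?_
      have h0 : Y t s w = V t s w - ∫ r in s..t, Y t r (D r (V r s w)) := by
        rw [hV.eq_add_integral s t hs.1 hs.2 w, add_sub_cancel_right]
      have h2 : ∫ r in s..t, Q * Real.exp (l * (t - r)) * (d * (N * ‖w‖))
          = Q * ((Real.exp (l * (t - s)) - 1) / l) * (d * (N * ‖w‖)) := by
        rw [intervalIntegral.integral_mul_const, intervalIntegral.integral_const_mul,
          integral_exp_mul_sub_right hl0.ne']
      have h1 : ‖∫ r in s..t, Y t r (D r (V r s w))‖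
          ≤ Q * ((Real.exp (l * (t - s)) - 1) / l) * (d * (N * ‖w‖)) := by
        rw [← h2]
        refine intervalIntegral.norm_integral_le_of_norm_le hs.2
          (ae_of_all _ fun r hr => ?_) (Continuous.intervalIntegrable (by fun_prop) _ _)
        have hr0 : 0 ≤ r := hs.1.trans hr.1.le
        refine (ContinuousLinearMap.le_opNorm _ _).trans (mul_le_mul (ih r ⟨hr0, hr.2⟩) ?_
          (norm_nonneg _) (by positivity))
        refine (ContinuousLinearMap.le_opNorm _ _).trans (mul_le_mul (hd r hr0) ?_
          (norm_nonneg _) hd0)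
        exact (ContinuousLinearMap.le_opNorm _ _).trans (mul_le_mul_of_nonneg_right
          (hN s r hs.1 hr.1.le (hr.2.trans htT)) (norm_nonneg _))
      have h3 : ‖V t s w‖ ≤ N * ‖w‖ := (ContinuousLinearMap.le_opNorm _ _).trans
        (mul_le_mul_of_nonneg_right (hN s t hs.1 hs.2 htT) (norm_nonneg _))
      have h6 : d * N / l ≤ 1 / 2 := by rw [div_le_div_iff₀ hl0 two_pos]; linarith
      have h7 : 0 ≤ d * N / l := by positivity
      rw [h0]
      refine (norm_sub_le _ _).trans ((add_le_add h3 h1).trans ?_)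
      have h8 : Q * ((Real.exp (l * (t - s)) - 1) / l) * (d * (N * ‖w‖))
          ≤ Q / 2 * Real.exp (l * (t - s)) * ‖w‖ := by
        calc _ = Q * (d * N / l * (Real.exp (l * (t - s)) - 1)) * ‖w‖ := by ring
          _ ≤ Q * (1 / 2 * Real.exp (l * (t - s))) * ‖w‖ := by
            gcongr
            linarith
          _ = _ := by ring
      have h9 : N * ‖w‖ ≤ N * Real.exp (l * (t - s)) * ‖w‖ := by
        gcongr
        exact le_mul_of_one_le_right hN0 hE
      have h10 : (2 * N + C / 2 ^ (n + 1)) = N + Q / 2 := by rw [hQ, pow_succ]; ring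
      rw [h10]
      linarith
  have h1 : Tendsto (fun n : ℕ => (2 * N + C / 2 ^ n) * Real.exp (l * (t - s))) atTop
      (𝓝 (2 * N * Real.exp (l * (t - s)))) := by
    have := (((tendsto_pow_atTop_nhds_zero_of_lt_one (r := (1 / 2 : ℝ)) (by norm_num)
      (by norm_num)).const_mul C).const_add (2 * N)).mul_const (Real.exp (l * (t - s)))
    simp only [mul_zero, add_zero] at this
    refine this.congr fun n => ?_
    rw [one_div, inv_pow, div_eq_mul_inv]
  refine (ge_of_tendsto' h1 fun n => key n s ⟨hs, hst⟩).trans ?_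
  refine mul_le_mul_of_nonneg_left (Real.exp_le_exp.2 ?_) (by positivity)
  exact mul_le_mul_of_nonneg_left (by linarith) hl0.le

end

/-! ### Mild solutions -/

section

variable {𝕜 H : Type*} [RCLike 𝕜] [NormedAddCommGroup H] [InnerProductSpace 𝕜 H]

lemma integrableOn_clm_apply {E F : Type*} [NormedAddCommGroup E] [NormedSpace 𝕜 E]
    [NormedAddCommGroup F] [NormedSpace 𝕜 F] {D : ℝ → E →L[𝕜] F} {S : Set ℝ}
    (hS : MeasurableSet S)
    (hm : ∀ v, AEStronglyMeasurable (fun r => D r v) (volume.restrict S)) {d : ℝ}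
    (hd : ∀ r ∈ S, ‖D r‖ ≤ d) {f : ℝ → E} (hf : IntegrableOn f S) :
    IntegrableOn (fun r => D r (f r)) S := by
  refine Integrable.mono' (g := fun r => d * ‖f r‖) (hf.norm.const_mul d)
    (aestronglyMeasurable_clm_apply hm hf.aestronglyMeasurable) ?_
  filter_upwards [ae_restrict_mem hS] with r hr
  exact (ContinuousLinearMap.le_opNorm _ _).trans
    (mul_le_mul_of_nonneg_right (hd r hr) (norm_nonneg _))

lemma intervalIntegrable_clm_apply {E F : Type*} [NormedAddCommGroup E] [NormedSpace 𝕜 E]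
    [NormedAddCommGroup F] [NormedSpace 𝕜 F] {D : ℝ → E →L[𝕜] F}
    (hD : ContinuousOn D (Set.Ici 0)) {s t : ℝ} (hs : 0 ≤ s) (hst : s ≤ t) {f : ℝ → E}
    (hf : IntervalIntegrable f volume s t) :
    IntervalIntegrable (fun r => D r (f r)) volume s t := by
  rw [intervalIntegrable_iff_integrableOn_Ioc_of_le hst] at hf ⊢
  have hsub : Set.Icc s t ⊆ Set.Ici 0 := fun r hr => hs.trans hr.1
  have hsub' : Set.Ioc s t ⊆ Set.Ici 0 := Set.Ioc_subset_Icc_self.trans hsub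
  obtain ⟨d, hd⟩ := isCompact_Icc.bddAbove_image (hD.mono hsub).norm
  refine integrableOn_clm_apply measurableSet_Ioc (fun v => ?_)
    (fun r hr => hd ⟨r, Set.Ioc_subset_Icc_self hr, rfl⟩) hf
  exact ((hD.mono hsub').clm_apply continuousOn_const).aestronglyMeasurable measurableSet_Ioc

lemma IsEvolutionOperator.aestronglyMeasurable_right {U : ℝ → ℝ → H →L[𝕜] H}
    (hU : IsEvolutionOperator U) {s t : ℝ} (hs : 0 ≤ s) (v : H) :
    AEStronglyMeasurable (fun r => U t r v) (volume.restrict (Set.Ioc s t)) := by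
  refine (hU.continuous_extend_right t v).aestronglyMeasurable.congr ?_
  filter_upwards [ae_restrict_mem measurableSet_Ioc] with r hr
  rw [extend_of_le U (hs.trans hr.1.le) hr.2]

lemma IsEvolutionOperator.intervalIntegrable_apply {U : ℝ → ℝ → H →L[𝕜] H}
    (hU : IsEvolutionOperator U) (hUb : IsLocallyBounded U) {s t : ℝ} (hs : 0 ≤ s) (hst : s ≤ t)
    {f : ℝ → H} (hf : IntervalIntegrable f volume s t) :
    IntervalIntegrable (fun r => U t r (f r)) volume s t := by
  rw [intervalIntegrable_iff_integrableOn_Ioc_of_le hst] at hf ⊢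
  obtain ⟨N, hN⟩ := hUb t
  exact integrableOn_clm_apply measurableSet_Ioc (fun v => hU.aestronglyMeasurable_right hs v)
    (fun r hr => hN r t (hs.trans hr.1.le) hr.2 le_rfl) hf

variable [NormedSpace ℝ H]

/-- The mild solution of `z' = A z + f`, `z s = x`, for the evolution operator `U` of `A`. -/
noncomputable def mild (U : ℝ → ℝ → H →L[𝕜] H) (s : ℝ) (x : H) (f : ℝ → H) (t : ℝ) : H :=
  U t s x + ∫ r in s..t, U t r (f r)

lemma mild_self {U : ℝ → ℝ → H →L[𝕜] H} (hU : IsEvolutionOperator U) {s : ℝ} (hs : 0 ≤ s)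
    (x : H) (f : ℝ → H) : mild U s x f s = x := by
  simp [mild, hU.refl s hs]

lemma mild_congr {U : ℝ → ℝ → H →L[𝕜] H} {s t : ℝ} (hst : s ≤ t) {x : H} {f g : ℝ → H}
    (h : ∀ᵐ r, r ∈ Set.Ioc s t → f r = g r) : mild U s x f t = mild U s x g t := by
  rw [mild, mild]
  congr 1
  refine intervalIntegral.integral_congr_ae ?_
  filter_upwards [h] with r hr hr'
  rw [Set.uIoc_of_le hst] at hr'
  rw [hr hr']

/-- Since the extended operator is the identity for r ≥ t, the integral over [s, t] equals the
integral of `extend U t r (f r)` over the fixed interval [s, T] minus the integral of f over [t, T].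
Dominated convergence handles the first and continuity of primitives the second. -/
lemma IsEvolutionOperator.continuousOn_mild {U : ℝ → ℝ → H →L[𝕜] H}
    (hU : IsEvolutionOperator U) (hUb : IsLocallyBounded U) {s T : ℝ} (hs : 0 ≤ s)
    (x : H) {f : ℝ → H} (hf : IntervalIntegrable f volume s T) :
    ContinuousOn (mild U s x f) (Set.Icc s T) := by
  rcases lt_or_ge T s with hT | hT
  · rw [Set.Icc_eq_empty (not_le.2 hT)]; exact continuousOn_empty _
  obtain ⟨N, hN0, hN⟩ := hUb.extend T
  have hfi : IntegrableOn f (Set.Ioc s T) :=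
    (intervalIntegrable_iff_integrableOn_Ioc_of_le hT).1 hf
  have he : ∀ t, IntervalIntegrable (fun r => extend U t r (f r)) volume s T ∨ T < t := by
    intro t
    rcases lt_or_ge T t with h | h
    · exact Or.inr h
    · left
      rw [intervalIntegrable_iff_integrableOn_Ioc_of_le hT]
      exact integrableOn_clm_apply measurableSet_Ioc
        (fun v => (hU.continuous_extend_right t v).aestronglyMeasurable)
        (fun r hr => hN r t h hr.2) hfi
  have h1 : ∀ t ∈ Set.Icc s T, mild U s x f t
      = U t s x + ((∫ r in s..T, extend U t r (f r)) - ∫ r in t..T, f r) := by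
    intro t ht
    have hsub : Set.uIcc s t ⊆ Set.uIcc s T := by
      rw [Set.uIcc_of_le ht.1, Set.uIcc_of_le hT]; exact Set.Icc_subset_Icc_right ht.2
    have hsub' : Set.uIcc t T ⊆ Set.uIcc s T := by
      rw [Set.uIcc_of_le ht.2, Set.uIcc_of_le hT]; exact Set.Icc_subset_Icc_left ht.1
    have h2 := (he t).resolve_right (not_lt.2 ht.2)
    rw [mild, ← intervalIntegral.integral_add_adjacent_intervals (h2.mono_set hsub)
      (h2.mono_set hsub'), add_sub_assoc]
    have h3 : ∫ r in t..T, extend U t r (f r) = ∫ r in t..T, f r := by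
      refine intervalIntegral.integral_congr fun r hr => ?_
      rw [Set.uIcc_of_le ht.2] at hr
      simp only [hU.extend_eq_id hr.1, ContinuousLinearMap.id_apply]
    rw [h3, sub_self, add_zero]
    congr 1
    refine intervalIntegral.integral_congr fun r hr => ?_
    rw [Set.uIcc_of_le ht.1] at hr
    simp only [extend_of_le U (hs.trans hr.1) hr.2]
  refine ContinuousOn.congr (f := fun t => U t s x + ((∫ r in s..T, extend U t r (f r))
    - ∫ r in t..T, f r)) ?_ h1
  refine ((hU.continuousOn_left s hs x).mono Set.Icc_subset_Ici_self).add (ContinuousOn.sub ?_ ?_)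
  · intro t ht
    refine intervalIntegral.tendsto_integral_filter_of_dominated_convergence
      (fun r => N * ‖f r‖) ?_ ?_ (hf.norm.const_mul N) ?_
    · filter_upwards [self_mem_nhdsWithin] with t' ht'
      rw [Set.uIoc_of_le hT]
      exact aestronglyMeasurable_clm_apply
        (fun v => (hU.continuous_extend_right t' v).aestronglyMeasurable) hfi.aestronglyMeasurable
    · filter_upwards [self_mem_nhdsWithin] with t' ht'
      refine ae_of_all _ fun r hr => ?_
      rw [Set.uIoc_of_le hT] at hr
      exact (ContinuousLinearMap.le_opNorm _ _).trans
        (mul_le_mul_of_nonneg_right (hN r t' ht'.2 hr.2) (norm_nonneg _))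
    · exact ae_of_all _ fun r _ => ((hU.continuous_extend_left r (f r)).tendsto t).mono_left
        nhdsWithin_le_nhds
  · have h := intervalIntegral.continuousOn_primitive_interval_left (f := f) (a := s) (b := T)
      (μ := volume) (by
        rw [Set.uIcc_of_le hT]; exact (integrableOn_Icc_iff_integrableOn_Ioc).2 hfi)
    rwa [Set.uIcc_of_le hT] at h

variable [CompleteSpace H]

lemma IsEvolutionOperator.mild_restart {U : ℝ → ℝ → H →L[𝕜] H}
    (hU : IsEvolutionOperator U) (hUb : IsLocallyBounded U) {s q t : ℝ} (hs : 0 ≤ s)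
    (hsq : s ≤ q) (hqt : q ≤ t) (x : H) {f : ℝ → H} (hf : IntervalIntegrable f volume s t) :
    mild U s x f t = mild U q (mild U s x f q) f t := by
  have hsub : Set.uIcc s q ⊆ Set.uIcc s t := by
    rw [Set.uIcc_of_le hsq, Set.uIcc_of_le (hsq.trans hqt)]; exact Set.Icc_subset_Icc_right hqt
  have hsub' : Set.uIcc q t ⊆ Set.uIcc s t := by
    rw [Set.uIcc_of_le hqt, Set.uIcc_of_le (hsq.trans hqt)]; exact Set.Icc_subset_Icc_left hsq
  have hi := hU.intervalIntegrable_apply hUb hs (hsq.trans hqt) hf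
  have h1 : ∫ r in s..q, U t r (f r) = U t q (∫ r in s..q, U q r (f r)) := by
    rw [← ContinuousLinearMap.intervalIntegral_comp_comm _
      (hU.intervalIntegrable_apply hUb hs hsq (hf.mono_set hsub))]
    refine intervalIntegral.integral_congr fun r hr => ?_
    rw [Set.uIcc_of_le hsq] at hr
    rw [← hU.comp r q t (hs.trans hr.1) hr.2 hqt]
    rfl
  rw [mild, mild, mild, map_add, ← intervalIntegral.integral_add_adjacent_intervals
    (hi.mono_set hsub) (hi.mono_set hsub'), h1, ← hU.comp s q t hs hsq hqt]
  simp only [ContinuousLinearMap.comp_apply]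
  abel

end

/-! ### Bounded perturbations: Fubini on the triangle, uniqueness, variation of constants -/

section

variable {𝕜 H : Type*} [RCLike 𝕜] [NormedAddCommGroup H] [InnerProductSpace 𝕜 H]
  {Y V : ℝ → ℝ → H →L[𝕜] H} {D : ℝ → H →L[𝕜] H}

/-- The Fubini hypothesis for `IsPerturbedEvolution.mild_eq`: on the triangle q < r the kernel is
dominated by a constant times ‖g q‖. -/
lemma integrable_triangle_kernel (hY : IsEvolutionOperator Y) (hYb : IsLocallyBounded Y)
    (hV : IsEvolutionOperator V) (hVb : IsLocallyBounded V)
    (hD : ContinuousOn D (Set.Ici 0)) {s t : ℝ} (hs : 0 ≤ s)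
    {g : ℝ → H} (hg : IntegrableOn g (Set.Ioc s t)) :
    Integrable (Function.uncurry fun r q =>
        Set.indicator (Set.Ioi q) (fun r => Y t r (D r (V r q (g q)))) r)
      ((volume.restrict (Set.Ioc s t)).prod (volume.restrict (Set.Ioc s t))) := by
  set μ := volume.restrict (Set.Ioc s t) with hμ
  obtain ⟨N, hN⟩ := hYb t
  obtain ⟨N', hN'⟩ := hVb t
  have hsub : Set.Icc s t ⊆ Set.Ici 0 := fun r hr => hs.trans hr.1
  have hsub' : Set.Ioc s t ⊆ Set.Ici 0 := Set.Ioc_subset_Icc_self.trans hsub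
  obtain ⟨d, hd⟩ := isCompact_Icc.bddAbove_image (hD.mono hsub).norm
  have hmem : ∀ᵐ p ∂(μ.prod μ), p.1 ∈ Set.Ioc s t ∧ p.2 ∈ Set.Ioc s t := by
    rw [hμ, Measure.prod_restrict]
    filter_upwards [ae_restrict_mem (measurableSet_Ioc.prod measurableSet_Ioc)] with p hp
    exact hp
  refine Integrable.mono' (g := fun p : ℝ × ℝ => N * (d * (N' * ‖g p.2‖)))
    (((((Integrable.comp_snd hg.norm μ).const_mul N').const_mul d)).const_mul N) ?_ ?_
  · have h0 : ∀ v, AEStronglyMeasurable (fun p : ℝ × ℝ => extend V p.1 p.2 v) (μ.prod μ) :=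
      fun v => (hV.stronglyMeasurable_extend v).aestronglyMeasurable
    have h1 := aestronglyMeasurable_clm_apply h0
      (AEStronglyMeasurable.comp_snd (μ := μ) hg.aestronglyMeasurable)
    have h2 : ∀ v, AEStronglyMeasurable (fun p : ℝ × ℝ => D p.1 v) (μ.prod μ) := fun v =>
      AEStronglyMeasurable.comp_fst (f := fun r => D r v)
        (((hD.mono hsub').clm_apply continuousOn_const).aestronglyMeasurable measurableSet_Ioc)
    have h3 := aestronglyMeasurable_clm_apply h2 h1
    have h4 : ∀ v, AEStronglyMeasurable (fun p : ℝ × ℝ => Y t p.1 v) (μ.prod μ) := fun v =>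
      AEStronglyMeasurable.comp_fst (f := fun r => Y t r v) (hY.aestronglyMeasurable_right hs v)
    have h5 := aestronglyMeasurable_clm_apply h4 h3
    have h6 := h5.indicator (measurableSet_lt (measurable_snd (α := ℝ) (β := ℝ)) measurable_fst)
    refine h6.congr ?_
    filter_upwards [hmem] with p hp
    by_cases h : p.2 < p.1
    · simp only [Function.uncurry, Set.indicator, Set.mem_Ioi, Set.mem_ofPred_eq, h, if_true]
      rw [extend_of_le V (hs.trans hp.2.1.le) h.le]
    · simp only [Function.uncurry, Set.indicator, Set.mem_Ioi, Set.mem_ofPred_eq, h, if_false]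
  · filter_upwards [hmem] with p hp
    have hp0 : 0 ≤ p.2 := hs.trans hp.2.1.le
    have hp1 : 0 ≤ p.1 := hs.trans hp.1.1.le
    have h1 := hN p.1 t hp1 hp.1.2 le_rfl
    have h2 := hd ⟨p.1, ⟨hp.1.1.le, hp.1.2⟩, rfl⟩
    have h3 := hN' p.2 p.2 hp0 le_rfl hp.2.2
    simp only at h2
    have hN0 : 0 ≤ N := (norm_nonneg _).trans h1
    have hd0 : 0 ≤ d := (norm_nonneg _).trans h2
    have hN0' : 0 ≤ N' := (norm_nonneg _).trans h3
    by_cases h : p.2 < p.1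
    · simp only [Function.uncurry, Set.indicator, Set.mem_Ioi, h, if_true]
      refine (ContinuousLinearMap.le_opNorm _ _).trans (mul_le_mul h1 ?_ (norm_nonneg _) hN0)
      refine (ContinuousLinearMap.le_opNorm _ _).trans (mul_le_mul h2 ?_ (norm_nonneg _) hd0)
      exact (ContinuousLinearMap.le_opNorm _ _).trans
        (mul_le_mul_of_nonneg_right (hN' _ _ hp0 h.le hp.1.2) (norm_nonneg _))
    · simp only [Function.uncurry, Set.indicator, Set.mem_Ioi, h, if_false, norm_zero]
      positivity

variable [NormedSpace ℝ H]

/-- Solutions of the homogeneous integral equation vanish. -/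
theorem eq_zero_of_eq_integral (hYb : IsLocallyBounded Y)
    (hD : ∃ d : ℝ, ∀ t, 0 ≤ t → ‖D t‖ ≤ d) {s T : ℝ} (hs : 0 ≤ s) {e : ℝ → H}
    (hc : ContinuousOn e (Set.Icc s T))
    (he : ∀ t ∈ Set.Icc s T, e t = ∫ r in s..t, Y t r (D r (e r))) :
    ∀ t ∈ Set.Icc s T, e t = 0 := by
  obtain ⟨d, hd⟩ := hD
  obtain ⟨N, hN⟩ := hYb T
  intro t ht
  have hd0 : 0 ≤ d := (norm_nonneg _).trans (hd 0 le_rfl)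
  have hN0 : 0 ≤ N := (norm_nonneg _).trans (hN s t hs ht.1 ht.2)
  rw [← norm_eq_zero]
  refine eq_zero_of_le_integral (φ := fun t => ‖e t‖) (c := N * d) (by positivity) hc.norm
    (fun t _ => norm_nonneg _) (fun t ht => ?_) t ht
  rw [← intervalIntegral.integral_const_mul]
  rw [he t ht]
  refine intervalIntegral.norm_integral_le_of_norm_le ht.1 (ae_of_all _ fun r hr => ?_) ?_
  · have hr0 : 0 ≤ r := hs.trans hr.1.le
    rw [mul_assoc]
    refine (ContinuousLinearMap.le_opNorm _ _).trans
      (mul_le_mul (hN r t hr0 hr.2 ht.2) ?_ (norm_nonneg _) hN0)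
    exact (ContinuousLinearMap.le_opNorm _ _).trans
      (mul_le_mul_of_nonneg_right (hd r hr0) (norm_nonneg _))
  · refine (ContinuousOn.intervalIntegrable ?_).const_mul _
    rw [Set.uIcc_of_le ht.1]
    exact (hc.mono (Set.Icc_subset_Icc_right ht.2)).norm

/-- The perturbed evolution operator is unique. -/
theorem IsPerturbedEvolution.eq (hYb : IsLocallyBounded Y) {V' : ℝ → ℝ → H →L[𝕜] H}
    (hV : IsPerturbedEvolution Y D V) (hV' : IsPerturbedEvolution Y D V')
    (hD : ∃ d : ℝ, ∀ t, 0 ≤ t → ‖D t‖ ≤ d) {s t : ℝ} (hs : 0 ≤ s) (hst : s ≤ t) :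
    V t s = V' t s := by
  ext x
  refine sub_eq_zero.1 (eq_zero_of_eq_integral (Y := Y) (D := D) (T := t)
    (e := fun t => V t s x - V' t s x) hYb hD hs ?_ ?_ t ⟨hst, le_rfl⟩)
  · exact ((hV.isEvolutionOperator.continuousOn_left s hs x).sub
      (hV'.isEvolutionOperator.continuousOn_left s hs x)).mono Set.Icc_subset_Ici_self
  · intro r hr
    rw [hV.eq_add_integral s r hs hr.1 x, hV'.eq_add_integral s r hs hr.1 x,
      add_sub_add_left_eq_sub, ← intervalIntegral.integral_sub
        (hV.intervalIntegrable s r hs hr.1 x) (hV'.intervalIntegrable s r hs hr.1 x)]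
    simp only [map_sub]

variable [CompleteSpace H]

/-- A mild solution for the perturbed evolution operator is a mild solution for the unperturbed
one, with the perturbation as an additional forcing term. -/
theorem IsPerturbedEvolution.mild_eq (hY : IsEvolutionOperator Y) (hYb : IsLocallyBounded Y)
    (hV : IsPerturbedEvolution Y D V) (hVb : IsLocallyBounded V)
    (hD : ContinuousOn D (Set.Ici 0)) {s t : ℝ} (hs : 0 ≤ s) (hst : s ≤ t) (x : H)
    {g : ℝ → H} (hg : IntervalIntegrable g volume s t) :
    mild V s x g t = mild Y s x (fun r => g r + D r (mild V s x g r)) t := by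
  have hVe := hV.isEvolutionOperator
  have hg' : IntegrableOn g (Set.Ioc s t) :=
    (intervalIntegrable_iff_integrableOn_Ioc_of_le hst).1 hg
  have hk := integrable_triangle_kernel hY hYb hVe hVb hD hs hg'
  have hgr : ∀ r ∈ Set.Icc s t, IntervalIntegrable g volume s r := fun r hr => hg.mono_set (by
    rw [Set.uIcc_of_le hr.1, Set.uIcc_of_le hst]; exact Set.Icc_subset_Icc_right hr.2)
  have hYg := hY.intervalIntegrable_apply hYb hs hst hg
  have h1 : ∫ q in s..t, V t q (g q)
      = (∫ q in s..t, Y t q (g q)) + ∫ r in s..t, Y t r (D r (∫ q in s..r, V r q (g q))) := by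
    -- The equation of V is inserted for each starting time q; the double integral over the triangle
    -- is then exchanged.
    have h2 : ∫ q in s..t, V t q (g q) = ∫ q in s..t, (Y t q (g q)
        + ∫ r in Set.Ioc s t, Set.indicator (Set.Ioi q) (fun r => Y t r (D r (V r q (g q)))) r) := by
      refine intervalIntegral.integral_congr fun q hq => ?_
      rw [Set.uIcc_of_le hst] at hq
      rw [hV.eq_add_integral q t (hs.trans hq.1) hq.2, intervalIntegral.integral_of_le hq.2,
        integral_indicator measurableSet_Ioi, Measure.restrict_restrict measurableSet_Ioi]
      congr 3
      ext r
      simp only [Set.mem_Ioc, Set.mem_inter_iff, Set.mem_Ioi]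
      exact ⟨fun h => ⟨h.1, hq.1.trans_lt h.1, h.2⟩, fun h => ⟨h.1, h.2.2⟩⟩
    have h3 : ∫ r in s..t, Y t r (D r (∫ q in s..r, V r q (g q))) = ∫ r in Set.Ioc s t,
        ∫ q in Set.Ioc s t, Set.indicator (Set.Ioi q) (fun r => Y t r (D r (V r q (g q)))) r := by
      rw [intervalIntegral.integral_of_le hst]
      refine setIntegral_congr_fun measurableSet_Ioc fun r hr => ?_
      have hi := hVe.intervalIntegrable_apply hVb hs hr.1.le (hgr r ⟨hr.1.le, hr.2⟩)
      -- The two descriptions of the triangle differ in the null set q = r, hence the passage to the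
      -- open interval.
      rw [← ContinuousLinearMap.comp_apply, ← ContinuousLinearMap.intervalIntegral_comp_comm _ hi,
        intervalIntegral.integral_of_le hr.1.le, integral_Ioc_eq_integral_Ioo]
      have h4 : ∀ q, Set.indicator (Set.Ioi q) (fun r => Y t r (D r (V r q (g q)))) r
          = Set.indicator (Set.Iio r) (fun q => Y t r (D r (V r q (g q)))) q := fun q => by
        simp only [Set.indicator, Set.mem_Ioi, Set.mem_Iio]
      simp_rw [h4]
      rw [integral_indicator measurableSet_Iio, Measure.restrict_restrict measurableSet_Iio]
      simp only [ContinuousLinearMap.comp_apply]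
      congr 2
      ext q
      simp only [Set.mem_Ioo, Set.mem_inter_iff, Set.mem_Ioc, Set.mem_Iio]
      exact ⟨fun h => ⟨h.2, h.1, h.2.le.trans hr.2⟩, fun h => ⟨h.2.1, h.1⟩⟩
    rw [h2, h3, integral_integral_swap hk, intervalIntegral.integral_add hYg,
      ← intervalIntegral.integral_of_le hst]
    rw [intervalIntegrable_iff_integrableOn_Ioc_of_le hst]
    exact hk.integral_prod_right
  have hVx : IntervalIntegrable (fun r => Y t r (D r (V r s x))) volume s t :=
    hV.intervalIntegrable s t hs hst x
  have hc : IntervalIntegrable (mild V s x g) volume s t := by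
    refine ContinuousOn.intervalIntegrable ?_
    rw [Set.uIcc_of_le hst]
    exact hVe.continuousOn_mild hVb hs x hg
  have hYD := hY.intervalIntegrable_apply hYb hs hst (intervalIntegrable_clm_apply hD hs hst hc)
  have h5 : ∫ r in s..t, Y t r (D r (∫ q in s..r, V r q (g q)))
      = (∫ r in s..t, Y t r (D r (mild V s x g r))) - ∫ r in s..t, Y t r (D r (V r s x)) := by
    rw [← intervalIntegral.integral_sub hYD hVx]
    refine intervalIntegral.integral_congr fun r _ => ?_
    simp only [mild, map_add, add_sub_cancel_left]
  simp only [mild] at h5 hYD ⊢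
  simp only [map_add]
  rw [h1, h5, hV.eq_add_integral s t hs hst x, intervalIntegral.integral_add hYg]
  · simp only [map_add]
    abel
  · simpa only [map_add] using hYD

/-- A mild solution for the unperturbed evolution operator is a mild solution for the perturbed
one, with the negative of the perturbation as an additional forcing term. -/
theorem IsPerturbedEvolution.mild_eq_sub (hY : IsEvolutionOperator Y) (hYb : IsLocallyBounded Y)
    (hV : IsPerturbedEvolution Y D V) (hVb : IsLocallyBounded V)
    (hD : IsBoundedContinuous D) {s t : ℝ} (hs : 0 ≤ s) (hst : s ≤ t) (x : H)
    {f : ℝ → H} (hf : IntervalIntegrable f volume s t) :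
    mild Y s x f t = mild V s x (fun r => f r - D r (mild Y s x f r)) t := by
  set z := mild Y s x f with hz
  set g : ℝ → H := fun r => f r - D r (z r) with hg
  set w := mild V s x g with hw
  have hzc : ContinuousOn z (Set.Icc s t) := hY.continuousOn_mild hYb hs x hf
  have hmono : ∀ {F : ℝ → H}, IntervalIntegrable F volume s t → ∀ r ∈ Set.Icc s t,
      IntervalIntegrable F volume s r := fun hF r hr => hF.mono_set (by
    rw [Set.uIcc_of_le hr.1, Set.uIcc_of_le hst]; exact Set.Icc_subset_Icc_right hr.2)
  have hint : ∀ {e : ℝ → H}, ContinuousOn e (Set.Icc s t) →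
      IntervalIntegrable (fun r => D r (e r)) volume s t := fun he =>
    intervalIntegrable_clm_apply hD.1 hs hst (ContinuousOn.intervalIntegrable (by
      rwa [Set.uIcc_of_le hst]))
  have hgi : IntervalIntegrable g volume s t := hf.sub (hint hzc)
  have hwc : ContinuousOn w (Set.Icc s t) :=
    hV.isEvolutionOperator.continuousOn_mild hVb hs x hgi
  -- By `mild_eq`, w is a mild solution for Y with forcing f - D z + D w, so z - w solves the
  -- homogeneous equation with perturbation D.
  have h := eq_zero_of_eq_integral (Y := Y) (D := D) (T := t) hYb hD.2 hs (hzc.sub hwc) ?_ t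
    ⟨hst, le_rfl⟩
  · exact sub_eq_zero.1 h
  intro r hr
  have h1 := hV.mild_eq hY hYb hVb hD.1 hs hr.1 x (hmono hgi r hr)
  rw [← hw] at h1
  have h2 := hY.intervalIntegrable_apply hYb hs hr.1 (hmono hf r hr)
  have h3 := hY.intervalIntegrable_apply hYb hs hr.1
    ((hmono hgi r hr).add (hmono (hint hwc) r hr))
  simp only [Pi.sub_apply]
  rw [h1, hz, mild, mild, add_sub_add_left_eq_sub, ← intervalIntegral.integral_sub h2 h3]
  refine intervalIntegral.integral_congr fun q _ => ?_
  simp only [hg, map_add, map_sub]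
  abel

end

/-! ### Hilbert space tools: minimal sections, square roots, weak measurability -/

section Hilbert

variable {𝕜 H E : Type*} [RCLike 𝕜] [NormedAddCommGroup H] [InnerProductSpace 𝕜 H]
  [NormedAddCommGroup E] [InnerProductSpace 𝕜 E]

/-- The element of minimal norm in the fibres of a closed linear relation depends linearly
and continuously on the base point. -/
theorem exists_minimal_section [CompleteSpace E] (Γ : Submodule 𝕜 (H × E))
    (hΓ : IsClosed (Γ : Set (H × E))) {C : ℝ} (hC : ∀ x, ∃ g, (x, g) ∈ Γ ∧ ‖g‖ ≤ C * ‖x‖) :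
    ∃ T : H →L[𝕜] E, (∀ x, (x, T x) ∈ Γ) ∧ (∀ x g, (0, g) ∈ Γ → inner 𝕜 (T x) g = 0) ∧
      ∀ x, ‖T x‖ ≤ C * ‖x‖ := by
  set Γ₀ : Submodule 𝕜 E := Γ.comap (LinearMap.inr 𝕜 H E) with hΓ₀
  have hmem : ∀ g, g ∈ Γ₀ ↔ ((0 : H), g) ∈ Γ := fun g => by
    rw [hΓ₀, Submodule.mem_comap]; rfl
  have hcl : IsClosed (Γ₀ : Set E) :=
    hΓ.preimage (f := fun g : E => ((0 : H), g)) (by fun_prop)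
  have : CompleteSpace Γ₀ := hcl.completeSpace_coe
  have hex : ∀ x, ∃ g, (x, g) ∈ Γ ∧ (∀ g', (0, g') ∈ Γ → inner 𝕜 g g' = 0) ∧ ‖g‖ ≤ C * ‖x‖ := by
    intro x
    obtain ⟨g, hg, hgC⟩ := hC x
    have hp := Γ₀.starProjection_apply_mem g
    -- Subtracting the projection onto the fibre over 0 keeps the base point x, makes the element
    -- orthogonal to that fibre, and does not increase the norm.
    refine ⟨g - Γ₀.starProjection g, ?_, fun g' hg' => ?_, ?_⟩
    · have := Γ.sub_mem hg ((hmem _).1 hp)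
      simpa using this
    · exact Submodule.starProjection_inner_eq_zero g g' ((hmem _).2 hg')
    · refine le_trans ?_ hgC
      have h1 : inner 𝕜 (g - Γ₀.starProjection g) (Γ₀.starProjection g) = 0 :=
        Submodule.starProjection_inner_eq_zero g _ hp
      have h2 := norm_add_sq_eq_norm_sq_add_norm_sq_of_inner_eq_zero _ _ h1
      rw [sub_add_cancel] at h2
      nlinarith [norm_nonneg g, norm_nonneg (g - Γ₀.starProjection g),
        norm_nonneg (Γ₀.starProjection g)]
  choose T hT hTo hTC using hex
  -- Orthogonality determines the element of the fibre; linearity of T follows because sums and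
  -- multiples keep both properties.
  have huniq : ∀ x g, (x, g) ∈ Γ → (∀ g', (0, g') ∈ Γ → inner 𝕜 g g' = 0) → g = T x := by
    intro x g hg ho
    have h1 : (0, g - T x) ∈ Γ := by simpa using Γ.sub_mem hg (hT x)
    have h2 : inner 𝕜 (g - T x) (g - T x) = 0 := by
      rw [inner_sub_left, ho _ h1, hTo x _ h1, sub_zero]
    exact sub_eq_zero.1 (inner_self_eq_zero.1 h2)
  let L : H →ₗ[𝕜] E :=
    { toFun := T
      map_add' := fun x y => by
        refine (huniq _ _ (by simpa using Γ.add_mem (hT x) (hT y)) fun g' hg' => ?_).symm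
        rw [inner_add_left, hTo x _ hg', hTo y _ hg', add_zero]
      map_smul' := fun a x => by
        refine (huniq _ _ (by simpa using Γ.smul_mem a (hT x)) fun g' hg' => ?_).symm
        rw [inner_smul_left, hTo x _ hg', mul_zero] }
  exact ⟨L.mkContinuous C hTC, hT, hTo, hTC⟩

/-- The difference is symmetric, so its quadratic form is real and therefore zero; for symmetric
operators this forces the operator to vanish over ℝ as well as over ℂ. -/
lemma eq_of_re_inner_eq {P Q : H →L[𝕜] H} (hP : P.IsPositive) (hQ : Q.IsPositive)
    (h : ∀ x, RCLike.re (inner 𝕜 (P x) x) = RCLike.re (inner 𝕜 (Q x) x)) : P = Q := by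
  have hs : ((P - Q : H →L[𝕜] H) : H →ₗ[𝕜] H).IsSymmetric := fun x y => by
    have h1 := hP.isSymmetric x y
    have h2 := hQ.isSymmetric x y
    simp only [ContinuousLinearMap.coe_coe] at h1 h2
    simp [inner_sub_left, inner_sub_right, h1, h2]
  have h0 : ((P - Q : H →L[𝕜] H) : H →ₗ[𝕜] H) = 0 := by
    refine hs.inner_map_self_eq_zero.1 fun x => ?_
    have h1 := hs.coe_re_inner_apply_self x
    rw [← h1]
    simp [inner_sub_left, h x]
  exact sub_eq_zero.1 (ContinuousLinearMap.coe_injective h0)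

variable [CompleteSpace H]

/-- The square root is Hölder continuous of exponent `1/2` on nonnegative operators. -/
theorem norm_sub_sq_le_norm_mul_self_sub {S T : H →L[𝕜] H} (hS : S.IsPositive)
    (hT : T.IsPositive) : ‖S - T‖ ^ 2 ≤ ‖S * S - T * T‖ := by
  set D := S - T with hD
  set d := ‖D‖ with hd
  have hDs : IsSelfAdjoint D := hS.isSelfAdjoint.sub hT.isSelfAdjoint
  set c := ‖S‖ + ‖T‖ with hc
  have hc0 : 0 ≤ c := by positivity
  by_contra! hlt
  have hd0 : 0 < d := by
    rcases (norm_nonneg D).eq_or_lt with h | h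
    · rw [hd, ← h] at hlt
      exact absurd hlt (not_lt.2 (by simp))
    · exact h
  -- For an approximate eigenvector D x ≈ l x with |l| = d, the identity S² - T² = S D + D T makes
  -- the form of S² - T² nearly l (⟨S x, x⟩ + ⟨T x, x⟩). By positivity of S and T the bracket is at
  -- least |⟨D x, x⟩| = a‖x‖². The square root term is the error from D x ≠ l x.
  have key : ∀ x : H, x ≠ 0 → ∀ a, a = |D.rayleighQuotient x| → a ≤ d ∧
      d * a ≤ ‖S * S - T * T‖ + c * √(2 * d * (d - a)) := by
    intro x hx a ha
    have hx0 : 0 < ‖x‖ := norm_pos_iff.2 hx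
    set p := RCLike.re (inner 𝕜 (D x) x) with hp
    have hpa : |p| = a * ‖x‖ ^ 2 := by
      rw [ha, ContinuousLinearMap.rayleighQuotient, abs_div, abs_of_nonneg (sq_nonneg ‖x‖),
        div_mul_cancel₀ _ (by positivity)]
      rfl
    have hDx : ‖D x‖ ≤ d * ‖x‖ := D.le_opNorm x
    have hpd : |p| ≤ d * ‖x‖ ^ 2 := by
      refine (RCLike.abs_re_le_norm _).trans ((norm_inner_le_norm _ _).trans ?_)
      nlinarith
    have had : a ≤ d := by
      rw [hpa] at hpd
      exact le_of_mul_le_mul_right hpd (by positivity)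
    refine ⟨had, ?_⟩
    -- l is d with the sign of ⟨D x, x⟩.
    obtain ⟨l, hl, hlp⟩ : ∃ l : ℝ, |l| = d ∧ l * p = d * |p| := by
      rcases le_total 0 p with h | h
      · exact ⟨d, abs_of_pos hd0, by rw [abs_of_nonneg h]⟩
      · exact ⟨-d, by rw [abs_neg, abs_of_pos hd0], by rw [abs_of_nonpos h]; ring⟩
    set r := D x - (l : 𝕜) • x with hr
    have hrn : ‖r‖ ^ 2 ≤ 2 * d * (d - a) * ‖x‖ ^ 2 := by
      have h1 : ‖r‖ ^ 2 = ‖D x‖ ^ 2 - 2 * (l * p) + (d * ‖x‖) ^ 2 := by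
        rw [hr, norm_sub_sq (𝕜 := 𝕜), inner_smul_right, RCLike.re_ofReal_mul, norm_smul,
          RCLike.norm_ofReal, hl]
      rw [h1, hlp, hpa]
      have : ‖D x‖ ^ 2 ≤ (d * ‖x‖) ^ 2 := pow_le_pow_left₀ (norm_nonneg _) hDx 2
      nlinarith
    have hrn' : ‖r‖ ≤ √(2 * d * (d - a)) * ‖x‖ := by
      rw [← Real.sqrt_sq hx0.le, ← Real.sqrt_mul (by nlinarith [sub_nonneg.2 had])]
      exact Real.le_sqrt_of_sq_le hrn
    have hDr : D x = (l : 𝕜) • x + r := by rw [hr]; abel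
    have hid : RCLike.re (inner 𝕜 ((S * S - T * T) x) x)
        = l * (RCLike.re (inner 𝕜 (S x) x) + RCLike.re (inner 𝕜 (T x) x))
          + RCLike.re (inner 𝕜 r (S x)) + RCLike.re (inner 𝕜 (T x) r) := by
      have h1 : (S * S - T * T) x = S (D x) + D (T x) := by
        simp [hD]
      have h2 : inner 𝕜 (S (D x)) x = inner 𝕜 (D x) (S x) := hS.isSymmetric _ _
      have h3 : inner 𝕜 (D (T x)) x = inner 𝕜 (T x) (D x) := hDs.isSymmetric _ _
      have h4 : RCLike.re (inner 𝕜 x (S x)) = RCLike.re (inner 𝕜 (S x) x) := inner_re_symm _ _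
      rw [h1, inner_add_left, h2, h3, hDr, inner_add_left, inner_add_right, inner_smul_left,
        inner_smul_right, RCLike.conj_ofReal]
      simp only [map_add, RCLike.re_ofReal_mul, h4]
      ring
    have hSx : 0 ≤ RCLike.re (inner 𝕜 (S x) x) := hS.re_inner_nonneg_left x
    have hTx : 0 ≤ RCLike.re (inner 𝕜 (T x) x) := hT.re_inner_nonneg_left x
    have hple : |p| ≤ RCLike.re (inner 𝕜 (S x) x) + RCLike.re (inner 𝕜 (T x) x) := by
      rw [hp, hD]
      simp only [sub_apply, inner_sub_left, map_sub]
      rw [abs_le]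
      constructor <;> linarith
    have h5 : |RCLike.re (inner 𝕜 ((S * S - T * T) x) x)| ≤ ‖S * S - T * T‖ * ‖x‖ ^ 2 := by
      refine (RCLike.abs_re_le_norm _).trans ((norm_inner_le_norm _ _).trans ?_)
      nlinarith [(S * S - T * T).le_opNorm x]
    have h6 : |RCLike.re (inner 𝕜 r (S x))| ≤ ‖r‖ * (‖S‖ * ‖x‖) :=
      (RCLike.abs_re_le_norm _).trans ((norm_inner_le_norm _ _).trans
        (mul_le_mul_of_nonneg_left (S.le_opNorm x) (norm_nonneg _)))
    have h7 : |RCLike.re (inner 𝕜 (T x) r)| ≤ ‖T‖ * ‖x‖ * ‖r‖ :=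
      (RCLike.abs_re_le_norm _).trans ((norm_inner_le_norm _ _).trans
        (mul_le_mul_of_nonneg_right (T.le_opNorm x) (norm_nonneg _)))
    have h8 : d * |p| ≤ ‖S * S - T * T‖ * ‖x‖ ^ 2 + c * ‖x‖ * ‖r‖ := by
      have h9 : d * |p| ≤ |l * (RCLike.re (inner 𝕜 (S x) x) + RCLike.re (inner 𝕜 (T x) x))| := by
        rw [abs_mul, hl, abs_of_nonneg (add_nonneg hSx hTx)]
        exact mul_le_mul_of_nonneg_left hple hd0.le
      have h10 : l * (RCLike.re (inner 𝕜 (S x) x) + RCLike.re (inner 𝕜 (T x) x))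
          = RCLike.re (inner 𝕜 ((S * S - T * T) x) x) - RCLike.re (inner 𝕜 r (S x))
            - RCLike.re (inner 𝕜 (T x) r) := by rw [hid]; ring
      rw [h10] at h9
      refine h9.trans ((abs_sub _ _).trans (?_ : _ ≤ _))
      have h11 := abs_sub (RCLike.re (inner 𝕜 ((S * S - T * T) x) x)) (RCLike.re (inner 𝕜 r (S x)))
      rw [hc]
      linarith
    have h12 : c * ‖x‖ * ‖r‖ ≤ c * √(2 * d * (d - a)) * ‖x‖ ^ 2 := by
      calc c * ‖x‖ * ‖r‖ ≤ c * ‖x‖ * (√(2 * d * (d - a)) * ‖x‖) :=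
            mul_le_mul_of_nonneg_left hrn' (by positivity)
        _ = _ := by ring
    rw [hpa] at h8
    refine le_of_mul_le_mul_right ?_ (pow_pos hx0 2)
    linarith
  -- As a tends to d, the inequality of `key` becomes d² ≤ ‖S² - T²‖, contrary to the assumption.
  have hcont : Tendsto (fun a => d * a - c * √(2 * d * (d - a))) (𝓝 d) (𝓝 (d ^ 2)) := by
    have : Continuous fun a => d * a - c * √(2 * d * (d - a)) := by fun_prop
    convert this.tendsto d using 2
    simp [sq]
  obtain ⟨e, he, hball⟩ := Metric.eventually_nhds_iff.1 (hcont.eventually (lt_mem_nhds hlt))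
  have hsup : d = ⨆ x, |D.rayleighQuotient x| :=
    ContinuousLinearMap.norm_eq_iSup_rayleighQuotient D hDs.isSymmetric
  -- The maximum with 0 excludes x = 0, whose Rayleigh quotient is 0.
  obtain ⟨x, hx⟩ := exists_lt_of_lt_ciSup (lt_of_lt_of_eq (max_lt (sub_lt_self d he) hd0) hsup)
  have hx0 : x ≠ 0 := by
    rintro rfl
    simp at hx
  obtain ⟨h1, h2⟩ := key x hx0 _ rfl
  have h3 := hball (y := |D.rayleighQuotient x|) (by
    rw [Real.dist_eq, abs_lt]
    have := (le_max_left _ _).trans_lt hx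
    constructor <;> linarith)
  linarith

lemma continuousOn_posSqrt {α : Type*} [TopologicalSpace α] {W : α → H →L[𝕜] H} {S : Set α}
    (hW : ContinuousOn W S) (hpos : ∀ t ∈ S, (W t).IsPositive) :
    ContinuousOn (fun t => posSqrt (W t)) S := by
  intro t ht
  rw [ContinuousWithinAt, tendsto_iff_norm_sub_tendsto_zero]
  have h1 : Tendsto (fun x => √‖W x - W t‖) (𝓝[S] t) (𝓝 0) := by
    have := ((tendsto_iff_norm_sub_tendsto_zero.1 (hW t ht))).sqrt
    simpa using this
  refine squeeze_zero' (Eventually.of_forall fun _ => norm_nonneg _) ?_ h1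
  filter_upwards [self_mem_nhdsWithin] with x hx
  refine Real.le_sqrt_of_sq_le ?_
  have := norm_sub_sq_le_norm_mul_self_sub (posSqrt_isPositive (hpos x hx))
    (posSqrt_isPositive (hpos t ht))
  rwa [posSqrt_mul_self (hpos x hx), posSqrt_mul_self (hpos t ht)] at this

lemma norm_posSqrt_apply_sq {W : H →L[𝕜] H} (hW : W.IsPositive) (x : H) :
    ‖posSqrt W x‖ ^ 2 = RCLike.re (inner 𝕜 x (W x)) := by
  have h := (posSqrt_isPositive hW).isSymmetric x (posSqrt W x)
  simp only [ContinuousLinearMap.coe_coe] at h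
  have h' : W x = posSqrt W (posSqrt W x) := by
    rw [← mul_apply_eq_comp, posSqrt_mul_self hW]
  rw [h', ← h, inner_self_eq_norm_sq]

lemma norm_posSqrt_sq_le {W : H →L[𝕜] H} (hW : W.IsPositive) : ‖posSqrt W‖ ^ 2 ≤ ‖W‖ := by
  have h : ‖posSqrt W‖ ≤ √‖W‖ := by
    refine ContinuousLinearMap.opNorm_le_bound _ (Real.sqrt_nonneg _) fun x => ?_
    rw [← Real.sqrt_sq (norm_nonneg x), ← Real.sqrt_mul (norm_nonneg _)]
    refine Real.le_sqrt_of_sq_le ?_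
    rw [norm_posSqrt_apply_sq hW]
    refine (RCLike.re_le_norm _).trans ((norm_inner_le_norm _ _).trans ?_)
    nlinarith [W.le_opNorm x, norm_nonneg x]
  calc ‖posSqrt W‖ ^ 2 ≤ √‖W‖ ^ 2 := pow_le_pow_left₀ (norm_nonneg _) h 2
    _ = ‖W‖ := Real.sq_sqrt (norm_nonneg _)

lemma IsBoundedContinuous.posSqrt {W : ℝ → H →L[𝕜] H} (hW : IsBoundedContinuous W)
    (hpos : ∀ t, 0 ≤ t → (W t).IsPositive) : IsBoundedContinuous fun t => posSqrt (W t) := by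
  refine ⟨continuousOn_posSqrt hW.1 hpos, ?_⟩
  obtain ⟨c, hc⟩ := hW.2
  refine ⟨√c, fun t ht => Real.le_sqrt_of_sq_le ?_⟩
  exact (norm_posSqrt_sq_le (hpos t ht)).trans (hc t ht)

/-- Weakly continuous Hilbert space valued functions are strongly measurable. -/
theorem stronglyMeasurable_of_continuous_inner {g : ℝ → H}
    (hg : ∀ v, Continuous fun q => inner 𝕜 v (g q)) : StronglyMeasurable g := by
  -- The finite-dimensional spans of the values of g along a dense sequence of times; g will be the
  -- pointwise limit of its projections onto them.
  let U : ℕ → Submodule 𝕜 H := fun n =>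
    Submodule.span 𝕜 ((fun i => g (TopologicalSpace.denseSeq ℝ i)) '' Set.Iio n)
  have hfd : ∀ n, FiniteDimensional 𝕜 (U n) := fun n =>
    FiniteDimensional.span_of_finite 𝕜 ((Set.finite_Iio n).image _)
  have hmono : Monotone U := fun m n hmn =>
    Submodule.span_mono (Set.image_mono (Set.Iio_subset_Iio hmn))
  set K := (⨆ n, U n).topologicalClosure with hK
  have : CompleteSpace K := (Submodule.isClosed_topologicalClosure _).completeSpace_coe
  have hgK : ∀ q, g q ∈ K := by
    intro q
    -- A vector orthogonal to K is orthogonal to g at a dense set of times, hence by weak continuity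
    -- at all times.
    rw [← Submodule.orthogonal_orthogonal K, Submodule.mem_orthogonal]
    intro v hv
    have h0 : (fun q => inner 𝕜 v (g q)) = fun _ => 0 := by
      refine (TopologicalSpace.denseRange_denseSeq ℝ).equalizer (hg v) continuous_const ?_
      ext i
      have hi : g (TopologicalSpace.denseSeq ℝ i) ∈ K :=
        Submodule.le_topologicalClosure _ ((le_iSup U (i + 1))
          (Submodule.subset_span ⟨i, Set.mem_Iio.2 (Nat.lt_succ_self i), rfl⟩))
      exact (Submodule.mem_orthogonal' _ _).1 hv _ hi
    exact congrFun h0 q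
  refine stronglyMeasurable_of_tendsto atTop
    (f := fun n q => (U n).starProjection (g q)) (fun n => ?_) (tendsto_pi_nhds.2 fun q => ?_)
  · refine Continuous.stronglyMeasurable ?_
    have : ∀ q, (U n).starProjection (g q)
        = ∑ i, inner 𝕜 (stdOrthonormalBasis 𝕜 (U n) i : H) (g q)
          • (stdOrthonormalBasis 𝕜 (U n) i : H) := by
      intro q
      rw [Submodule.starProjection_apply,
        ← (stdOrthonormalBasis 𝕜 (U n)).sum_repr' ((U n).orthogonalProjectionOnto (g q))]
      simp
    simp_rw [this]
    exact continuous_finsetSum _ fun i _ => (hg _).smul continuous_const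
  · have := Submodule.starProjection_tendsto_closure_iSup U hmono (g q)
    rwa [Submodule.starProjection_eq_self_iff.2 (hgK q)] at this

end Hilbert

/-! ### Square integral estimates and Datko's criterion -/

lemma intervalIntegrable_of_sq {φ : ℝ → ℝ} {s t : ℝ} (hst : s ≤ t)
    (hm : AEStronglyMeasurable φ (volume.restrict (Set.Ioc s t)))
    (h2 : IntervalIntegrable (fun r => φ r ^ 2) volume s t) :
    IntervalIntegrable φ volume s t := by
  rw [intervalIntegrable_iff_integrableOn_Ioc_of_le hst] at h2 ⊢
  refine Integrable.mono' (g := fun r => 1 + φ r ^ 2) (Integrable.add (by simp) h2) hm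
    (ae_of_all _ fun r => ?_)
  rw [Real.norm_eq_abs, ← sq_abs (φ r)]
  nlinarith [sq_nonneg (|φ r| - 1), abs_nonneg (φ r)]

/-- Weighted Cauchy–Schwarz: expand the nonnegative integral of e (φ - α I1)² and use that the
weight e has mass at most 1 / α. -/
lemma sq_integral_exp_mul_le {φ : ℝ → ℝ} {s t α : ℝ} (hα : 0 < α) (hst : s ≤ t)
    (hm : AEStronglyMeasurable φ (volume.restrict (Set.Ioc s t)))
    (h2 : IntervalIntegrable (fun r => φ r ^ 2) volume s t) :
    (∫ r in s..t, Real.exp (-α * (t - r)) * φ r) ^ 2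
      ≤ 1 / α * ∫ r in s..t, Real.exp (-α * (t - r)) * φ r ^ 2 := by
  have h1 := intervalIntegrable_of_sq hst hm h2
  set e : ℝ → ℝ := fun r => Real.exp (-α * (t - r)) with he
  have hec : Continuous e := by rw [he]; fun_prop
  have i1 : IntervalIntegrable (fun r => e r * φ r) volume s t := h1.continuousOn_mul hec.continuousOn
  have i2 : IntervalIntegrable (fun r => e r * φ r ^ 2) volume s t :=
    h2.continuousOn_mul hec.continuousOn
  have i0 : IntervalIntegrable e volume s t := hec.intervalIntegrable _ _
  set I1 := ∫ r in s..t, e r * φ r with hI1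
  set I2 := ∫ r in s..t, e r * φ r ^ 2 with hI2
  have hI0 : ∫ r in s..t, e r ≤ 1 / α := by
    rw [he, integral_exp_mul_sub_right (neg_ne_zero.2 hα.ne'), div_neg, ← neg_div, neg_sub]
    refine div_le_div_of_nonneg_right ?_ hα.le
    linarith [Real.exp_pos (-α * (t - s))]
  have hpos : 0 ≤ ∫ r in s..t, e r * (φ r - α * I1) ^ 2 :=
    intervalIntegral.integral_nonneg hst fun r _ => mul_nonneg (Real.exp_pos _).le (sq_nonneg _)
  have hex : ∫ r in s..t, e r * (φ r - α * I1) ^ 2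
      = I2 - 2 * (α * I1) * I1 + (α * I1) ^ 2 * ∫ r in s..t, e r := by
    have : ∀ r, e r * (φ r - α * I1) ^ 2
        = e r * φ r ^ 2 - 2 * (α * I1) * (e r * φ r) + (α * I1) ^ 2 * e r := fun r => by ring
    simp_rw [this]
    rw [intervalIntegral.integral_add (i2.sub (i1.const_mul _)) (i0.const_mul _),
      intervalIntegral.integral_sub i2 (i1.const_mul _), intervalIntegral.integral_const_mul,
      intervalIntegral.integral_const_mul]
  rw [hex] at hpos
  have h3 : (α * I1) ^ 2 * ∫ r in s..t, e r ≤ (α * I1) ^ 2 * (1 / α) :=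
    mul_le_mul_of_nonneg_left hI0 (sq_nonneg _)
  have h4 : (α * I1) ^ 2 * (1 / α) = α * I1 ^ 2 := by field_simp
  rw [one_div, inv_mul_eq_div, le_div_iff₀ hα]
  nlinarith

/-- Young's inequality for convolution with an exponential kernel: exchange the integrals and bound
the inner mass by 1 / α. -/
lemma integral_integral_exp_mul_le {F : ℝ → ℝ} {s T α : ℝ} (hα : 0 < α) (hsT : s ≤ T)
    (hF0 : ∀ r, 0 ≤ F r) (hF : IntervalIntegrable F volume s T) :
    IntervalIntegrable (fun t => ∫ r in s..t, Real.exp (-α * (t - r)) * F r) volume s T ∧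
    ∫ t in s..T, ∫ r in s..t, Real.exp (-α * (t - r)) * F r ≤ 1 / α * ∫ r in s..T, F r := by
  rw [intervalIntegrable_iff_integrableOn_Ioc_of_le hsT] at hF ⊢
  set μ := volume.restrict (Set.Ioc s T) with hμ
  have hk : Integrable (Function.uncurry fun t r =>
      Set.indicator (Set.Ioi r) (fun t => Real.exp (-α * (t - r)) * F r) t) (μ.prod μ) := by
    refine Integrable.mono' (g := fun p : ℝ × ℝ => F p.2) (Integrable.comp_snd hF μ) ?_
      (ae_of_all _ fun p => ?_)
    · have h1 : AEStronglyMeasurable (fun p : ℝ × ℝ => Real.exp (-α * (p.1 - p.2)) * F p.2)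
          (μ.prod μ) := by
        refine AEStronglyMeasurable.mul (Continuous.aestronglyMeasurable (by fun_prop)) ?_
        exact AEStronglyMeasurable.comp_snd hF.aestronglyMeasurable
      refine (h1.indicator (measurableSet_lt (measurable_snd (α := ℝ) (β := ℝ))
        measurable_fst)).congr (ae_of_all _ fun p => ?_)
      simp only [Function.uncurry, Set.indicator, Set.mem_Ioi, Set.mem_ofPred_eq]
    · simp only [Function.uncurry, Set.indicator, Set.mem_Ioi]
      split_ifs with h
      · rw [norm_mul, Real.norm_eq_abs, Real.norm_eq_abs, abs_of_pos (Real.exp_pos _),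
          abs_of_nonneg (hF0 _)]
        refine mul_le_of_le_one_left (hF0 _) (Real.exp_le_one_iff.2 ?_)
        nlinarith
      · simpa using hF0 _
  have h1 : ∀ t ∈ Set.Ioc s T, ∫ r in s..t, Real.exp (-α * (t - r)) * F r
      = ∫ r, Set.indicator (Set.Ioi r) (fun t => Real.exp (-α * (t - r)) * F r) t ∂μ := by
    intro t ht
    have h4 : ∀ r, Set.indicator (Set.Ioi r) (fun t => Real.exp (-α * (t - r)) * F r) t
        = Set.indicator (Set.Iio t) (fun r => Real.exp (-α * (t - r)) * F r) r := fun r => by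
      simp only [Set.indicator, Set.mem_Ioi, Set.mem_Iio]
    simp_rw [h4]
    rw [integral_indicator measurableSet_Iio, hμ, Measure.restrict_restrict measurableSet_Iio,
      intervalIntegral.integral_of_le ht.1.le, integral_Ioc_eq_integral_Ioo]
    congr 2
    ext q
    simp only [Set.mem_Ioo, Set.mem_inter_iff, Set.mem_Ioc, Set.mem_Iio]
    exact ⟨fun h => ⟨h.2, h.1, h.2.le.trans ht.2⟩, fun h => ⟨h.2.1, h.1⟩⟩
  refine ⟨(integrableOn_congr_fun h1 measurableSet_Ioc).2 hk.integral_prod_left, ?_⟩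
  rw [intervalIntegral.integral_of_le hsT, setIntegral_congr_fun measurableSet_Ioc h1,
    integral_integral_swap hk, intervalIntegral.integral_of_le hsT, ← integral_const_mul]
  refine setIntegral_mono_on hk.integral_prod_right (hF.const_mul _) measurableSet_Ioc fun r hr => ?_
  rw [integral_indicator measurableSet_Ioi, Measure.restrict_restrict measurableSet_Ioi,
    integral_mul_const]
  refine mul_le_mul_of_nonneg_right ?_ (hF0 r)
  have h5 : Set.Ioi r ∩ Set.Ioc s T = Set.Ioc r T := by
    ext q
    simp only [Set.mem_inter_iff, Set.mem_Ioc, Set.mem_Ioi]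
    exact ⟨fun h => ⟨h.1, h.2.2⟩, fun h => ⟨h.1, hr.1.trans h.1, h.2⟩⟩
  rw [h5, ← intervalIntegral.integral_of_le hr.2,
    integral_exp_mul_sub_left (neg_ne_zero.2 hα.ne'), div_neg, ← neg_div, neg_sub]
  refine div_le_div_of_nonneg_right ?_ hα.le
  linarith [Real.exp_pos (-α * (T - r))]

section

variable {𝕜 H : Type*} [RCLike 𝕜] [NormedAddCommGroup H] [InnerProductSpace 𝕜 H]
  {V : ℝ → ℝ → H →L[𝕜] H}

/-- Datko's criterion for exponential stability. -/
theorem isExponentiallyStable_of_integral_le (hV : IsEvolutionOperator V) {C : ℝ}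
    (h1 : ∀ s t, 0 ≤ s → s ≤ t → ∀ x, ‖V t s x‖ ^ 2 ≤ C * ‖x‖ ^ 2)
    (h2 : ∀ s t, 0 ≤ s → s ≤ t → ∀ x, ∫ r in s..t, ‖V r s x‖ ^ 2 ≤ C * ‖x‖ ^ 2) :
    IsExponentiallyStable V := by
  set c := max C 0 with hc
  have hc0 : 0 ≤ c := le_max_right _ _
  have h1' : ∀ s t, 0 ≤ s → s ≤ t → ∀ x, ‖V t s x‖ ^ 2 ≤ c * ‖x‖ ^ 2 := fun s t hs hst x =>
    (h1 s t hs hst x).trans (mul_le_mul_of_nonneg_right (le_max_left _ _) (sq_nonneg _))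
  have h2' : ∀ s t, 0 ≤ s → s ≤ t → ∀ x, ∫ r in s..t, ‖V r s x‖ ^ 2 ≤ c * ‖x‖ ^ 2 :=
    fun s t hs hst x =>
      (h2 s t hs hst x).trans (mul_le_mul_of_nonneg_right (le_max_left _ _) (sq_nonneg _))
  -- By V t s = V t r ∘ V r s, the norm at time t is controlled by the norm at every earlier r;
  -- averaging over r uses the square integral bound.
  have h3 : ∀ s t, 0 ≤ s → s ≤ t → ∀ x, (t - s) * ‖V t s x‖ ^ 2 ≤ c * (c * ‖x‖ ^ 2) := by
    intro s t hs hst x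
    have hi : IntervalIntegrable (fun r => c * ‖V r s x‖ ^ 2) volume s t := by
      refine ContinuousOn.intervalIntegrable ?_
      rw [Set.uIcc_of_le hst]
      exact (((hV.continuousOn_left s hs x).mono Set.Icc_subset_Ici_self).norm.pow 2).const_smul c
    calc (t - s) * ‖V t s x‖ ^ 2 = ∫ _ in s..t, ‖V t s x‖ ^ 2 := by simp
      _ ≤ ∫ r in s..t, c * ‖V r s x‖ ^ 2 := by
        refine intervalIntegral.integral_mono_on hst (by simp) hi fun r hr => ?_
        rw [← hV.comp s r t hs hr.1 hr.2]
        exact h1' r t (hs.trans hr.1) hr.2 _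
      _ ≤ _ := by
        rw [intervalIntegral.integral_const_mul]
        exact mul_le_mul_of_nonneg_left (h2' s t hs hst x) hc0
  -- After a time τ the bound c² / τ on the squared norm is below 1 / 4, so V contracts by 1 / 2.
  set τ := 4 * c ^ 2 + 1 with hτ
  have hτ0 : 0 < τ := by positivity
  have h4 : ∀ s t, 0 ≤ s → s + τ ≤ t → ∀ x, ‖V t s x‖ ≤ 1 / 2 * ‖x‖ := by
    intro s t hs hst x
    have h5 := h3 s t hs (by linarith) x
    refine abs_le_of_sq_le_sq' ?_ (by positivity) |>.2
    have h6 : τ * ‖V t s x‖ ^ 2 ≤ (t - s) * ‖V t s x‖ ^ 2 :=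
      mul_le_mul_of_nonneg_right (by linarith) (sq_nonneg _)
    refine le_of_mul_le_mul_left (h6.trans (h5.trans ?_)) hτ0
    rw [hτ]
    nlinarith [sq_nonneg ‖x‖]
  have h5 : ∀ n : ℕ, ∀ s t, 0 ≤ s → s + n * τ ≤ t → ∀ x, ‖V t s x‖ ≤ √c * (1 / 2) ^ n * ‖x‖ := by
    intro n
    induction n with
    | zero =>
      intro s t hs hst x
      refine abs_le_of_sq_le_sq' ?_ (by positivity) |>.2
      rw [pow_zero, mul_one, mul_pow, Real.sq_sqrt hc0]
      exact h1' s t hs (by simpa using hst) x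
    | succ n ih =>
      intro s t hs hst x
      push_cast at hst
      have hn : 0 ≤ n * τ := by positivity
      rw [← hV.comp s (s + τ) t hs (by linarith) (by linarith), ContinuousLinearMap.comp_apply]
      refine (ih (s + τ) t (by linarith) (by linarith) _).trans ?_
      rw [pow_succ, ← mul_assoc, mul_assoc (√c * (1 / 2) ^ n)]
      exact mul_le_mul_of_nonneg_left (h4 s (s + τ) hs le_rfl x) (by positivity)
  -- The norm halves over each period τ; the factor 2 pays for rounding (t - s) / τ down to an
  -- integer.
  refine ⟨2 * √c, Real.log 2 / τ, by positivity, div_pos (Real.log_pos one_lt_two) hτ0,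
    fun s t hs hst => ?_⟩
  refine ContinuousLinearMap.opNorm_le_bound _ (by positivity) fun x => ?_
  set n := ⌊(t - s) / τ⌋₊ with hn
  have hn1 : n * τ ≤ t - s := by
    rw [← le_div_iff₀ hτ0]
    exact Nat.floor_le (div_nonneg (sub_nonneg.2 hst) hτ0.le)
  have hn2 : (t - s) / τ < n + 1 := Nat.lt_floor_add_one _
  refine (h5 n s t hs (by linarith) x).trans (mul_le_mul_of_nonneg_right ?_ (norm_nonneg _))
  have h6 : ((1 / 2 : ℝ)) ^ n = Real.exp (-(n * Real.log 2)) := by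
    rw [Real.exp_neg, mul_comm, Real.exp_mul, Real.exp_log two_pos, Real.rpow_natCast]
    simp
  have h7 : (2 : ℝ) = Real.exp (Real.log 2) := (Real.exp_log two_pos).symm
  have h8 : ((1 / 2 : ℝ)) ^ n ≤ 2 * Real.exp (-(Real.log 2 / τ) * (t - s)) := by
    rw [h6]
    nth_rewrite 2 [h7]
    rw [← Real.exp_add]
    refine Real.exp_le_exp.2 ?_
    have : Real.log 2 * ((t - s) / τ) ≤ Real.log 2 * (n + 1) :=
      mul_le_mul_of_nonneg_left hn2.le (Real.log_pos one_lt_two).le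
    have h9 : -(Real.log 2 / τ) * (t - s) = -(Real.log 2 * ((t - s) / τ)) := by ring
    rw [h9]
    linarith
  calc √c * (1 / 2) ^ n ≤ √c * (2 * Real.exp (-(Real.log 2 / τ) * (t - s))) :=
        mul_le_mul_of_nonneg_left h8 (Real.sqrt_nonneg _)
    _ = _ := by ring

variable [NormedSpace ℝ H]

/-- Pointwise estimate of a mild solution for an exponentially stable evolution operator. -/
lemma norm_mild_sq_le {M α : ℝ} (hα : 0 < α)
    (hVb : ∀ s t, 0 ≤ s → s ≤ t → ‖V t s‖ ≤ M * Real.exp (-α * (t - s)))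
    {s t : ℝ} (hs : 0 ≤ s) (hst : s ≤ t) (x : H) {f : ℝ → H}
    (hm : AEStronglyMeasurable f (volume.restrict (Set.Ioc s t)))
    (h2 : IntervalIntegrable (fun r => ‖f r‖ ^ 2) volume s t) :
    ‖mild V s x f t‖ ^ 2 ≤ 2 * M ^ 2 * (Real.exp (-α * (t - s)) * ‖x‖ ^ 2
      + 1 / α * ∫ r in s..t, Real.exp (-α * (t - r)) * ‖f r‖ ^ 2) := by
  have h3 := sq_integral_exp_mul_le hα hst hm.norm h2
  have h1 := intervalIntegrable_of_sq hst hm.norm h2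
  set I := ∫ r in s..t, Real.exp (-α * (t - r)) * ‖f r‖ with hI
  have hi : IntervalIntegrable (fun r => Real.exp (-α * (t - r)) * ‖f r‖) volume s t :=
    h1.continuousOn_mul (Continuous.continuousOn (by fun_prop))
  have hI0 : 0 ≤ I := intervalIntegral.integral_nonneg hst fun r _ => by positivity
  have h4 : ‖∫ r in s..t, V t r (f r)‖ ≤ M * I := by
    rw [hI, ← intervalIntegral.integral_const_mul]
    refine intervalIntegral.norm_integral_le_of_norm_le hst (ae_of_all _ fun r hr => ?_)
      (hi.const_mul M)
    rw [← mul_assoc]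
    exact (ContinuousLinearMap.le_opNorm _ _).trans
      (mul_le_mul_of_nonneg_right (hVb r t (hs.trans hr.1.le) hr.2) (norm_nonneg _))
  set e := Real.exp (-α * (t - s)) with he
  have he0 : 0 < e := Real.exp_pos _
  have he1 : e ≤ 1 := Real.exp_le_one_iff.2 (by nlinarith)
  have h5 : ‖V t s x‖ ≤ M * e * ‖x‖ := (ContinuousLinearMap.le_opNorm _ _).trans
    (mul_le_mul_of_nonneg_right (hVb s t hs hst) (norm_nonneg _))
  have h6 : ‖mild V s x f t‖ ≤ M * (e * ‖x‖ + I) := by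
    rw [mild]
    refine (norm_add_le _ _).trans ?_
    linarith
  calc ‖mild V s x f t‖ ^ 2 ≤ (M * (e * ‖x‖ + I)) ^ 2 := pow_le_pow_left₀ (norm_nonneg _) h6 2
    _ = M ^ 2 * (e * ‖x‖ + I) ^ 2 := by ring
    _ ≤ M ^ 2 * (2 * (e * ‖x‖ ^ 2 + I ^ 2)) := by
      refine mul_le_mul_of_nonneg_left ?_ (sq_nonneg _)
      have : (e * ‖x‖) ^ 2 ≤ e * ‖x‖ ^ 2 := by
        rw [mul_pow]
        refine mul_le_mul_of_nonneg_right ?_ (sq_nonneg _)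
        nlinarith
      nlinarith [sq_nonneg (e * ‖x‖ - I)]
    _ ≤ _ := by
      have : M ^ 2 * (2 * (e * ‖x‖ ^ 2 + I ^ 2)) = 2 * M ^ 2 * (e * ‖x‖ ^ 2 + I ^ 2) := by ring
      rw [this]
      gcongr

/-- Uniform and square integral estimates of a mild solution for an exponentially stable
evolution operator. -/
theorem exists_mild_le [CompleteSpace H] (hV : IsEvolutionOperator V)
    (hVs : IsExponentiallyStable V) :
    ∃ c : ℝ, 0 ≤ c ∧ ∀ s t, 0 ≤ s → s ≤ t → ∀ (x : H) (f : ℝ → H),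
      AEStronglyMeasurable f (volume.restrict (Set.Ioc s t)) →
      IntervalIntegrable (fun r => ‖f r‖ ^ 2) volume s t →
      ‖mild V s x f t‖ ^ 2 ≤ c * (‖x‖ ^ 2 + ∫ r in s..t, ‖f r‖ ^ 2) ∧
      ∫ r in s..t, ‖mild V s x f r‖ ^ 2 ≤ c * (‖x‖ ^ 2 + ∫ r in s..t, ‖f r‖ ^ 2) := by
  have hVlb := hVs.isLocallyBounded
  obtain ⟨M, α, hM, hα, hVb⟩ := hVs
  -- a dominates both 1 and 1 / α, so a * a serves as a common constant for the pointwise and the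
  -- integral estimates.
  set a := 1 + 1 / α with ha
  have ha1 : 1 ≤ a := by rw [ha]; have : 0 < 1 / α := by positivity
                         linarith
  have haα : 1 / α ≤ a := by rw [ha]; linarith
  have hα0 : 0 < 1 / α := by positivity
  refine ⟨2 * M ^ 2 * (a * a), by positivity, fun s t hs hst x f hm h2 => ?_⟩
  have hmono : ∀ r ∈ Set.Icc s t, IntervalIntegrable (fun r => ‖f r‖ ^ 2) volume s r :=
    fun r hr => h2.mono_set (by
      rw [Set.uIcc_of_le hr.1, Set.uIcc_of_le hst]; exact Set.Icc_subset_Icc_right hr.2)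
  have hpt := fun r (hr : r ∈ Set.Icc s t) => norm_mild_sq_le hα hVb hs hr.1 x
    (hm.mono_set (Set.Ioc_subset_Ioc_right hr.2)) (hmono r hr)
  set F := ∫ r in s..t, ‖f r‖ ^ 2 with hF
  have hF0 : 0 ≤ F := intervalIntegral.integral_nonneg hst fun r _ => sq_nonneg _
  constructor
  · refine (hpt t ⟨hst, le_rfl⟩).trans ?_
    rw [mul_assoc (2 * M ^ 2)]
    refine mul_le_mul_of_nonneg_left ?_ (by positivity)
    have he1 : Real.exp (-α * (t - s)) ≤ 1 := Real.exp_le_one_iff.2 (by nlinarith)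
    have h3 : ∫ r in s..t, Real.exp (-α * (t - r)) * ‖f r‖ ^ 2 ≤ F := by
      refine intervalIntegral.integral_mono_on hst
        (h2.continuousOn_mul (Continuous.continuousOn (by fun_prop))) h2 fun r hr => ?_
      refine mul_le_of_le_one_left (sq_nonneg _) (Real.exp_le_one_iff.2 ?_)
      have := hr.2
      nlinarith
    have h4 : 1 / α * ∫ r in s..t, Real.exp (-α * (t - r)) * ‖f r‖ ^ 2 ≤ a * F :=
      (mul_le_mul_of_nonneg_left h3 hα0.le).trans (mul_le_mul_of_nonneg_right haα hF0)
    have h5 : Real.exp (-α * (t - s)) * ‖x‖ ^ 2 ≤ 1 * ‖x‖ ^ 2 :=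
      mul_le_mul_of_nonneg_right he1 (sq_nonneg _)
    nlinarith [sq_nonneg ‖x‖, mul_nonneg (sub_nonneg.2 ha1) hF0,
      mul_nonneg (sub_nonneg.2 ha1) (sq_nonneg ‖x‖),
      mul_nonneg (mul_nonneg (sub_nonneg.2 ha1) (zero_le_one.trans ha1)) hF0,
      mul_nonneg (mul_nonneg (sub_nonneg.2 ha1) (zero_le_one.trans ha1)) (sq_nonneg ‖x‖)]
  · obtain ⟨h3, h4⟩ := integral_integral_exp_mul_le hα hst (fun r => sq_nonneg ‖f r‖) h2
    have hfi : IntervalIntegrable f volume s t := by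
      have := intervalIntegrable_of_sq hst hm.norm h2
      rw [intervalIntegrable_iff_integrableOn_Ioc_of_le hst] at this ⊢
      exact (integrable_norm_iff hm).1 this
    have hc := hV.continuousOn_mild hVlb hs x hfi
    have hzi : IntervalIntegrable (fun r => ‖mild V s x f r‖ ^ 2) volume s t := by
      refine ContinuousOn.intervalIntegrable ?_
      rw [Set.uIcc_of_le hst]
      exact hc.norm.pow 2
    have hei : IntervalIntegrable (fun r => Real.exp (-α * (r - s)) * ‖x‖ ^ 2) volume s t :=
      Continuous.intervalIntegrable (by fun_prop) _ _
    have hle : ∫ r in s..t, Real.exp (-α * (r - s)) ≤ 1 / α := by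
      rw [integral_exp_mul_sub_left (neg_ne_zero.2 hα.ne'), div_neg, ← neg_div, neg_sub]
      refine div_le_div_of_nonneg_right ?_ hα.le
      linarith [Real.exp_pos (-α * (t - s))]
    refine (intervalIntegral.integral_mono_on hst hzi
      ((hei.add (h3.const_mul (1 / α))).const_mul (2 * M ^ 2)) hpt).trans ?_
    rw [intervalIntegral.integral_const_mul, intervalIntegral.integral_add hei
      (h3.const_mul (1 / α)), intervalIntegral.integral_mul_const,
      intervalIntegral.integral_const_mul, mul_assoc (2 * M ^ 2)]
    refine mul_le_mul_of_nonneg_left ?_ (by positivity)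
    have h5 := mul_le_mul_of_nonneg_right hle (sq_nonneg ‖x‖)
    have h6 : 1 / α * ∫ t in s..t, ∫ r in s..t, Real.exp (-α * (t - r)) * ‖f r‖ ^ 2
        ≤ 1 / α * (1 / α * F) := mul_le_mul_of_nonneg_left h4 hα0.le
    have h7 : 1 / α * (1 / α * F) ≤ a * (a * F) := by gcongr
    have h8 : 1 / α * ‖x‖ ^ 2 ≤ a * (a * ‖x‖ ^ 2) := by
      refine (mul_le_mul_of_nonneg_right haα (sq_nonneg _)).trans ?_
      refine mul_le_mul_of_nonneg_left ?_ (by linarith)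
      exact le_mul_of_one_le_left (sq_nonneg _) ha1
    linarith

end

/-! ### Square integrable signals with values in H × X -/

/-- Cauchy–Schwarz, from the nonnegative integral of ((t - s) φ - I1)². -/
lemma sq_integral_le {φ : ℝ → ℝ} {s t : ℝ} (hst : s ≤ t)
    (h1 : IntervalIntegrable φ volume s t)
    (h2 : IntervalIntegrable (fun r => φ r ^ 2) volume s t) :
    (∫ r in s..t, φ r) ^ 2 ≤ (t - s) * ∫ r in s..t, φ r ^ 2 := by
  rcases hst.eq_or_lt with rfl | hlt
  · simp
  set I1 := ∫ r in s..t, φ r with hI1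
  set I2 := ∫ r in s..t, φ r ^ 2 with hI2
  have hpos : 0 ≤ ∫ r in s..t, ((t - s) * φ r - I1) ^ 2 :=
    intervalIntegral.integral_nonneg hst fun r _ => sq_nonneg _
  have hex : ∫ r in s..t, ((t - s) * φ r - I1) ^ 2
      = (t - s) ^ 2 * I2 - 2 * (t - s) * I1 * I1 + (t - s) * I1 ^ 2 := by
    have : ∀ r, ((t - s) * φ r - I1) ^ 2
        = (t - s) ^ 2 * φ r ^ 2 - 2 * (t - s) * I1 * φ r + I1 ^ 2 := fun r => by ring
    simp_rw [this]
    rw [intervalIntegral.integral_add ((h2.const_mul _).sub (h1.const_mul _)) (by simp),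
      intervalIntegral.integral_sub (h2.const_mul _) (h1.const_mul _),
      intervalIntegral.integral_const_mul, intervalIntegral.integral_const_mul,
      intervalIntegral.integral_const, smul_eq_mul]
  rw [hex] at hpos
  have h3 : 0 < t - s := sub_pos.2 hlt
  refine le_of_mul_le_mul_left ?_ h3
  nlinarith

section Lp

variable {F : Type*} [NormedAddCommGroup F]

lemma integrable_norm_sq_coeFn (φ : Lp F 2 (volume : Measure ℝ)) :
    Integrable (fun r => ‖φ r‖ ^ 2) :=
  (memLp_two_iff_integrable_sq_norm (Lp.aestronglyMeasurable φ)).1 (Lp.memLp φ)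

lemma enorm_sq_eq_lintegral (φ : Lp F 2 (volume : Measure ℝ)) :
    ENNReal.ofReal (‖φ‖ ^ 2) = ∫⁻ r, ENNReal.ofReal (‖φ r‖ ^ 2) := by
  have h := eLpNorm_nnreal_pow_eq_lintegral (f := φ) (μ := volume) (p := 2) two_ne_zero
  have h1 : ENNReal.ofReal (‖φ‖ ^ 2) = eLpNorm φ 2 volume ^ 2 := by
    rw [ENNReal.ofReal_pow (norm_nonneg _), Lp.norm_def, ENNReal.ofReal_toReal (Lp.eLpNorm_ne_top φ)]
  rw [h1]
  have h2 : ∀ r, ENNReal.ofReal (‖φ r‖ ^ 2) = ‖φ r‖ₑ ^ 2 := fun r => by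
    rw [ENNReal.ofReal_pow (norm_nonneg _), ofReal_norm]
  simp_rw [h2]
  have h3 : ((2 : NNReal) : ℝ) = (2 : ℕ) := by norm_num
  rw [h3] at h
  simpa only [ENNReal.rpow_natCast, ENNReal.coe_ofNat] using h

lemma norm_sq_eq_integral (φ : Lp F 2 (volume : Measure ℝ)) :
    ‖φ‖ ^ 2 = ∫ r, ‖φ r‖ ^ 2 := by
  have h := enorm_sq_eq_lintegral φ
  rw [← ofReal_integral_eq_lintegral_ofReal (integrable_norm_sq_coeFn φ)
    (ae_of_all _ fun _ => sq_nonneg _)] at h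
  exact (ENNReal.ofReal_eq_ofReal_iff (sq_nonneg _) (integral_nonneg fun _ => sq_nonneg _)).1 h

lemma integral_norm_sq_le (φ : Lp F 2 (volume : Measure ℝ)) {s t : ℝ} (hst : s ≤ t) :
    ∫ r in s..t, ‖φ r‖ ^ 2 ≤ ‖φ‖ ^ 2 := by
  rw [norm_sq_eq_integral, intervalIntegral.integral_of_le hst]
  exact setIntegral_le_integral (integrable_norm_sq_coeFn φ) (ae_of_all _ fun _ => sq_nonneg _)

lemma intervalIntegrable_coeFn (φ : Lp F 2 (volume : Measure ℝ)) (s t : ℝ) :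
    IntervalIntegrable φ volume s t :=
  (((Lp.memLp φ).locallyIntegrable one_le_two).integrableOn_isCompact
    isCompact_uIcc).intervalIntegrable

lemma integral_norm_le (φ : Lp F 2 (volume : Measure ℝ)) {s t : ℝ} (hst : s ≤ t) :
    ∫ r in s..t, ‖φ r‖ ≤ √(t - s) * ‖φ‖ := by
  have h := sq_integral_le hst (intervalIntegrable_coeFn φ s t).norm
    ((integrable_norm_sq_coeFn φ).intervalIntegrable)
  rw [← Real.sqrt_sq (norm_nonneg φ), ← Real.sqrt_mul (sub_nonneg.2 hst)]
  exact Real.le_sqrt_of_sq_le (h.trans (mul_le_mul_of_nonneg_left (integral_norm_sq_le φ hst)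
    (sub_nonneg.2 hst)))

end Lp

section Pair

variable {𝕜 H X : Type*} [RCLike 𝕜]
  [NormedAddCommGroup H] [InnerProductSpace 𝕜 H]
  [NormedAddCommGroup X] [InnerProductSpace 𝕜 X]

lemma IsBoundedContinuous.comp {E F G : Type*} [NormedAddCommGroup E] [NormedSpace 𝕜 E]
    [NormedAddCommGroup F] [NormedSpace 𝕜 F] [NormedAddCommGroup G] [NormedSpace 𝕜 G]
    {A : ℝ → F →L[𝕜] G} {B : ℝ → E →L[𝕜] F} (hA : IsBoundedContinuous A)
    (hB : IsBoundedContinuous B) : IsBoundedContinuous fun t => A t ∘L B t := by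
  obtain ⟨a, ha⟩ := hA.2
  obtain ⟨b, hb⟩ := hB.2
  refine ⟨hA.1.clm_comp hB.1, a * b, fun t ht => ?_⟩
  exact (ContinuousLinearMap.opNorm_comp_le _ _).trans
    (mul_le_mul (ha t ht) (hb t ht) (norm_nonneg _) ((norm_nonneg _).trans (ha t ht)))

/-- The operator `v ↦ (A v, K v)` into the Hilbert sum. -/
noncomputable def pairL (A : H →L[𝕜] H) (K : H →L[𝕜] X) : H →L[𝕜] WithLp 2 (H × X) :=
  ((WithLp.prodContinuousLinearEquiv 2 𝕜 H X).symm : H × X →L[𝕜] WithLp 2 (H × X)) ∘L (A.prod K)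

lemma pairL_apply (A : H →L[𝕜] H) (K : H →L[𝕜] X) (v : H) :
    pairL A K v = WithLp.toLp 2 (A v, K v) := rfl

lemma isBoundedContinuous_pairL {C : ℝ → H →L[𝕜] H} {K : ℝ → H →L[𝕜] X}
    (hC : IsBoundedContinuous C) (hK : IsBoundedContinuous K) :
    IsBoundedContinuous fun t => pairL (C t) (K t) := by
  have h1 : ∀ (A : H →L[𝕜] H) (K : H →L[𝕜] X), pairL A K
      = pairL (ContinuousLinearMap.id 𝕜 H) 0 ∘L A
        + (((WithLp.prodContinuousLinearEquiv 2 𝕜 H X).symm : H × X →L[𝕜] WithLp 2 (H × X)) ∘L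
          (ContinuousLinearMap.inr 𝕜 H X)) ∘L K := by
    intro A K
    ext v : 1
    simp [pairL, ← WithLp.toLp_add]
  obtain ⟨c, hc⟩ := hC.2
  obtain ⟨k, hk⟩ := hK.2
  constructor
  · refine ContinuousOn.congr ?_ fun t _ => h1 (C t) (K t)
    exact (continuousOn_const.clm_comp hC.1).add (continuousOn_const.clm_comp hK.1)
  · refine ⟨c + k, fun t ht => ContinuousLinearMap.opNorm_le_bound _ ?_ fun v => ?_⟩
    · exact add_nonneg ((norm_nonneg _).trans (hc t ht)) ((norm_nonneg _).trans (hk t ht))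
    · have h2 : ‖C t v‖ ≤ c * ‖v‖ := (ContinuousLinearMap.le_opNorm _ _).trans
        (mul_le_mul_of_nonneg_right (hc t ht) (norm_nonneg _))
      have h3 : ‖K t v‖ ≤ k * ‖v‖ := (ContinuousLinearMap.le_opNorm _ _).trans
        (mul_le_mul_of_nonneg_right (hk t ht) (norm_nonneg _))
      refine abs_le_of_sq_le_sq' ?_ ?_ |>.2
      · rw [WithLp.prod_norm_sq_eq_of_L2, pairL_apply]
        change ‖C t v‖ ^ 2 + ‖K t v‖ ^ 2 ≤ _
        nlinarith [norm_nonneg (C t v), norm_nonneg (K t v)]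
      · linarith [norm_nonneg (C t v), norm_nonneg (K t v)]

lemma intervalIntegrable_snd (𝕜 : Type*) {H X : Type*} [RCLike 𝕜] [NormedAddCommGroup H]
    [InnerProductSpace 𝕜 H] [NormedAddCommGroup X] [InnerProductSpace 𝕜 X] (φ : Lp (WithLp 2 (H × X)) 2 (volume : Measure ℝ)) (s t : ℝ) :
    IntervalIntegrable (fun r => (φ r).snd) volume s t := by
  have h := intervalIntegrable_coeFn φ s t
  exact ⟨(WithLp.sndL 2 𝕜 H X).integrable_comp h.1, (WithLp.sndL 2 𝕜 H X).integrable_comp h.2⟩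

lemma intervalIntegrable_input {B : ℝ → X →L[𝕜] H} (hB : IsBoundedContinuous B)
    (φ : Lp (WithLp 2 (H × X)) 2 (volume : Measure ℝ)) {s t : ℝ} (hs : 0 ≤ s) (hst : s ≤ t) :
    IntervalIntegrable (fun r => B r (φ r).snd) volume s t :=
  intervalIntegrable_clm_apply hB.1 hs hst (intervalIntegrable_snd 𝕜 φ s t)

lemma norm_snd_le (f : WithLp 2 (H × X)) : ‖f.snd‖ ≤ ‖f‖ := by
  refine abs_le_of_sq_le_sq' ?_ (norm_nonneg _) |>.2
  rw [WithLp.prod_norm_sq_eq_of_L2]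
  linarith [sq_nonneg ‖f.fst‖]

lemma norm_fst_le (f : WithLp 2 (H × X)) : ‖f.fst‖ ≤ ‖f‖ := by
  refine abs_le_of_sq_le_sq' ?_ (norm_nonneg _) |>.2
  rw [WithLp.prod_norm_sq_eq_of_L2]
  linarith [sq_nonneg ‖f.snd‖]

end Pair

/-! ### Stabilized systems and the closed relation between initial values and signals -/

section System

variable {𝕜 H X : Type*} [RCLike 𝕜]
  [NormedAddCommGroup H] [InnerProductSpace 𝕜 H] [NormedSpace ℝ H]
  [NormedAddCommGroup X] [InnerProductSpace 𝕜 X]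

/-- A control system with observation `C` and a stabilizing feedback `K`, whose closed loop
evolution operator is `Z`. -/
structure IsStabilizedSystem (Y : ℝ → ℝ → H →L[𝕜] H) (B : ℝ → X →L[𝕜] H) (C : ℝ → H →L[𝕜] H)
    (K : ℝ → H →L[𝕜] X) (Z : ℝ → ℝ → H →L[𝕜] H) : Prop where
  evolution : IsEvolutionOperator Y
  input : IsBoundedContinuous B
  output : IsBoundedContinuous C
  feedback : IsBoundedContinuous K
  perturbed : IsPerturbedEvolution Y (fun t => B t ∘L K t) Z
  stable : IsExponentiallyStable Z

variable {Y Z : ℝ → ℝ → H →L[𝕜] H} {B : ℝ → X →L[𝕜] H} {C : ℝ → H →L[𝕜] H}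
  {K : ℝ → H →L[𝕜] X}

lemma trajectory_eq_mild (s : ℝ) (x : H) (u : ℝ → X) :
    trajectory Y B s x u = mild Y s x (fun r => B r (u r)) := rfl

lemma IsStabilizedSystem.isLocallyBounded [CompleteSpace H] (hS : IsStabilizedSystem Y B C K Z) :
    IsLocallyBounded Y :=
  hS.perturbed.isLocallyBounded_base hS.evolution hS.stable.isLocallyBounded
    (hS.input.comp hS.feedback).2

/-- The bounded linear operator mapping a control to the forced response at time `t`. -/
lemma exists_inputMap [CompleteSpace H] (hY : IsEvolutionOperator Y) (hYb : IsLocallyBounded Y)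
    (hB : IsBoundedContinuous B) {s t N b : ℝ} (hs : 0 ≤ s) (hst : s ≤ t)
    (hN : ∀ r, s ≤ r → r ≤ t → ‖Y t r‖ ≤ N) (hb : ∀ r, 0 ≤ r → ‖B r‖ ≤ b) :
    ∃ L : Lp (WithLp 2 (H × X)) 2 (volume : Measure ℝ) →L[𝕜] H,
      (∀ φ, L φ = ∫ r in s..t, Y t r (B r (φ r).snd)) ∧
      ∀ φ, ‖L φ‖ ≤ N * b * √(t - s) * ‖φ‖ := by
  have hi := fun φ : Lp (WithLp 2 (H × X)) 2 (volume : Measure ℝ) =>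
    hY.intervalIntegrable_apply hYb hs hst (intervalIntegrable_input hB φ hs hst)
  have hbd : ∀ φ : Lp (WithLp 2 (H × X)) 2 (volume : Measure ℝ),
      ‖∫ r in s..t, Y t r (B r (φ r).snd)‖ ≤ N * b * √(t - s) * ‖φ‖ := by
    intro φ
    have hN0 : 0 ≤ N := (norm_nonneg _).trans (hN s le_rfl hst)
    have hb0 : 0 ≤ b := (norm_nonneg _).trans (hb 0 le_rfl)
    rw [mul_assoc (N * b)]
    refine le_trans ?_ (mul_le_mul_of_nonneg_left (integral_norm_le φ hst) (by positivity))
    rw [← intervalIntegral.integral_const_mul]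
    refine intervalIntegral.norm_integral_le_of_norm_le hst (ae_of_all _ fun r hr => ?_)
      ((intervalIntegrable_coeFn φ s t).norm.const_mul _)
    rw [mul_assoc]
    refine (ContinuousLinearMap.le_opNorm _ _).trans
      (mul_le_mul (hN r hr.1.le hr.2) ?_ (norm_nonneg _) hN0)
    exact (ContinuousLinearMap.le_opNorm _ _).trans
      (mul_le_mul (hb r (hs.trans hr.1.le)) (norm_snd_le _) (norm_nonneg _) hb0)
  let L : Lp (WithLp 2 (H × X)) 2 (volume : Measure ℝ) →ₗ[𝕜] H :=
    { toFun := fun φ => ∫ r in s..t, Y t r (B r (φ r).snd)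
      map_add' := fun φ ψ => by
        rw [← intervalIntegral.integral_add (hi φ) (hi ψ)]
        refine intervalIntegral.integral_congr_ae ?_
        filter_upwards [Lp.coeFn_add φ ψ] with r hr _
        rw [hr]
        simp
      map_smul' := fun a φ => by
        -- The scalar is written as a bounded operator so that it can be moved through the integral.
        have h1 : (RingHom.id 𝕜 a) • ∫ r in s..t, Y t r (B r (φ r).snd)
            = (a • ContinuousLinearMap.id 𝕜 H) (∫ r in s..t, Y t r (B r (φ r).snd)) := by simp
        rw [h1, ← ContinuousLinearMap.intervalIntegral_comp_comm _ (hi φ)]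
        refine intervalIntegral.integral_congr_ae ?_
        filter_upwards [Lp.coeFn_smul a φ] with r hr _
        rw [hr]
        simp }
  exact ⟨L.mkContinuous _ hbd, fun φ => rfl, hbd⟩

/-- The pairs of an initial value `x` at time `s` and a square integrable signal, whose second
component is a control and whose first component is the corresponding output. -/
noncomputable def outputGraph [CompleteSpace H] (hY : IsEvolutionOperator Y)
    (hYb : IsLocallyBounded Y) (hB : IsBoundedContinuous B) (C : ℝ → H →L[𝕜] H) {s : ℝ}
    (hs : 0 ≤ s) : Submodule 𝕜 (H × Lp (WithLp 2 (H × X)) 2 (volume : Measure ℝ)) where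
  carrier := {p | (∀ᵐ t, t < s → p.2 t = 0) ∧
    ∀ᵐ t, s ≤ t → (p.2 t).fst = C t (trajectory Y B s p.1 (fun r => (p.2 r).snd) t)}
  add_mem' := by
    intro p q hp hq
    refine ⟨?_, ?_⟩
    · filter_upwards [hp.1, hq.1, Lp.coeFn_add p.2 q.2] with t h1 h2 h3 h
      rw [Prod.snd_add, h3, Pi.add_apply, h1 h, h2 h, add_zero]
    · filter_upwards [hp.2, hq.2, Lp.coeFn_add p.2 q.2] with t h1 h2 h3 h
      obtain ⟨N, hN⟩ := hYb t
      obtain ⟨b, hb⟩ := hB.2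
      obtain ⟨L, hL, -⟩ := exists_inputMap hY hYb hB hs h
        (fun r hr hrt => hN r t (hs.trans hr) hrt le_rfl) hb
      rw [Prod.snd_add, h3, Pi.add_apply, WithLp.add_fst, h1 h, h2 h, ← map_add, Prod.fst_add]
      simp only [trajectory]
      rw [← hL, ← hL, ← hL, L.map_add, (Y t s).map_add, add_add_add_comm]
  zero_mem' := by
    refine ⟨?_, ?_⟩
    · filter_upwards [Lp.coeFn_zero (WithLp 2 (H × X)) 2 (volume : Measure ℝ)] with t h1 _
      exact h1
    · filter_upwards [Lp.coeFn_zero (WithLp 2 (H × X)) 2 (volume : Measure ℝ)] with t h1 h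
      obtain ⟨N, hN⟩ := hYb t
      obtain ⟨b, hb⟩ := hB.2
      obtain ⟨L, hL, -⟩ := exists_inputMap hY hYb hB hs h
        (fun r hr hrt => hN r t (hs.trans hr) hrt le_rfl) hb
      simp only [trajectory, Prod.snd_zero, Prod.fst_zero]
      rw [← hL, h1]
      simp
  smul_mem' := by
    intro a p hp
    refine ⟨?_, ?_⟩
    · filter_upwards [hp.1, Lp.coeFn_smul a p.2] with t h1 h3 h
      rw [Prod.smul_snd, h3, Pi.smul_apply, h1 h, smul_zero]
    · filter_upwards [hp.2, Lp.coeFn_smul a p.2] with t h1 h3 h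
      obtain ⟨N, hN⟩ := hYb t
      obtain ⟨b, hb⟩ := hB.2
      obtain ⟨L, hL, -⟩ := exists_inputMap hY hYb hB hs h
        (fun r hr hrt => hN r t (hs.trans hr) hrt le_rfl) hb
      rw [Prod.smul_snd, h3, Pi.smul_apply, WithLp.smul_fst, h1 h, Prod.smul_fst]
      simp only [trajectory]
      rw [← hL, ← hL, L.map_smul, (Y t s).map_smul, ← smul_add, (C t).map_smul]

end System

lemma integrableOn_exp_neg_sub {a : ℝ} (ha : 0 < a) (s : ℝ) :
    IntegrableOn (fun t => Real.exp (-a * (t - s))) (Set.Ici s) := by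
  rw [integrableOn_Ici_iff_integrableOn_Ioi]
  have h : ∀ t, Real.exp (-a * (t - s)) = Real.exp (a * s) * Real.exp (-a * t) := fun t => by
    rw [← Real.exp_add]; ring_nf
  simp_rw [h]
  exact (integrableOn_exp_mul_Ioi (neg_lt_zero.2 ha) s).const_mul _

lemma integral_exp_neg_sub {a : ℝ} (ha : 0 < a) (s : ℝ) :
    ∫ t in Set.Ici s, Real.exp (-a * (t - s)) = 1 / a := by
  rw [integral_Ici_eq_integral_Ioi]
  have h : ∀ t, Real.exp (-a * (t - s)) = Real.exp (a * s) * Real.exp (-a * t) := fun t => by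
    rw [← Real.exp_add]; ring_nf
  simp_rw [h]
  rw [integral_const_mul, integral_exp_mul_Ioi (neg_lt_zero.2 ha), neg_div_neg_eq, ← mul_div_assoc,
    ← Real.exp_add]
  simp

section

variable {𝕜 H F : Type*} [RCLike 𝕜] [NormedAddCommGroup H] [InnerProductSpace 𝕜 H]
  [NormedAddCommGroup F] [InnerProductSpace 𝕜 F]

/-- The squared norm is at most (n m)² times the integral of exp (-2 α (t - s)) over [s, ∞), which
is 1 / (2 α). The bound does not depend on s, and this makes the optimal cost uniformly bounded. -/
lemma memLp_indicator_of_norm_le_exp {N : ℝ → H →L[𝕜] F} (hN : ContinuousOn N (Set.Ici 0)) {n : ℝ}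
    (hn : ∀ t, 0 ≤ t → ‖N t‖ ≤ n) {s m α : ℝ} (hs : 0 ≤ s) (hα : 0 < α) {ζ : ℝ → H}
    (hζ : ContinuousOn ζ (Set.Ici s)) (hm : ∀ t, s ≤ t → ‖ζ t‖ ≤ m * Real.exp (-α * (t - s))) :
    ∃ h : MemLp (Set.indicator (Set.Ici s) fun t => N t (ζ t)) 2 volume,
      ‖h.toLp‖ ≤ n * m / √(2 * α) := by
  have hn0 : 0 ≤ n := (norm_nonneg _).trans (hn 0 le_rfl)
  have hm0 : 0 ≤ m := by simpa using (norm_nonneg _).trans (hm s le_rfl)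
  have hmeas : AEStronglyMeasurable (Set.indicator (Set.Ici s) fun t => N t (ζ t)) volume := by
    rw [aestronglyMeasurable_indicator_iff measurableSet_Ici]
    exact ((hN.mono (Set.Ici_subset_Ici.2 hs)).clm_apply hζ).aestronglyMeasurable measurableSet_Ici
  have hb : ∀ t, ‖Set.indicator (Set.Ici s) (fun t => N t (ζ t)) t‖ ^ 2
      ≤ Set.indicator (Set.Ici s) (fun t => (n * m) ^ 2 * Real.exp (-(2 * α) * (t - s))) t := by
    intro t
    by_cases ht : t ∈ Set.Ici s
    · rw [Set.indicator_of_mem ht, Set.indicator_of_mem ht]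
      have h1 : ‖N t (ζ t)‖ ≤ n * (m * Real.exp (-α * (t - s))) :=
        (ContinuousLinearMap.le_opNorm _ _).trans
          (mul_le_mul (hn t (hs.trans ht)) (hm t ht) (norm_nonneg _) hn0)
      refine (pow_le_pow_left₀ (norm_nonneg _) h1 2).trans (le_of_eq ?_)
      rw [← mul_assoc, mul_pow, ← Real.exp_nat_mul]
      congr 2
      push_cast
      ring
    · rw [Set.indicator_of_notMem ht, Set.indicator_of_notMem ht]
      simp
  have hgi : Integrable
      (Set.indicator (Set.Ici s) fun t => (n * m) ^ 2 * Real.exp (-(2 * α) * (t - s))) := by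
    rw [integrable_indicator_iff measurableSet_Ici]
    exact (integrableOn_exp_neg_sub (by positivity) s).const_mul _
  have hsq : Integrable fun t => ‖Set.indicator (Set.Ici s) (fun t => N t (ζ t)) t‖ ^ 2 :=
    hgi.mono' (hmeas.norm.pow 2) (ae_of_all _ fun t => by
      rw [Real.norm_eq_abs, abs_of_nonneg (sq_nonneg _)]; exact hb t)
  have hL := (memLp_two_iff_integrable_sq_norm hmeas).2 hsq
  refine ⟨hL, ?_⟩
  refine abs_le_of_sq_le_sq' ?_ (by positivity) |>.2
  rw [norm_sq_eq_integral]
  have h2 : ∫ t, ‖hL.toLp _ t‖ ^ 2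
      = ∫ t, ‖Set.indicator (Set.Ici s) (fun t => N t (ζ t)) t‖ ^ 2 := by
    refine integral_congr_ae ?_
    filter_upwards [hL.coeFn_toLp] with t ht
    rw [ht]
  rw [h2]
  refine (integral_mono hsq hgi hb).trans (le_of_eq ?_)
  rw [integral_indicator measurableSet_Ici, integral_const_mul,
    integral_exp_neg_sub (by positivity), div_pow, Real.sq_sqrt (by positivity), mul_one_div]

end

section System

variable {𝕜 H X : Type*} [RCLike 𝕜]
  [NormedAddCommGroup H] [InnerProductSpace 𝕜 H] [NormedSpace ℝ H]
  [NormedAddCommGroup X] [InnerProductSpace 𝕜 X]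
  {Y Z : ℝ → ℝ → H →L[𝕜] H} {B : ℝ → X →L[𝕜] H} {C : ℝ → H →L[𝕜] H}
  {K : ℝ → H →L[𝕜] X}

lemma trajectory_congr {s t : ℝ} (hst : s ≤ t) {x : H} {u v : ℝ → X}
    (h : ∀ᵐ r, r ∈ Set.Ioc s t → u r = v r) :
    trajectory Y B s x u t = trajectory Y B s x v t := by
  rw [trajectory_eq_mild, trajectory_eq_mild]
  refine mild_congr hst ?_
  filter_upwards [h] with r hr hr'
  rw [hr hr']

lemma continuousOn_mild_Ici {U : ℝ → ℝ → H →L[𝕜] H} (hU : IsEvolutionOperator U)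
    (hUb : IsLocallyBounded U) {s : ℝ} (hs : 0 ≤ s) (x : H) {f : ℝ → H}
    (hf : ∀ t, s ≤ t → IntervalIntegrable f volume s t) :
    ContinuousOn (mild U s x f) (Set.Ici s) := by
  intro t ht
  have h := hU.continuousOn_mild hUb hs x (hf (t + 1) (by linarith [Set.mem_Ici.1 ht])) t
    ⟨ht, by linarith⟩
  refine h.mono_of_mem_nhdsWithin ?_
  rw [mem_nhdsWithin]
  exact ⟨Set.Iio (t + 1), isOpen_Iio, by simp, fun y hy => ⟨hy.2, hy.1.le⟩⟩

lemma continuousOn_trajectory (hY : IsEvolutionOperator Y) (hYb : IsLocallyBounded Y)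
    (hB : IsBoundedContinuous B) {s : ℝ} (hs : 0 ≤ s) (x : H)
    (φ : Lp (WithLp 2 (H × X)) 2 (volume : Measure ℝ)) :
    ContinuousOn (trajectory Y B s x fun r => (φ r).snd) (Set.Ici s) :=
  continuousOn_mild_Ici hY hYb hs x fun _ ht => intervalIntegrable_input hB φ hs ht

variable [CompleteSpace H]

lemma mem_outputGraph {hY : IsEvolutionOperator Y} {hYb : IsLocallyBounded Y}
    {hB : IsBoundedContinuous B} {s : ℝ} {hs : 0 ≤ s} {x : H}
    {φ : Lp (WithLp 2 (H × X)) 2 (volume : Measure ℝ)} :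
    (x, φ) ∈ outputGraph hY hYb hB C hs ↔ (∀ᵐ t, t < s → φ t = 0) ∧
      ∀ᵐ t, s ≤ t → (φ t).fst = C t (trajectory Y B s x (fun r => (φ r).snd) t) := Iff.rfl

lemma toLp_mem_outputGraph (hY : IsEvolutionOperator Y) (hYb : IsLocallyBounded Y)
    (hB : IsBoundedContinuous B) {s : ℝ} (hs : 0 ≤ s) {x : H} {f : ℝ → WithLp 2 (H × X)}
    (hf : MemLp f 2 volume) (h0 : ∀ᵐ t, t < s → f t = 0)
    (h : ∀ᵐ t, s ≤ t → (f t).fst = C t (trajectory Y B s x (fun r => (f r).snd) t)) :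
    (x, hf.toLp) ∈ outputGraph hY hYb hB C hs := by
  rw [mem_outputGraph]
  constructor
  · filter_upwards [hf.coeFn_toLp, h0] with t h1 h2 ht
    rw [h1, h2 ht]
  · filter_upwards [hf.coeFn_toLp, h] with t h1 h2 ht
    rw [h1, h2 ht]
    congr 1
    refine trajectory_congr ht ?_
    filter_upwards [hf.coeFn_toLp] with r hr _
    rw [hr]

/-- A convergent sequence of signals has a subsequence converging almost everywhere, and for each t
the trajectory depends continuously on (x, φ) by `exists_inputMap`; both conditions survive the
limit. -/
lemma isClosed_outputGraph (hY : IsEvolutionOperator Y) (hYb : IsLocallyBounded Y)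
    (hB : IsBoundedContinuous B) {s : ℝ} (hs : 0 ≤ s) :
    IsClosed (outputGraph hY hYb hB C hs :
      Set (H × Lp (WithLp 2 (H × X)) 2 (volume : Measure ℝ))) := by
  refine IsSeqClosed.isClosed fun p q hp hpq => ?_
  have h1 : Tendsto (fun n => (p n).1) atTop (𝓝 q.1) := (continuous_fst.tendsto q).comp hpq
  have h2 : Tendsto (fun n => (p n).2) atTop (𝓝 q.2) := (continuous_snd.tendsto q).comp hpq
  obtain ⟨ns, hns, hae⟩ := (tendstoInMeasure_of_tendsto_Lp h2).exists_seq_tendsto_ae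
  have hp1 := ae_all_iff.2 fun n => (hp n).1
  have hp2 := ae_all_iff.2 fun n => (hp n).2
  refine ⟨?_, ?_⟩
  · filter_upwards [hae, hp1] with t ht h0 hts
    refine tendsto_nhds_unique ht ?_
    simp_rw [fun i => h0 (ns i) hts]
    exact tendsto_const_nhds
  · filter_upwards [hae, hp2] with t ht h0 hts
    obtain ⟨N, hN⟩ := hYb t
    obtain ⟨b, hb⟩ := hB.2
    obtain ⟨L, hL, -⟩ := exists_inputMap (X := X) hY hYb hB hs hts
      (fun r hr hrt => hN r t (hs.trans hr) hrt le_rfl) hb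
    have h3 : Tendsto (fun i => ((p (ns i)).2 t).fst) atTop (𝓝 (q.2 t).fst) :=
      ((WithLp.fstL 2 𝕜 H X).continuous.tendsto _).comp ht
    refine tendsto_nhds_unique h3 ?_
    simp_rw [fun i => h0 (ns i) hts]
    simp only [trajectory, ← hL]
    refine ((C t).continuous.tendsto _).comp (Tendsto.add ?_ ?_)
    · exact ((Y t s).continuous.tendsto _).comp (h1.comp hns.tendsto_atTop)
    · exact (L.continuous.tendsto _).comp (h2.comp hns.tendsto_atTop)

/-- The competitor supplied by stabilizability: by its integral equation, Z t s x is the trajectory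
of Y under the control K t (Z t s x). -/
lemma IsStabilizedSystem.pairL_mem_outputGraph (hS : IsStabilizedSystem Y B C K Z) {s : ℝ}
    (hs : 0 ≤ s) (x : H)
    (hf : MemLp (Set.indicator (Set.Ici s) fun t => pairL (C t) (K t) (Z t s x)) 2 volume) :
    (x, hf.toLp) ∈ outputGraph hS.evolution hS.isLocallyBounded hS.input C hs := by
  refine toLp_mem_outputGraph _ _ _ hs hf (ae_of_all _ fun t ht => ?_) (ae_of_all _ fun t ht => ?_)
  · exact Set.indicator_of_notMem (not_le.2 ht) _
  · rw [Set.indicator_of_mem (Set.mem_Ici.2 ht), pairL_apply]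
    change C t (Z t s x) = _
    rw [hS.perturbed.eq_add_integral s t hs ht x]
    congr 1
    rw [trajectory]
    congr 1
    refine intervalIntegral.integral_congr fun r hr => ?_
    rw [Set.uIcc_of_le ht] at hr
    simp only [Set.indicator_of_mem (Set.mem_Ici.2 hr.1), pairL_apply]
    rfl

/-- The signals of minimal norm, i.e. of minimal cost, for all initial times and values. -/
theorem IsStabilizedSystem.exists_optimalSignal [CompleteSpace X]
    (hS : IsStabilizedSystem Y B C K Z) :
    ∃ (c : ℝ) (T : ℝ → H →L[𝕜] Lp (WithLp 2 (H × X)) 2 (volume : Measure ℝ)), 0 ≤ c ∧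
      ∀ s, (hs : 0 ≤ s) →
        (∀ x, (x, T s x) ∈ outputGraph hS.evolution hS.isLocallyBounded hS.input C hs) ∧
        (∀ x g, (0, g) ∈ outputGraph hS.evolution hS.isLocallyBounded hS.input C hs →
          inner 𝕜 (T s x) g = 0) ∧
        ∀ x, ‖T s x‖ ≤ c * ‖x‖ := by
  have hN := isBoundedContinuous_pairL hS.output hS.feedback
  obtain ⟨n, hn⟩ := hN.2
  obtain ⟨M, α, hM, hα, hZ⟩ := hS.stable
  have hn0 : 0 ≤ n := (norm_nonneg _).trans (hn 0 le_rfl)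
  -- The bound on the closed loop signal for ‖x‖ = 1, common to all initial times.
  set c := n * M / √(2 * α) with hc
  have hex : ∀ s, 0 ≤ s → ∃ T : H →L[𝕜] Lp (WithLp 2 (H × X)) 2 (volume : Measure ℝ),
      ∀ hs : 0 ≤ s,
        (∀ x, (x, T x) ∈ outputGraph hS.evolution hS.isLocallyBounded hS.input C hs) ∧
        (∀ x g, (0, g) ∈ outputGraph hS.evolution hS.isLocallyBounded hS.input C hs →
          inner 𝕜 (T x) g = 0) ∧
        ∀ x, ‖T x‖ ≤ c * ‖x‖ := by
    intro s hs
    obtain ⟨T, hT⟩ := exists_minimal_section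
      (outputGraph hS.evolution hS.isLocallyBounded hS.input C hs)
      (isClosed_outputGraph _ _ _ hs) (C := c) fun x => by
        obtain ⟨hf, hfn⟩ := memLp_indicator_of_norm_le_exp hN.1 hn hs hα (m := M * ‖x‖)
          (hS.perturbed.isEvolutionOperator.continuousOn_left s hs x) fun t ht => by
            refine (ContinuousLinearMap.le_opNorm _ _).trans
              ((mul_le_mul_of_nonneg_right (hZ s t hs ht) (norm_nonneg _)).trans (le_of_eq ?_))
            ring
        refine ⟨hf.toLp, hS.pairL_mem_outputGraph hs x hf, hfn.trans (le_of_eq ?_)⟩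
        rw [hc]
        ring
    exact ⟨T, fun _ => hT⟩
  classical
  refine ⟨c, fun s => if hs : 0 ≤ s then (hex s hs).choose else 0, by positivity, fun s hs => ?_⟩
  simp only [dif_pos hs]
  exact (hex s hs).choose_spec hs

end System

/-! ### Optimal signals and the optimal flow -/

section System

variable {𝕜 H X : Type*} [RCLike 𝕜]
  [NormedAddCommGroup H] [InnerProductSpace 𝕜 H] [NormedSpace ℝ H] [CompleteSpace H]
  [NormedAddCommGroup X] [InnerProductSpace 𝕜 X]
  {Y Z V : ℝ → ℝ → H →L[𝕜] H} {B : ℝ → X →L[𝕜] H} {C : ℝ → H →L[𝕜] H}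
  {K : ℝ → H →L[𝕜] X} {T : ℝ → H →L[𝕜] Lp (WithLp 2 (H × X)) 2 (volume : Measure ℝ)} {c : ℝ}

/-- `T s x` is the signal of minimal norm among the signals with initial value `x` at time `s`. -/
structure IsOptimalSignal (hS : IsStabilizedSystem Y B C K Z) (c : ℝ)
    (T : ℝ → H →L[𝕜] Lp (WithLp 2 (H × X)) 2 (volume : Measure ℝ)) : Prop where
  nonneg : 0 ≤ c
  mem : ∀ s (hs : 0 ≤ s) x,
    (x, T s x) ∈ outputGraph hS.evolution hS.isLocallyBounded hS.input C hs
  inner_eq_zero : ∀ s (hs : 0 ≤ s) x g,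
    (0, g) ∈ outputGraph hS.evolution hS.isLocallyBounded hS.input C hs → inner 𝕜 (T s x) g = 0
  norm_le : ∀ s, 0 ≤ s → ∀ x, ‖T s x‖ ≤ c * ‖x‖

/-- `V t s` maps an initial value at time `s` to the value at time `t` of the trajectory of its
optimal control. -/
def IsOptimalFlow (Y : ℝ → ℝ → H →L[𝕜] H) (B : ℝ → X →L[𝕜] H)
    (T : ℝ → H →L[𝕜] Lp (WithLp 2 (H × X)) 2 (volume : Measure ℝ))
    (V : ℝ → ℝ → H →L[𝕜] H) : Prop :=
  ∀ s t, 0 ≤ s → s ≤ t → ∀ x, V t s x = trajectory Y B s x (fun r => (T s x r).snd) t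

/-- The state at time t is Y t s x plus the input map applied to T s x, hence linear and bounded in
x. -/
lemma IsStabilizedSystem.exists_isOptimalFlow (hS : IsStabilizedSystem Y B C K Z)
    (T : ℝ → H →L[𝕜] Lp (WithLp 2 (H × X)) 2 (volume : Measure ℝ)) :
    ∃ V : ℝ → ℝ → H →L[𝕜] H, IsOptimalFlow Y B T V := by
  have h : ∀ t s, ∃ L : H →L[𝕜] H, 0 ≤ s → s ≤ t →
      ∀ x, L x = trajectory Y B s x (fun r => (T s x r).snd) t := by
    intro t s
    by_cases hst : 0 ≤ s ∧ s ≤ t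
    · obtain ⟨N, hN⟩ := hS.isLocallyBounded t
      obtain ⟨b, hb⟩ := hS.input.2
      obtain ⟨L, hL, -⟩ := exists_inputMap (X := X) hS.evolution hS.isLocallyBounded hS.input
        hst.1 hst.2 (fun r hr hrt => hN r t (hst.1.trans hr) hrt le_rfl) hb
      refine ⟨Y t s + L ∘L T s, fun _ _ x => ?_⟩
      rw [trajectory, ← hL]
      rfl
    · exact ⟨0, fun h1 h2 => absurd ⟨h1, h2⟩ hst⟩
  choose V hV using h
  exact ⟨V, fun s t hs hst x => hV t s hs hst x⟩

/-- The zero extension of a signal with zero initial value to earlier times. -/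
lemma IsStabilizedSystem.zero_mem_outputGraph_of_le (hS : IsStabilizedSystem Y B C K Z) {s r : ℝ}
    (hs : 0 ≤ s) (hsr : s ≤ r) {g : Lp (WithLp 2 (H × X)) 2 (volume : Measure ℝ)}
    (hg : (0, g) ∈ outputGraph hS.evolution hS.isLocallyBounded hS.input C (hs.trans hsr)) :
    (0, g) ∈ outputGraph hS.evolution hS.isLocallyBounded hS.input C hs := by
  rw [mem_outputGraph] at hg ⊢
  have hzero : ∀ t, s ≤ t → t ≤ r → trajectory Y B s 0 (fun q => (g q).snd) t = 0 := by
    intro t hst htr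
    have h1 : trajectory Y B s 0 (fun q => (g q).snd) t = trajectory Y B s 0 (fun _ => 0) t := by
      refine trajectory_congr hst ?_
      filter_upwards [hg.1, compl_mem_ae_iff.2 (measure_singleton t)] with q hq hqt hq'
      rw [hq ((lt_of_le_of_ne hq'.2 hqt).trans_le htr)]
      rfl
    rw [h1]
    simp [trajectory]
  refine ⟨?_, ?_⟩
  · filter_upwards [hg.1] with t ht hts
    exact ht (hts.trans_le hsr)
  · filter_upwards [hg.1, hg.2] with t h1 h2 hst
    rcases lt_or_ge t r with htr | htr
    · rw [hzero t hst htr.le, h1 htr, map_zero]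
      rfl
    · rw [h2 htr, trajectory_eq_mild, trajectory_eq_mild,
        hS.evolution.mild_restart hS.isLocallyBounded hs hsr htr 0
          (intervalIntegrable_input hS.input g hs hst)]
      rw [← trajectory_eq_mild s, hzero r hsr le_rfl]

variable {hS : IsStabilizedSystem Y B C K Z}

lemma inner_eq_integral_of_ae_eq {ι F : Type*} [MeasurableSpace ι] {ν : Measure ι}
    [NormedAddCommGroup F] [InnerProductSpace 𝕜 F] (φ : Lp F 2 ν) {f : ι → F} (hf : MemLp f 2 ν) :
    inner 𝕜 φ (hf.toLp f) = ∫ t, inner 𝕜 (φ t) (f t) ∂ν := by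
  rw [L2.inner_def]
  refine integral_congr_ae ?_
  filter_upwards [hf.coeFn_toLp] with t ht
  rw [ht]

/-- The principle of optimality. -/
theorem IsOptimalSignal.restrict (hT : IsOptimalSignal hS c T) (hV : IsOptimalFlow Y B T V)
    {s r : ℝ} (hs : 0 ≤ s) (hsr : s ≤ r) (x : H) :
    T r (V r s x) =ᵐ[volume] Set.indicator (Set.Ici r) (T s x) := by
  have hr : 0 ≤ r := hs.trans hsr
  set φ := T s x with hφ
  have hmem := mem_outputGraph.1 (hT.mem s hs x)
  have hL : MemLp (Set.indicator (Set.Ici r) φ) 2 volume := (Lp.memLp φ).indicator measurableSet_Ici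
  have h1 : (V r s x, hL.toLp) ∈
      outputGraph hS.evolution hS.isLocallyBounded hS.input C hr := by
    refine toLp_mem_outputGraph _ _ _ hr hL (ae_of_all _ fun t ht => ?_) ?_
    · exact Set.indicator_of_notMem (not_le.2 ht) _
    · filter_upwards [hmem.2] with t ht hrt
      rw [Set.indicator_of_mem (Set.mem_Ici.2 hrt), ht (hsr.trans hrt), trajectory_eq_mild,
        hS.evolution.mild_restart hS.isLocallyBounded hs hsr hrt x
          (intervalIntegrable_input hS.input φ hs (hsr.trans hrt)), hV s r hs hsr x]
      congr 1
      refine trajectory_congr (B := B) hrt (ae_of_all _ fun q hq => ?_)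
      rw [Set.indicator_of_mem (Set.mem_Ici.2 hq.1.le)]
  -- A test signal starting from 0 at time r is also one starting from 0 at time s, and it only sees
  -- the part of T s x after r.
  have h2 : ∀ g, (0, g) ∈ outputGraph hS.evolution hS.isLocallyBounded hS.input C hr →
      inner 𝕜 hL.toLp g = 0 := by
    intro g hg
    rw [← hT.inner_eq_zero s hs x g (hS.zero_mem_outputGraph_of_le hs hsr hg), L2.inner_def,
      L2.inner_def]
    refine integral_congr_ae ?_
    filter_upwards [hL.coeFn_toLp, (mem_outputGraph.1 hg).1] with t h3 h4
    rw [h3]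
    by_cases ht : t ∈ Set.Ici r
    · rw [Set.indicator_of_mem ht]
    · rw [h4 (not_le.1 ht), inner_zero_right, inner_zero_right]
  have h3 : ((0 : H), T r (V r s x) - hL.toLp) ∈
      outputGraph hS.evolution hS.isLocallyBounded hS.input C hr := by
    simpa using Submodule.sub_mem _ (hT.mem r hr (V r s x)) h1
  -- Both signals lie over V r s x and are orthogonal to the fibre over 0, so their difference is
  -- orthogonal to itself.
  have h4 : T r (V r s x) = hL.toLp := by
    refine sub_eq_zero.1 (inner_self_eq_zero (𝕜 := 𝕜).1 ?_)
    rw [inner_sub_left, hT.inner_eq_zero r hr _ _ h3, h2 _ h3, sub_zero]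
  rw [h4]
  exact hL.coeFn_toLp

lemma IsOptimalSignal.flow_comp (hT : IsOptimalSignal hS c T) (hV : IsOptimalFlow Y B T V)
    {s r t : ℝ} (hs : 0 ≤ s) (hsr : s ≤ r) (hrt : r ≤ t) (x : H) :
    V t r (V r s x) = V t s x := by
  rw [hV r t (hs.trans hsr) hrt, hV s t hs (hsr.trans hrt), trajectory_eq_mild s,
    hS.evolution.mild_restart hS.isLocallyBounded hs hsr hrt x
      (intervalIntegrable_input hS.input (T s x) hs (hsr.trans hrt)),
    ← trajectory_eq_mild s, ← hV s r hs hsr x, ← trajectory_eq_mild]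
  refine trajectory_congr hrt ?_
  filter_upwards [hT.restrict hV hs hsr x] with q hq hq'
  rw [hq, Set.indicator_of_mem (Set.mem_Ici.2 hq'.1.le)]

/-- The optimal control has L² norm at most c‖x‖, so by Cauchy–Schwarz it contributes O(√(r - s))
over [s, r]. This transfers continuity in the initial time from Y to V. -/
lemma IsOptimalSignal.exists_norm_flow_sub_le (hT : IsOptimalSignal hS c T)
    (hV : IsOptimalFlow Y B T V) (t : ℝ) :
    ∃ k : ℝ, 0 ≤ k ∧ ∀ s r, 0 ≤ s → s ≤ r → r ≤ t → ∀ x,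
      ‖V r s x - Y r s x‖ ≤ k * √(r - s) * ‖x‖ := by
  rcases lt_or_ge t 0 with ht | ht
  · exact ⟨0, le_rfl, fun s r hs hsr hrt => absurd ((hs.trans hsr).trans hrt) (not_le.2 ht)⟩
  obtain ⟨N, hN⟩ := hS.isLocallyBounded t
  obtain ⟨b, hb⟩ := hS.input.2
  have hN0 : 0 ≤ N := (norm_nonneg _).trans (hN t t ht le_rfl le_rfl)
  have hb0 : 0 ≤ b := (norm_nonneg _).trans (hb 0 le_rfl)
  refine ⟨N * b * c, mul_nonneg (mul_nonneg hN0 hb0) hT.nonneg, fun s r hs hsr hrt x => ?_⟩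
  obtain ⟨L, hL, hLn⟩ := exists_inputMap (X := X) hS.evolution hS.isLocallyBounded hS.input
    hs hsr (fun q hq hqr => hN q r (hs.trans hq) hqr hrt) hb
  rw [hV s r hs hsr x, trajectory, ← hL, add_sub_cancel_left]
  calc ‖L (T s x)‖ ≤ N * b * √(r - s) * ‖T s x‖ := hLn _
    _ ≤ N * b * √(r - s) * (c * ‖x‖) :=
      mul_le_mul_of_nonneg_left (hT.norm_le s hs x) (by positivity)
    _ = _ := by ring

/-- The optimal trajectories form an evolution operator. -/
theorem IsOptimalSignal.isEvolutionOperator (hT : IsOptimalSignal hS c T)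
    (hV : IsOptimalFlow Y B T V) : IsEvolutionOperator V := by
  have hY := hS.evolution
  refine ⟨fun t ht => ?_, fun s r t hs hsr hrt => ?_, fun s hs x => ?_, fun t ht x => ?_⟩
  · ext x
    rw [hV t t ht le_rfl x, trajectory_eq_mild, mild_self hY ht]
    rfl
  · ext x
    exact hT.flow_comp hV hs hsr hrt x
  · exact (continuousOn_trajectory hY hS.isLocallyBounded hS.input hs x (T s x)).congr
      fun t ht => hV s t hs ht x
  · obtain ⟨k, hk, hkV⟩ := hT.exists_norm_flow_sub_le hV t
    obtain ⟨N, hN⟩ := hS.isLocallyBounded t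
    have hN0 : 0 ≤ N := (norm_nonneg _).trans (hN t t ht le_rfl le_rfl)
    set m := N + k * √t with hm
    have hm0 : 0 ≤ m := by positivity
    have hVm : ∀ q, 0 ≤ q → q ≤ t → ∀ y, ‖V t q y‖ ≤ m * ‖y‖ := by
      intro q hq hqt y
      have h1 := hkV q t hq hqt le_rfl y
      have h2 : ‖Y t q y‖ ≤ N * ‖y‖ := (ContinuousLinearMap.le_opNorm _ _).trans
        (mul_le_mul_of_nonneg_right (hN q t hq hqt le_rfl) (norm_nonneg _))
      have h3 : ‖V t q y‖ ≤ ‖V t q y - Y t q y‖ + ‖Y t q y‖ := by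
        simpa using norm_add_le (V t q y - Y t q y) (Y t q y)
      have h4 : k * √(t - q) * ‖y‖ ≤ k * √t * ‖y‖ := by
        gcongr
        linarith
      rw [hm]
      linarith
    -- V t s x - V t q x = V t q (V q s x - x), and V q s x is compared with Y q s x.
    have key : ∀ s q, 0 ≤ s → s ≤ q → q ≤ t →
        ‖V t s x - V t q x‖ ≤ m * (‖Y q s x - x‖ + k * √(q - s) * ‖x‖) := by
      intro s q hs hsq hqt
      rw [← hT.flow_comp hV hs hsq hqt x, ← map_sub]
      refine (hVm q (hs.trans hsq) hqt _).trans (mul_le_mul_of_nonneg_left ?_ hm0)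
      have h1 : V q s x - x = (Y q s x - x) + (V q s x - Y q s x) := by abel
      rw [h1]
      exact (norm_add_le _ _).trans (add_le_add_right (hkV s q hs hsq hqt x) _)
    intro s₀ hs₀
    rw [ContinuousWithinAt, tendsto_iff_norm_sub_tendsto_zero]
    -- One majorant for both sides: for s ≤ s₀ the first norm is used, for s ≥ s₀ the second, and
    -- each vanishes at s = s₀.
    have hlim : Tendsto (fun s => m * ((‖extend Y s₀ s x - x‖ + ‖extend Y s s₀ x - x‖)
        + k * √|s₀ - s| * ‖x‖)) (𝓝[Set.Icc 0 t] s₀) (𝓝 0) := by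
      have hc : Continuous fun s => m * ((‖extend Y s₀ s x - x‖ + ‖extend Y s s₀ x - x‖)
          + k * √|s₀ - s| * ‖x‖) := by
        have h1 := hY.continuous_extend_right s₀ x
        have h2 := hY.continuous_extend_left s₀ x
        fun_prop
      have h := hc.tendsto s₀
      simp only [hY.extend_eq_id le_rfl, ContinuousLinearMap.id_apply, sub_self, norm_zero,
        abs_zero, Real.sqrt_zero, mul_zero, zero_mul, add_zero] at h
      exact h.mono_left nhdsWithin_le_nhds
    refine squeeze_zero' (Eventually.of_forall fun _ => norm_nonneg _) ?_ hlim
    filter_upwards [self_mem_nhdsWithin] with s hs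
    rcases le_total s s₀ with h | h
    · refine (key s s₀ hs.1 h hs₀.2).trans (mul_le_mul_of_nonneg_left ?_ hm0)
      rw [extend_of_le Y hs.1 h, abs_of_nonneg (sub_nonneg.2 h)]
      linarith [norm_nonneg (extend Y s s₀ x - x)]
    · rw [norm_sub_rev]
      refine (key s₀ s hs₀.1 h hs.2).trans (mul_le_mul_of_nonneg_left ?_ hm0)
      rw [extend_of_le Y hs₀.1 h, abs_sub_comm, abs_of_nonneg (sub_nonneg.2 h)]
      linarith [norm_nonneg (extend Y s₀ s x - x)]

end System

/-! ### The first variation and the feedback form of the optimal control -/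

section System

variable {𝕜 H X : Type*} [RCLike 𝕜]
  [NormedAddCommGroup H] [InnerProductSpace 𝕜 H] [NormedSpace ℝ H]
  [NormedAddCommGroup X] [InnerProductSpace 𝕜 X]
  {Y Z V : ℝ → ℝ → H →L[𝕜] H} {B : ℝ → X →L[𝕜] H} {C : ℝ → H →L[𝕜] H}
  {K : ℝ → H →L[𝕜] X} {T : ℝ → H →L[𝕜] Lp (WithLp 2 (H × X)) 2 (volume : Measure ℝ)} {c : ℝ}

lemma IsStabilizedSystem.memLp_closedLoop (hS : IsStabilizedSystem Y B C K Z) {q : ℝ}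
    (hq : 0 ≤ q) (v : H) :
    MemLp (Set.indicator (Set.Ici q) fun t => pairL (C t) (K t) (Z t q v)) 2 volume := by
  have hN := isBoundedContinuous_pairL hS.output hS.feedback
  obtain ⟨n, hn⟩ := hN.2
  obtain ⟨M, α, hM, hα, hZ⟩ := hS.stable
  obtain ⟨hf, -⟩ := memLp_indicator_of_norm_le_exp hN.1 hn hq hα (m := M * ‖v‖)
    (hS.perturbed.isEvolutionOperator.continuousOn_left q hq v) fun t ht => by
      refine (ContinuousLinearMap.le_opNorm _ _).trans
        ((mul_le_mul_of_nonneg_right (hZ q t hq ht) (norm_nonneg _)).trans (le_of_eq ?_))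
      ring
  exact hf

lemma integrable_norm_mul_exp {F : Type*} [NormedAddCommGroup F]
    (φ : Lp F 2 (volume : Measure ℝ)) {α : ℝ} (hα : 0 < α) (s : ℝ) :
    Integrable (fun t => ‖φ t‖ * Set.indicator (Set.Ici s) (fun t => Real.exp (-α * (t - s))) t) := by
  have h1 : MemLp (Set.indicator (Set.Ici s) (fun t => Real.exp (-α * (t - s)))) 2 volume := by
    have hm : AEStronglyMeasurable (Set.indicator (Set.Ici s)
        (fun t => Real.exp (-α * (t - s)))) volume :=
      (Continuous.aestronglyMeasurable (by fun_prop)).indicator measurableSet_Ici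
    rw [memLp_two_iff_integrable_sq hm]
    have h2 : ∀ t, Set.indicator (Set.Ici s) (fun t => Real.exp (-α * (t - s))) t ^ 2
        = Set.indicator (Set.Ici s) (fun t => Real.exp (-(2 * α) * (t - s))) t := by
      intro t
      by_cases h : t ∈ Set.Ici s
      · rw [Set.indicator_of_mem h, Set.indicator_of_mem h, ← Real.exp_nat_mul]
        congr 1
        push_cast
        ring
      · rw [Set.indicator_of_notMem h, Set.indicator_of_notMem h]
        simp
    simp_rw [h2]
    rw [integrable_indicator_iff measurableSet_Ici]
    exact integrableOn_exp_neg_sub (by positivity) s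
  exact (Lp.memLp φ).norm.integrable_mul h1

/-- Estimate and measurability of the kernel `⟪φ t, N t (Z t q (g q))⟫`, `s ≤ q ≤ t`. -/
lemma IsStabilizedSystem.integrable_kernel (hS : IsStabilizedSystem Y B C K Z) {s b : ℝ}
    (hs : 0 ≤ s) (φ : Lp (WithLp 2 (H × X)) 2 (volume : Measure ℝ)) {g : ℝ → H}
    (hg : Integrable g) (hgb : ∀ q, b < q → g q = 0) :
    Integrable (Function.uncurry fun t q => Set.indicator (Set.Ici q)
        (fun t => inner 𝕜 (φ t) (pairL (C t) (K t) (Z t q (g q)))) t)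
      ((volume : Measure ℝ).prod (volume.restrict (Set.Ioi s))) := by
  have hN := isBoundedContinuous_pairL hS.output hS.feedback
  obtain ⟨n, hn⟩ := hN.2
  obtain ⟨M, α, hM, hα, hZ⟩ := hS.stable
  have hn0 : 0 ≤ n := (norm_nonneg _).trans (hn 0 le_rfl)
  have hZe := hS.perturbed.isEvolutionOperator
  have hmem : ∀ᵐ p ∂((volume : Measure ℝ).prod (volume.restrict (Set.Ioi s))), s < p.2 := by
    have h : ∀ᵐ q ∂(volume.restrict (Set.Ioi s)), s < q := ae_restrict_mem measurableSet_Ioi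
    exact Measure.quasiMeasurePreserving_snd.ae h
  -- Since g vanishes after b, only q ≤ b matters, where exp (-α (t - q)) ≤ exp (α (b - s)) exp (-α
  -- (t - s)). This decouples t from q.
  have hbound := (((integrable_norm_mul_exp φ hα s).const_mul
    (n * M * Real.exp (α * (b - s)))).mul_prod (hg.norm.integrableOn (s := Set.Ioi s)))
  refine hbound.mono' ?_ ?_
  · have h0 : ∀ v, AEStronglyMeasurable (fun p : ℝ × ℝ => extend Z p.1 p.2 v)
        ((volume : Measure ℝ).prod (volume.restrict (Set.Ioi s))) :=
      fun v => (hZe.stronglyMeasurable_extend v).aestronglyMeasurable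
    have h1 := aestronglyMeasurable_clm_apply h0
      (AEStronglyMeasurable.comp_snd (μ := (volume : Measure ℝ))
        (hg.integrableOn (s := Set.Ioi s)).aestronglyMeasurable)
    have h2 : ∀ v, AEStronglyMeasurable
        (fun p : ℝ × ℝ => pairL (C (max p.1 0)) (K (max p.1 0)) v)
        ((volume : Measure ℝ).prod (volume.restrict (Set.Ioi s))) := by
      intro v
      have hc : Continuous fun t : ℝ => pairL (C (max t 0)) (K (max t 0)) :=
        hN.1.comp_continuous (f := fun t : ℝ => max t 0) (by fun_prop)
          fun t => Set.mem_Ici.2 (le_max_right _ _)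
      exact Continuous.aestronglyMeasurable
        ((hc.comp continuous_fst).clm_apply continuous_const)
    have h3 := aestronglyMeasurable_clm_apply h2 h1
    have h4 : AEStronglyMeasurable (fun p : ℝ × ℝ => φ p.1)
        ((volume : Measure ℝ).prod (volume.restrict (Set.Ioi s))) :=
      AEStronglyMeasurable.comp_fst (Lp.aestronglyMeasurable φ)
    have h5 := (AEStronglyMeasurable.inner (𝕜 := 𝕜) h4 h3).indicator
      (measurableSet_le (measurable_snd (α := ℝ) (β := ℝ)) measurable_fst)
    refine h5.congr ?_
    filter_upwards [hmem] with p hp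
    have hp0 : 0 ≤ p.2 := hs.trans hp.le
    by_cases h : p.2 ≤ p.1
    · simp only [Function.uncurry, Set.indicator, Set.mem_Ici, Set.mem_ofPred_eq, h, if_true]
      rw [extend_of_le Z hp0 h, max_eq_left (hp0.trans h)]
    · simp only [Function.uncurry, Set.indicator, Set.mem_Ici, Set.mem_ofPred_eq, h, if_false]
  · filter_upwards [hmem] with p hp
    have hp0 : 0 ≤ p.2 := hs.trans hp.le
    have hpos : 0 ≤ Set.indicator (Set.Ici s) (fun t => Real.exp (-α * (t - s))) p.1 :=
      Set.indicator_nonneg (fun _ _ => (Real.exp_pos _).le) _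
    by_cases h : p.2 ≤ p.1
    · simp only [Function.uncurry, Set.indicator_of_mem (Set.mem_Ici.2 h),
        Set.indicator_of_mem (Set.mem_Ici.2 (hp.le.trans h))]
      rcases le_or_gt p.2 b with hb | hb
      · have h6 : ‖Z p.1 p.2 (g p.2)‖
            ≤ M * (Real.exp (α * (b - s)) * Real.exp (-α * (p.1 - s))) * ‖g p.2‖ := by
          refine (ContinuousLinearMap.le_opNorm _ _).trans
            (mul_le_mul_of_nonneg_right ((hZ _ _ hp0 h).trans ?_) (norm_nonneg _))
          refine mul_le_mul_of_nonneg_left ?_ hM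
          rw [← Real.exp_add]
          refine Real.exp_le_exp.2 ?_
          nlinarith
        refine (norm_inner_le_norm _ _).trans ?_
        calc ‖φ p.1‖ * ‖pairL (C p.1) (K p.1) (Z p.1 p.2 (g p.2))‖
            ≤ ‖φ p.1‖ * (n * (M * (Real.exp (α * (b - s)) * Real.exp (-α * (p.1 - s)))
              * ‖g p.2‖)) := by
              refine mul_le_mul_of_nonneg_left ?_ (norm_nonneg _)
              exact (ContinuousLinearMap.le_opNorm _ _).trans
                (mul_le_mul (hn _ (hp0.trans h)) h6 (norm_nonneg _) hn0)
          _ = _ := by ring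
      · rw [hgb _ hb]
        simp
    · simp only [Function.uncurry, Set.indicator_of_notMem (mt Set.mem_Ici.1 h), norm_zero]
      positivity

variable [CompleteSpace H] {hS : IsStabilizedSystem Y B C K Z}

/-- Representation of the optimal cost operator along an optimal trajectory. -/
lemma IsOptimalSignal.inner_flow_eq (hT : IsOptimalSignal hS c T) (hV : IsOptimalFlow Y B T V)
    {s q : ℝ} (hs : 0 ≤ s) (hsq : s ≤ q) (x v : H) :
    inner 𝕜 (T q (V q s x)) (T q v)
      = ∫ t, Set.indicator (Set.Ici q)
          (fun t => inner 𝕜 (T s x t) (pairL (C t) (K t) (Z t q v))) t := by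
  have hq := hs.trans hsq
  have hf := hS.memLp_closedLoop hq v
  -- T q v and the closed loop signal of Z from (q, v) differ by an element over 0, to which optimal
  -- signals are orthogonal. So T q v can be replaced by an explicit signal whose dependence on q is
  -- under control.
  have h1 : ((0 : H), T q v - hf.toLp) ∈
      outputGraph hS.evolution hS.isLocallyBounded hS.input C hq := by
    simpa using Submodule.sub_mem _ (hT.mem q hq v) (hS.pairL_mem_outputGraph hq v hf)
  have h2 := hT.inner_eq_zero q hq (V q s x) _ h1
  rw [inner_sub_right, sub_eq_zero] at h2
  rw [h2, inner_eq_integral_of_ae_eq]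
  refine integral_congr_ae ?_
  filter_upwards [hT.restrict hV hs hsq x] with t ht
  rw [ht]
  by_cases h : t ∈ Set.Ici q
  · simp only [Set.indicator_of_mem h]
  · simp only [Set.indicator_of_notMem h, inner_zero_left]

/-- The first variation of the cost vanishes along optimal trajectories. -/
theorem IsOptimalSignal.integral_inner_add_eq_zero (hT : IsOptimalSignal hS c T)
    (hV : IsOptimalFlow Y B T V) {s b : ℝ} (hs : 0 ≤ s) (x : H) {h : ℝ → X}
    (hL : MemLp h 2 volume) (hsupp : ∀ q, q ∉ Set.Ioc s b → h q = 0) :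
    (∫ q in Set.Ioi s, inner 𝕜 (T q (V q s x)) (T q (B q (h q))))
      + ∫ q, inner 𝕜 (T s x q).snd (h q) = 0 := by
  have hN := isBoundedContinuous_pairL hS.output hS.feedback
  obtain ⟨n, hn⟩ := hN.2
  obtain ⟨M, α, hM, hα, hZ⟩ := hS.stable
  have hZe := hS.perturbed.isEvolutionOperator
  have hZb := hS.stable.isLocallyBounded
  set φ := T s x with hφ
  set g : ℝ → H := fun q => B q (h q) with hg
  have hsub : Set.Ioc s b ⊆ Set.Ici 0 := fun q hq => hs.trans hq.1.le
  have hg0 : ∀ q, q ∉ Set.Ioc s b → g q = 0 := fun q hq => by rw [hg]; simp [hsupp q hq]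
  have hhi : IntegrableOn h (Set.Ioc s b) :=
    (((hL.locallyIntegrable one_le_two).integrableOn_isCompact isCompact_Icc).mono_set
      (Set.Ioc_subset_Icc_self (a := s) (b := b)))
  have hgi : Integrable g := by
    rw [← integrableOn_iff_integrable_of_support_subset (s := Set.Ioc s b)
      (fun q hq => by by_contra hq'; exact hq (hg0 q hq'))]
    obtain ⟨β, hβ⟩ := hS.input.2
    exact integrableOn_clm_apply measurableSet_Ioc
      (fun v => ((hS.input.1.mono hsub).clm_apply continuousOn_const).aestronglyMeasurable
        measurableSet_Ioc) (fun q hq => hβ q (hsub hq)) hhi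
  -- The closed loop response to h, i.e. the trajectory from 0 under the control K ζ + h. As h has
  -- bounded support, ζ decays exponentially and its signal is square integrable.
  set ζ := mild Z s 0 g with hζ
  have hζc : ContinuousOn ζ (Set.Ici s) :=
    continuousOn_mild_Ici hZe hZb hs 0 fun t _ => hgi.intervalIntegrable
  have hζb : ∀ t, s ≤ t → ‖ζ t‖
      ≤ (M * Real.exp (α * (b - s)) * ∫ q, ‖g q‖) * Real.exp (-α * (t - s)) := by
    intro t ht
    have h1 : ‖∫ r in s..t, Z t r (g r)‖
        ≤ ∫ r in s..t, M * Real.exp (α * (b - s)) * Real.exp (-α * (t - s)) * ‖g r‖ := by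
      refine intervalIntegral.norm_integral_le_of_norm_le ht (ae_of_all _ fun r hr => ?_)
        (hgi.norm.intervalIntegrable.const_mul _)
      rcases le_or_gt r b with hb | hb
      · refine (ContinuousLinearMap.le_opNorm _ _).trans (mul_le_mul_of_nonneg_right
          ((hZ r t (hs.trans hr.1.le) hr.2).trans ?_) (norm_nonneg _))
        rw [mul_assoc, ← Real.exp_add]
        refine mul_le_mul_of_nonneg_left (Real.exp_le_exp.2 ?_) hM
        nlinarith
      · rw [hg0 r fun hr' => absurd hr'.2 (not_le.2 hb)]
        simp
    have h2 : ∫ r in s..t, ‖g r‖ ≤ ∫ q, ‖g q‖ := by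
      rw [intervalIntegral.integral_of_le ht]
      exact setIntegral_le_integral hgi.norm (ae_of_all _ fun _ => norm_nonneg _)
    rw [hζ, mild, map_zero, zero_add]
    refine h1.trans ?_
    rw [intervalIntegral.integral_const_mul]
    calc M * Real.exp (α * (b - s)) * Real.exp (-α * (t - s)) * ∫ r in s..t, ‖g r‖
        ≤ M * Real.exp (α * (b - s)) * Real.exp (-α * (t - s)) * ∫ q, ‖g q‖ :=
          mul_le_mul_of_nonneg_left h2 (by positivity)
      _ = _ := by ring
  obtain ⟨hf1, -⟩ := memLp_indicator_of_norm_le_exp hN.1 hn hs hα hζc hζb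
  have hf2 : MemLp (fun t => WithLp.toLp 2 ((0 : H), h t)) 2 volume := by
    let J : X →L[𝕜] WithLp 2 (H × X) :=
      ((WithLp.prodContinuousLinearEquiv 2 𝕜 H X).symm : H × X →L[𝕜] WithLp 2 (H × X)) ∘L
        (ContinuousLinearMap.inr 𝕜 H X)
    exact J.comp_memLp' hL
  have hf := hf1.add hf2
  have hval : ∀ t, s ≤ t → (Set.indicator (Set.Ici s) (fun t => pairL (C t) (K t) (ζ t))
      + fun t => WithLp.toLp 2 ((0 : H), h t)) t = WithLp.toLp 2 (C t (ζ t), K t (ζ t) + h t) := by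
    intro t ht
    rw [Pi.add_apply, Set.indicator_of_mem (Set.mem_Ici.2 ht), pairL_apply, ← WithLp.toLp_add]
    simp
  have hmem : ((0 : H), hf.toLp) ∈
      outputGraph hS.evolution hS.isLocallyBounded hS.input C hs := by
    refine toLp_mem_outputGraph _ _ _ hs hf (ae_of_all _ fun t ht => ?_)
      (ae_of_all _ fun t ht => ?_)
    · rw [Pi.add_apply, Set.indicator_of_notMem (mt Set.mem_Ici.1 (not_le.2 ht)),
        hsupp t fun ht' => absurd ht'.1 (not_lt.2 ht.le)]
      simp
    · rw [hval t ht]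
      change C t (ζ t) = _
      congr 1
      rw [hζ, hS.perturbed.mild_eq hS.evolution hS.isLocallyBounded hZb
        (hS.input.comp hS.feedback).1 hs ht 0 hgi.intervalIntegrable, trajectory_eq_mild]
      refine mild_congr ht (ae_of_all _ fun r hr => ?_)
      rw [hval r hr.1.le]
      change _ = B r (K r (ζ r) + h r)
      rw [map_add, add_comm]
      rfl
  have h0 := hT.inner_eq_zero s hs x _ hmem
  rw [inner_eq_integral_of_ae_eq] at h0
  have hi1 : Integrable fun t => inner 𝕜 (φ t)
      (Set.indicator (Set.Ici s) (fun t => pairL (C t) (K t) (ζ t)) t) := by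
    refine (L2.integrable_inner (𝕜 := 𝕜) φ hf1.toLp).congr ?_
    filter_upwards [hf1.coeFn_toLp] with t ht
    rw [ht]
  have hi2 : Integrable fun t => inner 𝕜 (φ t) (WithLp.toLp 2 ((0 : H), h t)) := by
    refine (L2.integrable_inner (𝕜 := 𝕜) φ hf2.toLp).congr ?_
    filter_upwards [hf2.coeFn_toLp] with t ht
    rw [ht]
  simp only [Pi.add_apply, inner_add_right] at h0
  rw [integral_add hi1 hi2] at h0
  have h2 : ∫ t, inner 𝕜 (φ t) (WithLp.toLp 2 ((0 : H), h t))
      = ∫ q, inner 𝕜 (φ q).snd (h q) := by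
    refine integral_congr_ae (ae_of_all _ fun t => ?_)
    simp only [WithLp.prod_inner_apply, inner_zero_right, zero_add]
    rfl
  rw [← h2, ← h0]
  congr 1
  have hk := hS.integrable_kernel hs φ hgi (b := b)
    (fun q hq => hg0 q fun hq' => absurd hq'.2 (not_le.2 hq))
  -- With `inner_flow_eq` the costate term becomes a double integral over s < q ≤ t; integrating in
  -- q first reassembles ζ t.
  have h3 : ∫ q in Set.Ioi s, inner 𝕜 (T q (V q s x)) (T q (g q))
      = ∫ q in Set.Ioi s, ∫ t, Set.indicator (Set.Ici q)
        (fun t => inner 𝕜 (φ t) (pairL (C t) (K t) (Z t q (g q)))) t :=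
    setIntegral_congr_fun measurableSet_Ioi fun q hq => hT.inner_flow_eq hV hs (le_of_lt hq) x (g q)
  rw [h3, ← integral_integral_swap hk]
  refine integral_congr_ae (ae_of_all _ fun t => ?_)
  have h4 : ∀ q, Set.indicator (Set.Ici q)
      (fun t => inner 𝕜 (φ t) (pairL (C t) (K t) (Z t q (g q)))) t
      = Set.indicator (Set.Iic t)
        (fun q => inner 𝕜 (φ t) (pairL (C t) (K t) (Z t q (g q)))) q := fun q => by
    simp only [Set.indicator, Set.mem_Ici, Set.mem_Iic]
  simp only [h4]
  rw [integral_indicator measurableSet_Iic, Measure.restrict_restrict measurableSet_Iic,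
    Set.inter_comm, Set.Ioi_inter_Iic]
  rcases le_or_gt s t with ht | ht
  · rw [Set.indicator_of_mem (Set.mem_Ici.2 ht), ← intervalIntegral.integral_of_le ht]
    have h5 := hZe.intervalIntegrable_apply hZb hs ht hgi.intervalIntegrable
    let A : H →L[𝕜] 𝕜 := (innerSL 𝕜 (φ t)) ∘L pairL (C t) (K t)
    have h6 := A.intervalIntegral_comp_comm h5
    have h7 : ζ t = ∫ r in s..t, Z t r (g r) := by rw [hζ, mild, map_zero, zero_add]
    rw [h7]
    exact h6
  · rw [Set.indicator_of_notMem (mt Set.mem_Ici.1 (not_le.2 ht)), Set.Ioc_eq_empty (not_lt.2 ht.le)]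
    simp

end System

section System

variable {𝕜 H X : Type*} [RCLike 𝕜]
  [NormedAddCommGroup H] [InnerProductSpace 𝕜 H] [NormedSpace ℝ H] [CompleteSpace H]
  [NormedAddCommGroup X] [InnerProductSpace 𝕜 X]
  {Y Z V : ℝ → ℝ → H →L[𝕜] H} {B : ℝ → X →L[𝕜] H} {C : ℝ → H →L[𝕜] H}
  {K : ℝ → H →L[𝕜] X} {T : ℝ → H →L[𝕜] Lp (WithLp 2 (H × X)) 2 (volume : Measure ℝ)} {c : ℝ}
  {hS : IsStabilizedSystem Y B C K Z}

/-- The costate `P q (z q)` is weakly continuous along optimal trajectories `z`. -/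
lemma IsOptimalSignal.continuousOn_inner_flow (hT : IsOptimalSignal hS c T)
    (hV : IsOptimalFlow Y B T V) {s : ℝ} (hs : 0 ≤ s) (x v : H) :
    ContinuousOn (fun q => inner 𝕜 (T q (V q s x)) (T q v)) (Set.Ici s) := by
  have hN := isBoundedContinuous_pairL hS.output hS.feedback
  obtain ⟨n, hn⟩ := hN.2
  obtain ⟨M, α, hM, hα, hZ⟩ := hS.stable
  have hZe := hS.perturbed.isEvolutionOperator
  have hn0 : 0 ≤ n := (norm_nonneg _).trans (hn 0 le_rfl)
  refine ContinuousOn.congr ?_ fun q hq => hT.inner_flow_eq hV hs hq x v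
  set φ := T s x with hφ
  intro q₀ hq₀
  have hq₀0 : 0 ≤ q₀ := hs.trans hq₀
  -- Only q < q₀ + 1 matters near q₀, which gives a majorant independent of q.
  have hbound : Integrable fun t => n * (M * Real.exp (α * (q₀ + 1 - s)) * ‖v‖)
      * (‖φ t‖ * Set.indicator (Set.Ici s) (fun t => Real.exp (-α * (t - s))) t) :=
    (integrable_norm_mul_exp φ hα s).const_mul _
  refine tendsto_integral_filter_of_dominated_convergence _ ?_ ?_ hbound ?_
  · filter_upwards [self_mem_nhdsWithin] with q hq
    have hf := hS.memLp_closedLoop (hs.trans hq) v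
    refine (AEStronglyMeasurable.inner (𝕜 := 𝕜) (Lp.aestronglyMeasurable φ)
      hf.aestronglyMeasurable).congr (ae_of_all _ fun t => ?_)
    by_cases h : t ∈ Set.Ici q
    · simp only [Set.indicator_of_mem h]
    · simp only [Set.indicator_of_notMem h, inner_zero_right]
  · filter_upwards [self_mem_nhdsWithin, mem_nhdsWithin_of_mem_nhds
      (Iio_mem_nhds (lt_add_one q₀))] with q hq hq1
    refine ae_of_all _ fun t => ?_
    have hpos : 0 ≤ Set.indicator (Set.Ici s) (fun t => Real.exp (-α * (t - s))) t :=
      Set.indicator_nonneg (fun _ _ => (Real.exp_pos _).le) _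
    by_cases h : t ∈ Set.Ici q
    · have hst : t ∈ Set.Ici s := Set.mem_Ici.2 ((Set.mem_Ici.1 hq).trans h)
      rw [Set.indicator_of_mem h, Set.indicator_of_mem hst]
      refine (norm_inner_le_norm _ _).trans ?_
      have h6 : ‖Z t q v‖ ≤ M * (Real.exp (α * (q₀ + 1 - s)) * Real.exp (-α * (t - s))) * ‖v‖ := by
        refine (ContinuousLinearMap.le_opNorm _ _).trans
          (mul_le_mul_of_nonneg_right ((hZ _ _ (hs.trans hq) h).trans ?_) (norm_nonneg _))
        refine mul_le_mul_of_nonneg_left ?_ hM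
        rw [← Real.exp_add]
        refine Real.exp_le_exp.2 ?_
        have := Set.mem_Iio.1 hq1
        nlinarith
      calc ‖φ t‖ * ‖pairL (C t) (K t) (Z t q v)‖
          ≤ ‖φ t‖ * (n * (M * (Real.exp (α * (q₀ + 1 - s)) * Real.exp (-α * (t - s))) * ‖v‖)) := by
            refine mul_le_mul_of_nonneg_left ?_ (norm_nonneg _)
            exact (ContinuousLinearMap.le_opNorm _ _).trans
              (mul_le_mul (hn _ (hs.trans hst)) h6 (norm_nonneg _) hn0)
        _ = _ := by ring
    · rw [Set.indicator_of_notMem h, norm_zero]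
      positivity
  -- For t ≠ q₀ the indicator is locally constant in q, and Z t q v is continuous in q; the jump at
  -- t = q₀ is a null set.
  · filter_upwards [compl_mem_ae_iff.2 (measure_singleton q₀)] with t ht
    rcases lt_or_gt_of_ne ht with h | h
    · rw [Set.indicator_of_notMem (mt Set.mem_Ici.1 (not_le.2 h))]
      refine tendsto_const_nhds.congr' ?_
      filter_upwards [mem_nhdsWithin_of_mem_nhds (Ioi_mem_nhds h)] with q hq
      rw [Set.indicator_of_notMem (mt Set.mem_Ici.1 (not_le.2 hq))]
    · rw [Set.indicator_of_mem (Set.mem_Ici.2 h.le)]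
      have h1 : Tendsto (fun q => extend Z t q v) (𝓝[Set.Ici s] q₀) (𝓝 (Z t q₀ v)) := by
        rw [← extend_of_le Z hq₀0 h.le]
        exact ((hZe.continuous_extend_right t v).tendsto q₀).mono_left nhdsWithin_le_nhds
      have h2 : Tendsto (fun q => inner 𝕜 (φ t) (pairL (C t) (K t) (extend Z t q v)))
          (𝓝[Set.Ici s] q₀) (𝓝 (inner 𝕜 (φ t) (pairL (C t) (K t) (Z t q₀ v)))) :=
        tendsto_const_nhds.inner (((pairL (C t) (K t)).continuous.tendsto _).comp h1)
      refine h2.congr' ?_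
      filter_upwards [self_mem_nhdsWithin, mem_nhdsWithin_of_mem_nhds (Iio_mem_nhds h)] with q hq hq'
      rw [Set.indicator_of_mem (Set.mem_Ici.2 (le_of_lt hq')),
        extend_of_le Z (hs.trans hq) (le_of_lt hq')]

variable [CompleteSpace X]

/-- The optimal control is given by the feedback `-B(t)* P(t)`. -/
theorem IsOptimalSignal.control_eq (hT : IsOptimalSignal hS c T) (hV : IsOptimalFlow Y B T V)
    {s : ℝ} (hs : 0 ≤ s) (x : H) : ∀ᵐ q, s < q → (T s x q).snd
      = -(ContinuousLinearMap.adjoint (B q)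
        (ContinuousLinearMap.adjoint (T q) (T q (V q s x)))) := by
  set φ := T s x with hφ
  set p : ℝ → H := fun q => ContinuousLinearMap.adjoint (T q) (T q (V q s x)) with hp
  set w : ℝ → X := fun q => ContinuousLinearMap.adjoint (B q) (p q) with hw
  -- Nothing is known about measurability of q ↦ T q; the costate p is measurable because it is
  -- weakly continuous.
  have hpm : AEStronglyMeasurable p (volume.restrict (Set.Ici s)) := by
    have h1 : StronglyMeasurable fun q => p (max s q) := by
      refine stronglyMeasurable_of_continuous_inner (𝕜 := 𝕜) fun v => ?_
      have h2 : ∀ q, inner 𝕜 v (p q)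
          = (starRingEnd 𝕜) (inner 𝕜 (T q (V q s x)) (T q v)) := fun q => by
        rw [hp, ContinuousLinearMap.adjoint_inner_right, inner_conj_symm]
      simp_rw [h2]
      refine RCLike.continuous_conj.comp ?_
      exact (hT.continuousOn_inner_flow hV hs x v).comp_continuous
        (f := fun q => max s q) (by fun_prop) fun q => Set.mem_Ici.2 (le_max_left _ _)
    refine h1.aestronglyMeasurable.congr ?_
    filter_upwards [ae_restrict_mem measurableSet_Ici] with q hq
    rw [max_eq_right (Set.mem_Ici.1 hq)]
  obtain ⟨β, hβ⟩ := hS.input.2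
  have hβ0 : 0 ≤ β := (norm_nonneg _).trans (hβ 0 le_rfl)
  have hwm : AEStronglyMeasurable w (volume.restrict (Set.Ici s)) := by
    refine aestronglyMeasurable_clm_apply (fun v => ?_) hpm
    have h1 : ContinuousOn (fun q => ContinuousLinearMap.adjoint (B q)) (Set.Ici s) :=
      (ContinuousLinearMap.adjoint (𝕜 := 𝕜) (E := X) (F := H)).continuous.comp_continuousOn
        (hS.input.1.mono (Set.Ici_subset_Ici.2 hs))
    exact (h1.clm_apply continuousOn_const).aestronglyMeasurable measurableSet_Ici
  have hzc := continuousOn_trajectory hS.evolution hS.isLocallyBounded hS.input hs x φ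
  have hw_le : ∀ q, s ≤ q → ‖w q‖ ≤ β * (c * (c * ‖V q s x‖)) := by
    intro q hq
    have hq0 : 0 ≤ q := hs.trans hq
    have hTn : ‖T q‖ ≤ c := ContinuousLinearMap.opNorm_le_bound _ hT.nonneg (hT.norm_le q hq0)
    refine (ContinuousLinearMap.le_opNorm _ _).trans (mul_le_mul ?_ ?_ (norm_nonneg _) hβ0)
    · rw [LinearIsometryEquiv.norm_map]
      exact hβ q hq0
    · refine (ContinuousLinearMap.le_opNorm _ _).trans
        (mul_le_mul ?_ (hT.norm_le q hq0 _) (norm_nonneg _) hT.nonneg)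
      rwa [LinearIsometryEquiv.norm_map]
  have key : ∀ b, s ≤ b → ∀ᵐ q, q ∈ Set.Ioc s b → (φ q).snd + w q = 0 := by
    intro b hsb
    obtain ⟨m, hm⟩ := isCompact_Icc.bddAbove_image
      (hzc.mono (Set.Icc_subset_Ici_self : Set.Icc s b ⊆ Set.Ici s)).norm
    -- The test control is the defect u + B*p itself, cut off to (s, b]; the first variation then
    -- says that its L² norm is zero.
    set h : ℝ → X := Set.indicator (Set.Ioc s b) fun q => (φ q).snd + w q with hh
    have hu : MemLp (fun q => (φ q).snd) 2 volume :=
      (WithLp.sndL 2 𝕜 H X).comp_memLp' (Lp.memLp φ)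
    have hwL : MemLp w 2 (volume.restrict (Set.Ioc s b)) := by
      refine MemLp.of_bound (hwm.mono_set (Set.Ioc_subset_Ioi_self.trans Set.Ioi_subset_Ici_self))
        (β * (c * (c * m))) ?_
      filter_upwards [ae_restrict_mem measurableSet_Ioc] with q hq
      refine (hw_le q hq.1.le).trans ?_
      have h1 : ‖V q s x‖ ≤ m := by
        rw [hV s q hs hq.1.le x]
        exact hm ⟨q, ⟨hq.1.le, hq.2⟩, rfl⟩
      have := hT.nonneg
      gcongr
    have hL : MemLp h 2 volume := by
      rw [hh, memLp_indicator_iff_restrict measurableSet_Ioc]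
      exact (hu.restrict _).add hwL
    have h0 := hT.integral_inner_add_eq_zero hV (b := b) hs x hL
      fun q hq => Set.indicator_of_notMem hq _
    have h1 : ∫ q in Set.Ioi s, inner 𝕜 (T q (V q s x)) (T q (B q (h q)))
        = ∫ q, inner 𝕜 (Set.indicator (Set.Ioc s b) w q) (h q) := by
      rw [← integral_indicator measurableSet_Ioi]
      refine integral_congr_ae (ae_of_all _ fun q => ?_)
      by_cases hq : q ∈ Set.Ioc s b
      · simp only
        rw [Set.indicator_of_mem (Set.mem_Ioi.2 hq.1), Set.indicator_of_mem hq, hw,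
          ContinuousLinearMap.adjoint_inner_left, hp, ContinuousLinearMap.adjoint_inner_left]
      · have hq0 : h q = 0 := Set.indicator_of_notMem hq _
        simp only [Set.indicator_apply, hq0, map_zero, inner_zero_right, ite_self]
    have h2 : ∫ q, inner 𝕜 (φ q).snd (h q)
        = ∫ q, inner 𝕜 (Set.indicator (Set.Ioc s b) (fun q => (φ q).snd) q) (h q) := by
      refine integral_congr_ae (ae_of_all _ fun q => ?_)
      by_cases hq : q ∈ Set.Ioc s b
      · simp only
        rw [Set.indicator_of_mem hq (fun q => (φ q).snd)]
      · simp only [hh, Set.indicator_of_notMem hq, inner_zero_right]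
    have hwi : MemLp (Set.indicator (Set.Ioc s b) w) 2 volume :=
      (memLp_indicator_iff_restrict measurableSet_Ioc).2 hwL
    have hui : MemLp (Set.indicator (Set.Ioc s b) (fun q => (φ q).snd)) 2 volume :=
      hu.indicator measurableSet_Ioc
    have hint : ∀ {f : ℝ → X}, MemLp f 2 volume → Integrable fun q => inner 𝕜 (f q) (h q) := by
      intro f hf
      refine (L2.integrable_inner (𝕜 := 𝕜) hf.toLp hL.toLp).congr ?_
      filter_upwards [hf.coeFn_toLp, hL.coeFn_toLp] with q h3 h4
      rw [h3, h4]
    rw [h1, h2, ← integral_add (hint hwi) (hint hui)] at h0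
    have h3 : inner 𝕜 hL.toLp hL.toLp = 0 := by
      rw [inner_eq_integral_of_ae_eq, ← h0]
      refine integral_congr_ae ?_
      filter_upwards [hL.coeFn_toLp] with q hq
      rw [hq, ← inner_add_left]
      congr 1
      rw [hh]
      by_cases hq : q ∈ Set.Ioc s b
      · simp only [Set.indicator_of_mem hq, add_comm]
      · simp only [Set.indicator_of_notMem hq, add_zero]
    have h4 := inner_self_eq_zero.1 h3
    have h5 := hL.coeFn_toLp
    rw [h4] at h5
    filter_upwards [h5, Lp.coeFn_zero X 2 (volume : Measure ℝ)] with q h6 h7 hq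
    have h8 : h q = 0 := by rw [← h6, h7]; rfl
    rwa [hh, Set.indicator_of_mem hq] at h8
  -- Countably many intervals (s, s + n] exhaust (s, ∞), so the exceptional null sets can be united.
  have hall : ∀ᵐ q, ∀ n : ℕ, q ∈ Set.Ioc s (s + n) → (φ q).snd + w q = 0 :=
    ae_all_iff.2 fun n => key (s + n) (by simp)
  filter_upwards [hall] with q hq hsq
  obtain ⟨n, hn⟩ := exists_nat_ge (q - s)
  exact eq_neg_of_add_eq_zero_left (hq n ⟨hsq, by linarith⟩)

end System

/-! ### The optimal closed loop: generation, stability, uniqueness -/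

section System

variable {𝕜 H X : Type*} [RCLike 𝕜]
  [NormedAddCommGroup H] [InnerProductSpace 𝕜 H] [NormedSpace ℝ H] [CompleteSpace H]
  [NormedAddCommGroup X] [InnerProductSpace 𝕜 X]
  {Y Z V : ℝ → ℝ → H →L[𝕜] H} {B : ℝ → X →L[𝕜] H} {C D : ℝ → H →L[𝕜] H}
  {K : ℝ → H →L[𝕜] X} {T : ℝ → H →L[𝕜] Lp (WithLp 2 (H × X)) 2 (volume : Measure ℝ)} {c : ℝ}
  {hS : IsStabilizedSystem Y B C K Z}

/-- The optimal trajectories are generated by the optimal feedback. -/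
theorem IsOptimalSignal.isPerturbedEvolution [CompleteSpace X] (hT : IsOptimalSignal hS c T)
    (hV : IsOptimalFlow Y B T V)
    (hD : ∀ t, 0 ≤ t → D t = -(B t ∘L ContinuousLinearMap.adjoint (B t) ∘L
      ContinuousLinearMap.adjoint (T t) ∘L T t)) : IsPerturbedEvolution Y D V := by
  have hae : ∀ s, 0 ≤ s → ∀ x, ∀ᵐ r, s < r → D r (V r s x) = B r (T s x r).snd := by
    intro s hs x
    filter_upwards [hT.control_eq hV hs x] with r hr hsr
    rw [hr hsr, hD r (hs.trans hsr.le), map_neg]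
    rfl
  refine ⟨hT.isEvolutionOperator hV, fun s t hs hst w => ?_, fun s t hs hst w => ?_⟩
  · have h := hS.evolution.intervalIntegrable_apply hS.isLocallyBounded hs hst
      (intervalIntegrable_input hS.input (T s w) hs hst)
    rw [intervalIntegrable_iff_integrableOn_Ioc_of_le hst] at h ⊢
    refine h.congr ?_
    filter_upwards [ae_restrict_of_ae (hae s hs w), ae_restrict_mem measurableSet_Ioc] with r h1 h2
    rw [h1 h2.1]
  · rw [hV s t hs hst w, trajectory]
    congr 1
    refine intervalIntegral.integral_congr_ae ?_
    filter_upwards [hae s hs w] with r h1 h2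
    rw [Set.uIoc_of_le hst] at h2
    rw [h1 h2.1]

/-- Detectability implies the exponential stability of the optimal trajectories. -/
theorem IsOptimalSignal.isExponentiallyStable (hT : IsOptimalSignal hS c T)
    (hV : IsOptimalFlow Y B T V) (hdet : IsUniformlyDetectable Y C) :
    IsExponentiallyStable V := by
  obtain ⟨L, hL, U, hU, hUs⟩ := hdet
  obtain ⟨β, hβ⟩ := hS.input.2
  obtain ⟨l, hl⟩ := hL.2
  have hβ0 : 0 ≤ β := (norm_nonneg _).trans (hβ 0 le_rfl)
  have hl0 : 0 ≤ l := (norm_nonneg _).trans (hl 0 le_rfl)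
  obtain ⟨m, hm0, hm⟩ := exists_mild_le hU.isEvolutionOperator hUs
  have key : ∀ s t, 0 ≤ s → s ≤ t → ∀ x,
      ‖V t s x‖ ^ 2 ≤ m * (1 + ((β + l) * c) ^ 2) * ‖x‖ ^ 2 ∧
      ∫ r in s..t, ‖V r s x‖ ^ 2 ≤ m * (1 + ((β + l) * c) ^ 2) * ‖x‖ ^ 2 := by
    intro s t hs hst x
    set φ := T s x with hφ
    -- Along the optimal trajectory the first component of φ is C z, so this is the forcing B u - L
    -- C z left over after output injection.
    set f : ℝ → H := fun r => B r (φ r).snd - L r (φ r).fst with hf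
    have hsub : Set.Ioc s t ⊆ Set.Ici 0 := fun r hr => hs.trans hr.1.le
    have hφm := (Lp.aestronglyMeasurable φ).restrict (s := Set.Ioc s t)
    have hfm : AEStronglyMeasurable f (volume.restrict (Set.Ioc s t)) := by
      refine AEStronglyMeasurable.sub
        (aestronglyMeasurable_clm_apply (fun v => ?_) ?_)
        (aestronglyMeasurable_clm_apply (fun v => ?_) ?_)
      · exact ((hS.input.1.mono hsub).clm_apply continuousOn_const).aestronglyMeasurable
          measurableSet_Ioc
      · exact (WithLp.sndL 2 𝕜 H X).continuous.comp_aestronglyMeasurable hφm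
      · exact ((hL.1.mono hsub).clm_apply continuousOn_const).aestronglyMeasurable
          measurableSet_Ioc
      · exact (WithLp.fstL 2 𝕜 H X).continuous.comp_aestronglyMeasurable hφm
    have hfb : ∀ r ∈ Set.Ioc s t, ‖f r‖ ^ 2 ≤ (β + l) ^ 2 * ‖φ r‖ ^ 2 := by
      intro r hr
      rw [← mul_pow]
      refine pow_le_pow_left₀ (norm_nonneg _) ?_ 2
      have h1 : ‖B r (φ r).snd‖ ≤ β * ‖φ r‖ := (ContinuousLinearMap.le_opNorm _ _).trans
        (mul_le_mul (hβ r (hsub hr)) (norm_snd_le _) (norm_nonneg _) hβ0)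
      have h2 : ‖L r (φ r).fst‖ ≤ l * ‖φ r‖ := (ContinuousLinearMap.le_opNorm _ _).trans
        (mul_le_mul (hl r (hsub hr)) (norm_fst_le _) (norm_nonneg _) hl0)
      have := norm_sub_le (B r (φ r).snd) (L r (φ r).fst)
      simp only [hf]
      linarith
    have hφi : IntegrableOn (fun r => (β + l) ^ 2 * ‖φ r‖ ^ 2) (Set.Ioc s t) :=
      ((integrable_norm_sq_coeFn φ).const_mul _).integrableOn
    have hfi : IntervalIntegrable (fun r => ‖f r‖ ^ 2) volume s t := by
      rw [intervalIntegrable_iff_integrableOn_Ioc_of_le hst]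
      refine hφi.mono' (hfm.norm.pow 2) ?_
      filter_upwards [ae_restrict_mem measurableSet_Ioc] with r hr
      rw [Real.norm_eq_abs, abs_of_nonneg (sq_nonneg _)]
      exact hfb r hr
    have hfint : ∫ r in s..t, ‖f r‖ ^ 2 ≤ ((β + l) * c) ^ 2 * ‖x‖ ^ 2 := by
      calc ∫ r in s..t, ‖f r‖ ^ 2 ≤ ∫ r in s..t, (β + l) ^ 2 * ‖φ r‖ ^ 2 := by
            rw [intervalIntegral.integral_of_le hst, intervalIntegral.integral_of_le hst]
            exact setIntegral_mono_on
              ((intervalIntegrable_iff_integrableOn_Ioc_of_le hst).1 hfi) hφi measurableSet_Ioc hfb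
        _ = (β + l) ^ 2 * ∫ r in s..t, ‖φ r‖ ^ 2 := intervalIntegral.integral_const_mul _ _
        _ ≤ (β + l) ^ 2 * (c * ‖x‖) ^ 2 := by
          refine mul_le_mul_of_nonneg_left ((integral_norm_sq_le φ hst).trans ?_) (sq_nonneg _)
          exact pow_le_pow_left₀ (norm_nonneg _) (hT.norm_le s hs x) 2
        _ = _ := by ring
    -- Passing from Y to U, the evolution operator perturbed by L C, moves L C z into the forcing.
    have hz : ∀ r ∈ Set.Icc s t, V r s x = mild U s x f r := by
      intro r hr
      rw [hV s r hs hr.1 x, trajectory_eq_mild, hU.mild_eq_sub hS.evolution hS.isLocallyBounded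
        hUs.isLocallyBounded (hL.comp hS.output) hs hr.1 x
        (intervalIntegrable_input hS.input φ hs hr.1)]
      refine mild_congr hr.1 ?_
      filter_upwards [(mem_outputGraph.1 (hT.mem s hs x)).2] with q hq hq'
      simp only [hf]
      rw [hq hq'.1.le, trajectory_eq_mild]
      rfl
    obtain ⟨h1, h2⟩ := hm s t hs hst x f hfm hfi
    have h3 : m * (‖x‖ ^ 2 + ∫ r in s..t, ‖f r‖ ^ 2)
        ≤ m * (1 + ((β + l) * c) ^ 2) * ‖x‖ ^ 2 := by
      rw [mul_assoc]
      refine mul_le_mul_of_nonneg_left ?_ hm0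
      linarith
    constructor
    · rw [hz t ⟨hst, le_rfl⟩]
      exact h1.trans h3
    · refine le_trans (le_of_eq ?_) (h2.trans h3)
      refine intervalIntegral.integral_congr fun r hr => ?_
      rw [Set.uIcc_of_le hst] at hr
      simp only [hz r hr]
  exact isExponentiallyStable_of_integral_le (hT.isEvolutionOperator hV)
    (fun s t hs hst x => (key s t hs hst x).1) (fun s t hs hst x => (key s t hs hst x).2)

/-- The closed loop evolution operator of the optimal feedback exists, and it is exponentially
stable. -/
theorem IsOptimalSignal.exists_perturbed_and_stable [CompleteSpace X]
    (hT : IsOptimalSignal hS c T) (hdet : IsUniformlyDetectable Y C)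
    (hD : ∀ t, 0 ≤ t → D t = -(B t ∘L ContinuousLinearMap.adjoint (B t) ∘L
      ContinuousLinearMap.adjoint (T t) ∘L T t)) :
    (∃ V, IsPerturbedEvolution Y D V) ∧
      ∀ V, IsPerturbedEvolution Y D V → IsExponentiallyStable V := by
  obtain ⟨V, hV⟩ := hS.exists_isOptimalFlow T
  have hVp := hT.isPerturbedEvolution hV hD
  refine ⟨⟨V, hVp⟩, fun V' hV' => ?_⟩
  obtain ⟨M, α, hM, hα, hb⟩ := hT.isExponentiallyStable hV hdet
  refine ⟨M, α, hM, hα, fun s t hs hst => ?_⟩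
  -- Uniqueness needs a bounded perturbation, and B B* T* T is bounded by β² c².
  rw [hV'.eq hS.isLocallyBounded hVp ?_ hs hst]
  · exact hb s t hs hst
  · obtain ⟨β, hβ⟩ := hS.input.2
    refine ⟨β * (β * (c * c)), fun t ht => ?_⟩
    have hβ0 : 0 ≤ β := (norm_nonneg _).trans (hβ 0 le_rfl)
    have hTn : ‖T t‖ ≤ c := ContinuousLinearMap.opNorm_le_bound _ hT.nonneg (hT.norm_le t ht)
    rw [hD t ht, norm_neg]
    refine (ContinuousLinearMap.opNorm_comp_le _ _).trans
      (mul_le_mul (hβ t ht) ?_ (norm_nonneg _) hβ0)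
    refine (ContinuousLinearMap.opNorm_comp_le _ _).trans
      (mul_le_mul ?_ ?_ (norm_nonneg _) hβ0)
    · rw [LinearIsometryEquiv.norm_map]
      exact hβ t ht
    · refine (ContinuousLinearMap.opNorm_comp_le _ _).trans
        (mul_le_mul ?_ hTn (norm_nonneg _) hT.nonneg)
      rwa [LinearIsometryEquiv.norm_map]

end System

/-! ### The cost as the squared norm of a signal -/

section Cost

variable {𝕜 H X : Type*} [RCLike 𝕜]
  [NormedAddCommGroup H] [InnerProductSpace 𝕜 H] [NormedSpace ℝ H]
  [NormedAddCommGroup X] [InnerProductSpace 𝕜 X]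
  {Y : ℝ → ℝ → H →L[𝕜] H} {B : ℝ → X →L[𝕜] H} {W C : ℝ → H →L[𝕜] H}
  {R S S' : ℝ → X →L[𝕜] X}

lemma memLp_two_of_lintegral_norm_sq {F : Type*} [NormedAddCommGroup F] {f : ℝ → F}
    (hm : AEStronglyMeasurable f volume) (hf : ∫⁻ r, ENNReal.ofReal (‖f r‖ ^ 2) ≠ ⊤) :
    MemLp f 2 volume := by
  rw [memLp_two_iff_integrable_sq_norm hm]
  refine ⟨hm.norm.pow 2, ?_⟩
  rw [hasFiniteIntegral_iff_ofReal (ae_of_all _ fun _ => sq_nonneg _)]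
  exact hf.lt_top

lemma trajectory_comp_input {s : ℝ} (x : H) {u v : ℝ → X} {t : ℝ} (hst : s ≤ t)
    (h : ∀ r, s ≤ r → u r = S' r (v r)) :
    trajectory Y B s x u t = trajectory Y (fun r => B r ∘L S' r) s x v t := by
  rw [trajectory_eq_mild, trajectory_eq_mild]
  refine mild_congr hst (ae_of_all _ fun r hr => ?_)
  rw [h r hr.1.le]
  rfl

lemma IsPerturbedEvolution.congr {V : ℝ → ℝ → H →L[𝕜] H} {D D' : ℝ → H →L[𝕜] H}
    (hV : IsPerturbedEvolution Y D V) (h : ∀ t, 0 ≤ t → D t = D' t) :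
    IsPerturbedEvolution Y D' V := by
  refine ⟨hV.isEvolutionOperator, fun s t hs hst w => ?_, fun s t hs hst w => ?_⟩
  · refine (hV.intervalIntegrable s t hs hst w).congr ?_
    intro r hr
    rw [Set.uIoc_of_le hst] at hr
    simp only [h r (hs.trans hr.1.le)]
  · rw [hV.eq_add_integral s t hs hst w]
    congr 1
    refine intervalIntegral.integral_congr fun r hr => ?_
    rw [Set.uIcc_of_le hst] at hr
    simp only [h r (hs.trans hr.1)]

/-- Minimal values are unique, so the quadratic forms agree. -/
lemma IsOptimalCostOperator.eq [CompleteSpace H] {P Q : ℝ → H →L[𝕜] H} (hP : IsOptimalCostOperator Y B W R P)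
    (hQ : IsOptimalCostOperator Y B W R Q) {s : ℝ} (hs : 0 ≤ s) : P s = Q s := by
  refine eq_of_re_inner_eq (hP s hs).1 (hQ s hs).1 fun x => ?_
  have h := ((hP s hs).2 x).unique ((hQ s hs).2 x)
  exact (ENNReal.ofReal_eq_ofReal_iff ((hP s hs).1.re_inner_nonneg_left x)
    ((hQ s hs).1.re_inner_nonneg_left x)).1 h

variable [CompleteSpace H]

/-- Controls of finite cost correspond to square integrable signals. -/
lemma exists_signal_of_infiniteCost_ne_top (hY : IsEvolutionOperator Y) (hYb : IsLocallyBounded Y)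
    (hB' : IsBoundedContinuous fun t => B t ∘L S' t) (hC : IsBoundedContinuous C)
    (hS : IsBoundedContinuous S)
    (hCW : ∀ t, 0 ≤ t → ∀ z, RCLike.re (inner 𝕜 z (W t z)) = ‖C t z‖ ^ 2)
    (hSR : ∀ t, 0 ≤ t → ∀ v, RCLike.re (inner 𝕜 v (R t v)) = ‖S t v‖ ^ 2)
    (hinv : ∀ t, 0 ≤ t → ∀ v, S' t (S t v) = v) {s : ℝ} (hs : 0 ≤ s) (x : H) {u : ℝ → X}
    (hu : AEStronglyMeasurable u (volume.restrict (Set.Ici s)))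
    (hcost : infiniteCost Y B W R s x u ≠ ⊤) :
    ∃ φ : Lp (WithLp 2 (H × X)) 2 (volume : Measure ℝ),
      (x, φ) ∈ outputGraph hY hYb hB' C hs ∧
      ENNReal.ofReal (‖φ‖ ^ 2) = infiniteCost Y B W R s x u := by
  have hsub : Set.Ici s ⊆ Set.Ici 0 := Set.Ici_subset_Ici.2 hs
  set z := trajectory Y B s x u with hz
  have hJ : infiniteCost Y B W R s x u
      = ∫⁻ r in Set.Ici s, ENNReal.ofReal (‖C r (z r)‖ ^ 2 + ‖S r (u r)‖ ^ 2) := by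
    refine setLIntegral_congr_fun measurableSet_Ici fun r hr => ?_
    simp only [hCW r (hsub hr), hSR r (hsub hr), ← hz]
  have hSu : AEStronglyMeasurable (fun r => S r (u r)) (volume.restrict (Set.Ici s)) :=
    aestronglyMeasurable_clm_apply (fun v =>
      ((hS.1.mono hsub).clm_apply continuousOn_const).aestronglyMeasurable measurableSet_Ici) hu
  -- The normalised control S u, extended by zero. Finite cost makes it square integrable, hence z
  -- continuous and the output measurable.
  set v : ℝ → X := Set.indicator (Set.Ici s) fun r => S r (u r) with hv
  have hvL : MemLp v 2 volume := by
    refine memLp_two_of_lintegral_norm_sq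
      ((aestronglyMeasurable_indicator_iff measurableSet_Ici).2 hSu) (ne_top_of_le_ne_top hcost ?_)
    rw [hJ, ← lintegral_indicator measurableSet_Ici]
    refine lintegral_mono fun r => ?_
    by_cases hr : r ∈ Set.Ici s
    · simp only [hv, Set.indicator_of_mem hr]
      exact ENNReal.ofReal_le_ofReal (le_add_of_nonneg_left (sq_nonneg _))
    · simp [hv, Set.indicator_of_notMem hr]
  have hzv : ∀ t, s ≤ t → z t = trajectory Y (fun r => B r ∘L S' r) s x v t := fun t ht =>
    trajectory_comp_input x ht fun r hr => by
      rw [hv, Set.indicator_of_mem (Set.mem_Ici.2 hr), hinv r (hs.trans hr)]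
  have hzc : ContinuousOn z (Set.Ici s) := by
    refine ContinuousOn.congr (continuousOn_mild_Ici hY hYb hs x fun t ht => ?_) fun t ht =>
      hzv t ht
    exact intervalIntegrable_clm_apply hB'.1 hs ht (((hvL.locallyIntegrable
      one_le_two).integrableOn_isCompact isCompact_uIcc).intervalIntegrable)
  have hCz : AEStronglyMeasurable (fun r => C r (z r)) (volume.restrict (Set.Ici s)) :=
    ((hC.1.mono hsub).clm_apply hzc).aestronglyMeasurable measurableSet_Ici
  set f : ℝ → WithLp 2 (H × X) :=
    Set.indicator (Set.Ici s) fun r => WithLp.toLp 2 (C r (z r), S r (u r)) with hf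
  have hfm : AEStronglyMeasurable f volume := by
    refine (aestronglyMeasurable_indicator_iff measurableSet_Ici).2 ?_
    exact (WithLp.prod_continuous_toLp 2 H X).comp_aestronglyMeasurable (hCz.prodMk hSu)
  have hfJ : ∫⁻ r, ENNReal.ofReal (‖f r‖ ^ 2) = infiniteCost Y B W R s x u := by
    rw [hJ, ← lintegral_indicator measurableSet_Ici]
    refine lintegral_congr fun r => ?_
    by_cases hr : r ∈ Set.Ici s
    · simp only [hf, Set.indicator_of_mem hr, WithLp.prod_norm_sq_eq_of_L2]
      rfl
    · simp [hf, Set.indicator_of_notMem hr]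
  have hfL : MemLp f 2 volume := memLp_two_of_lintegral_norm_sq hfm (hfJ ▸ hcost)
  refine ⟨hfL.toLp, toLp_mem_outputGraph _ _ _ hs hfL (ae_of_all _ fun t ht => ?_)
    (ae_of_all _ fun t ht => ?_), ?_⟩
  · exact Set.indicator_of_notMem (mt Set.mem_Ici.1 (not_le.2 ht)) _
  · rw [hf, Set.indicator_of_mem (Set.mem_Ici.2 ht)]
    change C t (z t) = _
    rw [hzv t ht]
    congr 1
    refine trajectory_congr ht (ae_of_all _ fun r hr => ?_)
    rw [hv, Set.indicator_of_mem (Set.mem_Ici.2 hr.1.le),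
      Set.indicator_of_mem (Set.mem_Ici.2 hr.1.le)]
    rfl
  · rw [← hfJ, enorm_sq_eq_lintegral]
    refine lintegral_congr_ae ?_
    filter_upwards [hfL.coeFn_toLp] with r hr
    rw [hr]

/-- Square integrable signals correspond to controls of finite cost. -/
lemma infiniteCost_eq_of_mem_outputGraph (hY : IsEvolutionOperator Y) (hYb : IsLocallyBounded Y)
    (hB' : IsBoundedContinuous fun t => B t ∘L S' t) (hS' : IsBoundedContinuous S')
    (hCW : ∀ t, 0 ≤ t → ∀ z, RCLike.re (inner 𝕜 z (W t z)) = ‖C t z‖ ^ 2)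
    (hSR : ∀ t, 0 ≤ t → ∀ v, RCLike.re (inner 𝕜 v (R t v)) = ‖S t v‖ ^ 2)
    (hinv : ∀ t, 0 ≤ t → ∀ v, S t (S' t v) = v) {s : ℝ} (hs : 0 ≤ s) (x : H)
    {φ : Lp (WithLp 2 (H × X)) 2 (volume : Measure ℝ)}
    (hφ : (x, φ) ∈ outputGraph hY hYb hB' C hs) :
    AEStronglyMeasurable (fun r => S' r (φ r).snd) (volume.restrict (Set.Ici s)) ∧
    infiniteCost Y B W R s x (fun r => S' r (φ r).snd) = ENNReal.ofReal (‖φ‖ ^ 2) := by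
  have hsub : Set.Ici s ⊆ Set.Ici 0 := Set.Ici_subset_Ici.2 hs
  constructor
  · refine aestronglyMeasurable_clm_apply (fun v =>
      ((hS'.1.mono hsub).clm_apply continuousOn_const).aestronglyMeasurable measurableSet_Ici) ?_
    exact (WithLp.sndL 2 𝕜 H X).continuous.comp_aestronglyMeasurable
      (Lp.aestronglyMeasurable φ).restrict
  · rw [enorm_sq_eq_lintegral, infiniteCost, ← lintegral_indicator measurableSet_Ici]
    refine lintegral_congr_ae ?_
    filter_upwards [(mem_outputGraph.1 hφ).1, (mem_outputGraph.1 hφ).2] with r h1 h2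
    by_cases hr : r ∈ Set.Ici s
    · have hr' : s ≤ r := hr
      rw [Set.indicator_of_mem hr, hCW r (hsub hr), hSR r (hsub hr), hinv r (hsub hr),
        WithLp.prod_norm_sq_eq_of_L2, h2 hr', trajectory_comp_input x hr' fun _ _ => rfl]
    · rw [Set.indicator_of_notMem hr, h1 (not_le.1 hr)]
      simp

/-- The optimal cost operator is `T* T`, where `T` maps an initial value to its optimal signal. -/
theorem IsOptimalSignal.isOptimalCostOperator {Z : ℝ → ℝ → H →L[𝕜] H} {K : ℝ → H →L[𝕜] X}
    {hSys : IsStabilizedSystem Y (fun t => B t ∘L S' t) C K Z} {c : ℝ}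
    {T : ℝ → H →L[𝕜] Lp (WithLp 2 (H × X)) 2 (volume : Measure ℝ)} [CompleteSpace X]
    (hT : IsOptimalSignal hSys c T)
    (hS : IsBoundedContinuous S) (hS' : IsBoundedContinuous S')
    (hCW : ∀ t, 0 ≤ t → ∀ z, RCLike.re (inner 𝕜 z (W t z)) = ‖C t z‖ ^ 2)
    (hSR : ∀ t, 0 ≤ t → ∀ v, RCLike.re (inner 𝕜 v (R t v)) = ‖S t v‖ ^ 2)
    (hinv : ∀ t, 0 ≤ t → ∀ v, S t (S' t v) = v)
    (hinv' : ∀ t, 0 ≤ t → ∀ v, S' t (S t v) = v) :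
    IsOptimalCostOperator Y B W R fun s => ContinuousLinearMap.adjoint (T s) ∘L T s := by
  intro s hs
  refine ⟨ContinuousLinearMap.isPositive_adjoint_comp_self _, fun x => ?_⟩
  have hre : RCLike.re (inner 𝕜 ((ContinuousLinearMap.adjoint (T s) ∘L T s) x) x)
      = ‖T s x‖ ^ 2 := by
    rw [ContinuousLinearMap.comp_apply, ContinuousLinearMap.adjoint_inner_left,
      inner_self_eq_norm_sq]
  rw [hre]
  constructor
  · obtain ⟨h1, h2⟩ := infiniteCost_eq_of_mem_outputGraph (W := W) (R := R) (S := S)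
      hSys.evolution hSys.isLocallyBounded hSys.input hS' hCW hSR hinv hs x (hT.mem s hs x)
    exact ⟨_, h1, h2⟩
  · rintro _ ⟨u, hu, rfl⟩
    by_cases hcost : infiniteCost Y B W R s x u = ⊤
    · rw [hcost]; exact le_top
    obtain ⟨φ, hφ, hφJ⟩ := exists_signal_of_infiniteCost_ne_top hSys.evolution
      hSys.isLocallyBounded hSys.input hSys.output hS hCW hSR hinv' hs x hu hcost
    rw [← hφJ]
    refine ENNReal.ofReal_le_ofReal ?_
    -- Any competitor is T s x plus an element of the fibre over 0, and Pythagoras gives minimality.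
    have h1 : ((0 : H), φ - T s x) ∈
        outputGraph hSys.evolution hSys.isLocallyBounded hSys.input C hs := by
      simpa using Submodule.sub_mem _ hφ (hT.mem s hs x)
    have h2 := norm_add_sq_eq_norm_sq_add_norm_sq_of_inner_eq_zero _ _
      (hT.inner_eq_zero s hs x _ h1)
    rw [add_sub_cancel] at h2
    nlinarith [norm_nonneg (φ - T s x)]

end Cost

/-! ### Inverse square roots of the control weight -/

section InverseSqrt

variable {𝕜 X : Type*} [RCLike 𝕜] [NormedAddCommGroup X] [InnerProductSpace 𝕜 X] [CompleteSpace X]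

lemma isUnit_of_coercive {R : X →L[𝕜] X} {δ : ℝ} (hδ : 0 < δ)
    (h : ∀ v, δ * ‖v‖ ^ 2 ≤ RCLike.re (inner 𝕜 v (R v))) : IsUnit R := by
  refine ContinuousLinearMap.isUnit_of_forall_le_norm_inner_map R (c := ⟨δ, hδ.le⟩) hδ fun v => ?_
  have h1 := (h v).trans (RCLike.re_le_norm _)
  rw [norm_inner_symm] at h1
  rw [mul_comm]
  exact h1

/-- The inverse square root of a coercive operator. -/
lemma inverse_posSqrt {R : X →L[𝕜] X} (hpos : R.IsPositive) (hu : IsUnit R) :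
    posSqrt R * (R.inverse * posSqrt R) = 1 ∧ R.inverse * posSqrt R * posSqrt R = 1 ∧
      R.inverse * posSqrt R * (R.inverse * posSqrt R) = R.inverse ∧
      ContinuousLinearMap.adjoint (R.inverse * posSqrt R) = R.inverse * posSqrt R := by
  have hSS := posSqrt_mul_self hpos
  set S := posSqrt R with hS
  set I := R.inverse with hI
  have hI' : I = Ring.inverse R := by rw [ContinuousLinearMap.ringInverse_eq_inverse]
  have h1 : I * R = 1 := by rw [hI', Ring.inverse_mul_cancel _ hu]
  have h2 : R * I = 1 := by rw [hI', Ring.mul_inverse_cancel _ hu]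
  have h3 : I * S * S = 1 := by rw [mul_assoc, hSS, h1]
  have h4 : S * (S * I) = 1 := by rw [← mul_assoc, hSS, h2]
  -- I S is a left inverse and S I a right inverse of S, so they coincide and S is invertible.
  have h5 : I * S = S * I := left_inv_eq_right_inv h3 h4
  have h6 : S * (I * S) = 1 := by rw [h5, h4]
  refine ⟨h6, h3, ?_, ?_⟩
  · rw [mul_assoc, h6, mul_one]
  · have hSs : star S = S := (posSqrt_isPositive hpos).isSelfAdjoint
    rw [← ContinuousLinearMap.star_eq_adjoint]
    refine left_inv_eq_right_inv (a := S) ?_ h6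
    nth_rewrite 2 [← hSs]
    rw [← star_mul, h6, star_one]

lemma isPositive_of_coercive {R : X →L[𝕜] X} (hR : IsSelfAdjoint R) {δ : ℝ} (hδ : 0 < δ)
    (h : ∀ v, δ * ‖v‖ ^ 2 ≤ RCLike.re (inner 𝕜 v (R v))) : R.IsPositive := by
  rw [ContinuousLinearMap.isPositive_def']
  refine ⟨hR, fun v => ?_⟩
  rw [ContinuousLinearMap.reApplyInnerSelf_apply, inner_re_symm]
  exact (by positivity : 0 ≤ δ * ‖v‖ ^ 2).trans (h v)

/-- Coercivity at R^{-1/2} v reads δ‖R^{-1/2} v‖² ≤ ‖R^{1/2} R^{-1/2} v‖² = ‖v‖². -/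
lemma norm_inverse_posSqrt_le {R : X →L[𝕜] X} (hR : R.IsPositive) {δ : ℝ} (hδ : 0 < δ)
    (h : ∀ v, δ * ‖v‖ ^ 2 ≤ RCLike.re (inner 𝕜 v (R v))) :
    ‖R.inverse * posSqrt R‖ ≤ (√δ)⁻¹ := by
  refine ContinuousLinearMap.opNorm_le_bound _ (by positivity) fun v => ?_
  have h1 := h ((R.inverse * posSqrt R) v)
  rw [← norm_posSqrt_apply_sq hR, ← mul_apply_eq_comp,
    (inverse_posSqrt hR (isUnit_of_coercive hδ h)).1, one_apply_eq_self] at h1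
  rw [← div_eq_inv_mul, le_div_iff₀ (Real.sqrt_pos.2 hδ)]
  refine le_of_sq_le_sq ?_ (norm_nonneg v)
  rw [mul_pow, Real.sq_sqrt hδ.le, mul_comm]
  exact h1

lemma IsBoundedContinuous.inverse_posSqrt {R : ℝ → X →L[𝕜] X} (hR : IsBoundedContinuous R)
    (hpos : ∀ t, 0 ≤ t → (R t).IsPositive) {δ : ℝ} (hδ : 0 < δ)
    (h : ∀ t, 0 ≤ t → ∀ v, δ * ‖v‖ ^ 2 ≤ RCLike.re (inner 𝕜 v (R t v))) :
    IsBoundedContinuous fun t => (R t).inverse * InfiniteHorizonLQ.posSqrt (R t) := by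
  refine ⟨ContinuousOn.mul (fun t ht => ?_) (hR.posSqrt hpos).1, (√δ)⁻¹, fun t ht =>
    norm_inverse_posSqrt_le (hpos t ht) hδ (h t ht)⟩
  obtain ⟨a, ha⟩ := isUnit_of_coercive hδ (h t ht)
  have h1 : ContinuousAt ContinuousLinearMap.inverse (R t) := by
    rw [← ContinuousLinearMap.ringInverse_eq_inverse, ← ha]
    exact NormedRing.inverse_continuousAt a
  exact h1.comp_continuousWithinAt (hR.1 t ht)

end InverseSqrt

end InfiniteHorizonLQ

/-! ### The theorem, by reduction to the normalised system -/

theorem mainTheorem4 {𝕜 H X : Type*} [RCLike 𝕜]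
    [NormedAddCommGroup H] [InnerProductSpace 𝕜 H] [CompleteSpace H]
    [NormedSpace ℝ H] [IsScalarTower ℝ 𝕜 H]
    [NormedAddCommGroup X] [InnerProductSpace 𝕜 X] [CompleteSpace X]
    (Y : ℝ → ℝ → H →L[𝕜] H) (B : ℝ → X →L[𝕜] H)
    (W : ℝ → H →L[𝕜] H) (R : ℝ → X →L[𝕜] X)
    (hY : InfiniteHorizonLQ.IsEvolutionOperator Y)
    (hB : InfiniteHorizonLQ.IsBoundedContinuous B)
    (hW : InfiniteHorizonLQ.IsBoundedContinuous W)
    (hW_nonneg : ∀ t, 0 ≤ t → (W t).IsPositive)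
    (hR : InfiniteHorizonLQ.IsBoundedContinuous R)
    (hR_selfAdjoint : ∀ t, 0 ≤ t → IsSelfAdjoint (R t))
    (hR_coercive : ∃ δ : ℝ, 0 < δ ∧ ∀ t, 0 ≤ t → ∀ v : X,
      δ * ‖v‖ ^ 2 ≤ RCLike.re (inner 𝕜 v (R t v)))
    (hstab : InfiniteHorizonLQ.IsUniformlyStabilizable Y B)
    (hdet : InfiniteHorizonLQ.IsUniformlyDetectable Y
      (fun t => InfiniteHorizonLQ.posSqrt (W t))) :
    (∃ P : ℝ → H →L[𝕜] H, InfiniteHorizonLQ.IsOptimalCostOperator Y B W R P) ∧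
    ∀ P : ℝ → H →L[𝕜] H, InfiniteHorizonLQ.IsOptimalCostOperator Y B W R P →
      (∃ V : ℝ → ℝ → H →L[𝕜] H, InfiniteHorizonLQ.IsPerturbedEvolution Y
        (fun t => -(B t ∘L InfiniteHorizonLQ.feedback B R P t)) V) ∧
      ∀ V : ℝ → ℝ → H →L[𝕜] H, InfiniteHorizonLQ.IsPerturbedEvolution Y
        (fun t => -(B t ∘L InfiniteHorizonLQ.feedback B R P t)) V →
        InfiniteHorizonLQ.IsExponentiallyStable V := by
  obtain ⟨δ, hδ, hRδ⟩ := hR_coercive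
  obtain ⟨K, hK, Z, hZ, hZs⟩ := hstab
  have hRpos : ∀ t, 0 ≤ t → (R t).IsPositive := fun t ht =>
    InfiniteHorizonLQ.isPositive_of_coercive (hR_selfAdjoint t ht) hδ (hRδ t ht)
  have hinv := fun t ht => InfiniteHorizonLQ.inverse_posSqrt (hRpos t ht)
    (InfiniteHorizonLQ.isUnit_of_coercive hδ (hRδ t ht))
  have hS := hR.posSqrt hRpos
  have hS' := hR.inverse_posSqrt hRpos hδ hRδ
  -- In the normalised system the input operator is B R^{-1/2} and the feedback R^{1/2} K; their
  -- product is still B K, so Z remains its closed loop.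
  have hSys : InfiniteHorizonLQ.IsStabilizedSystem Y
      (fun t => B t ∘L ((R t).inverse * InfiniteHorizonLQ.posSqrt (R t)))
      (fun t => InfiniteHorizonLQ.posSqrt (W t))
      (fun t => InfiniteHorizonLQ.posSqrt (R t) ∘L K t) Z :=
    ⟨hY, hB.comp hS', hW.posSqrt hW_nonneg, hS.comp hK, hZ.congr fun t ht => by
      ext x
      exact congrArg (B t) (DFunLike.congr_fun (hinv t ht).2.1 (K t x)).symm, hZs⟩
  obtain ⟨c, T, hc, hT⟩ := hSys.exists_optimalSignal
  have hTo : InfiniteHorizonLQ.IsOptimalSignal hSys c T :=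
    ⟨hc, fun s hs => (hT s hs).1, fun s hs => (hT s hs).2.1, fun s hs => (hT s hs).2.2⟩
  have hP := hTo.isOptimalCostOperator (W := W) (R := R) hS hS'
    (fun t ht z => (InfiniteHorizonLQ.norm_posSqrt_apply_sq (hW_nonneg t ht) z).symm)
    (fun t ht v => (InfiniteHorizonLQ.norm_posSqrt_apply_sq (hRpos t ht) v).symm)
    (fun t ht => DFunLike.congr_fun (hinv t ht).1) (fun t ht => DFunLike.congr_fun (hinv t ht).2.1)
  refine ⟨⟨_, hP⟩, fun P hPo => hTo.exists_perturbed_and_stable hdet fun t ht => ?_⟩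
  -- P equals T* T, and R^{-1/2} is self-adjoint with square R^{-1}, so B K_∞ = B R^{-1} B* P is the
  -- normalised feedback B' B'* T* T.
  rw [InfiniteHorizonLQ.feedback, hPo.eq hP ht, ContinuousLinearMap.adjoint_comp,
    (hinv t ht).2.2.2]
  ext x
  exact congrArg (fun v => -(B t v)) (DFunLike.congr_fun (hinv t ht).2.2.1
    (ContinuousLinearMap.adjoint (B t) (ContinuousLinearMap.adjoint (T t) (T t x)))).symm
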